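/- All rings are unital. For a countable first-order language $\mathcal L$, let $\mathrm{Str}_{\mathcal L}$ be the space of $\mathcal L$-structures with universe $\omega$ with its natural (Polish) topology, and for a countable set $T$ of $\mathcal L_{\omega_1\omega}$-sentences let $\mathrm{Mod}(T)\subseteq \mathrm{Str}_{\mathcal L}$ be the set of its models. For such $T$ in $\mathcal L$ and $S$ in $\mathcal L'$, write $S\le_B T$ if there is a Borel map $f:\mathrm{Mod}(S)\to\mathrm{Mod}(T)$ such that $f(M)\cong f(N)$ if and only if $M\cong N$, for all $M,N\in\mathrm{Mod}(S)$. Call $T$ Borel complete if $S\le_B T$ for every countable set $S$ of $\mathcal L'_{\omega_1\omega}$-sentences in every countable language $\mathcal L'$. Theorem. Let $R$ be a countable commutative local ring, that is, a countable commutative ring with a unique maximal ideal. If the theory of $R$-modules, in the language $\{+,0\}\cup\{r\cdot{} : r\in R\}$, is not Borel complete, then $R$ is an Artinian principal ideal ring, that is, $R$ is Artinian and every ideal of $R$ is generated by a single element. -/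

import Mathlib

namespace CountableModels

universe u v u' v'

/-! ### The space of structures with universe `ℕ` -/

/-- The set of all `L`-structures with universe `ℕ`. -/
def Str (L : FirstOrder.Language.{u, v}) : Type (max u v) := L.Structure ℕ

/-- The natural topology on `Str L`: the coarsest one for which the value `f(x)` of each function
symbol at each tuple, and the truth value of each relation symbol at each tuple, are continuous
maps into discrete spaces. -/
instance Str.instTopologicalSpace (L : FirstOrder.Language.{u, v}) : TopologicalSpace (Str L) :=
  TopologicalSpace.generateFrom
    ({U | ∃ (n : ℕ) (f : L.Functions n) (x : Fin n → ℕ) (y : ℕ),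
          U = {M : Str L | M.funMap f x = y}} ∪
      {U | ∃ (n : ℕ) (r : L.Relations n) (x : Fin n → ℕ),
          U = {M : Str L | M.RelMap r x} ∨ U = {M : Str L | ¬ M.RelMap r x}})

/-- `Str L` carries its Borel sets. -/
instance Str.instMeasurableSpace (L : FirstOrder.Language.{u, v}) : MeasurableSpace (Str L) :=
  borel (Str L)

/-- Isomorphism of `L`-structures with universe `ℕ`. -/
def Str.Iso {L : FirstOrder.Language.{u, v}} (M N : Str L) : Prop :=
  Nonempty (@FirstOrder.Language.Equiv L ℕ ℕ M N)

/-! ### The infinitary logic `L_{ω₁ω}` -/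

/-- Formulas of `L_{ω₁ω}` whose free variables are among `v₀, …, v_{n-1}`: negation, countable
conjunction and quantification over a single variable. -/
inductive InfFormula (L : FirstOrder.Language.{u, v}) : ℕ → Type (max u v)
  | equal {n : ℕ} (s t : L.Term (Fin n)) : InfFormula L n
  | rel {n k : ℕ} (r : L.Relations k) (ts : Fin k → L.Term (Fin n)) : InfFormula L n
  | neg {n : ℕ} (φ : InfFormula L n) : InfFormula L n
  | conj {n : ℕ} (φ : ℕ → InfFormula L n) : InfFormula L n
  | all {n : ℕ} (φ : InfFormula L (n + 1)) : InfFormula L n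

/-- `∃ vₙ, φ`. -/
def InfFormula.ex {L : FirstOrder.Language.{u, v}} {n : ℕ} (φ : InfFormula L (n + 1)) : InfFormula L n :=
  .neg (.all (.neg φ))

/-- Satisfaction of an `L_{ω₁ω}`-formula. -/
def InfFormula.Realize {L : FirstOrder.Language.{u, v}} (M : Str L) :
    {n : ℕ} → InfFormula L n → (Fin n → ℕ) → Prop
  | _, .equal s t, x => @FirstOrder.Language.Term.realize L ℕ M _ x s = @FirstOrder.Language.Term.realize L ℕ M _ x t
  | _, .rel r ts, x => M.RelMap r fun i => @FirstOrder.Language.Term.realize L ℕ M _ x (ts i)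
  | _, .neg φ, x => ¬ φ.Realize M x
  | _, .conj φ, x => ∀ i, (φ i).Realize M x
  | _, .all φ, x => ∀ a : ℕ, φ.Realize M (Fin.snoc x a)

/-- A set of `L_{ω₁ω}`-sentences. -/
abbrev InfTheory (L : FirstOrder.Language.{u, v}) : Type (max u v) := Set (InfFormula L 0)

/-- `Mod(T)`: the models of `T` with universe `ℕ`. -/
def Mod {L : FirstOrder.Language.{u, v}} (T : InfTheory L) : Set (Str L) :=
  {M | ∀ φ ∈ T, φ.Realize M Fin.elim0}

/-! ### Borel reducibility -/

/-- `T ≤_B S`: there is a Borel map `Mod(T) → Mod(S)` that preserves and reflects isomorphism. -/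
def BorelReducible {L : FirstOrder.Language.{u, v}} {L' : FirstOrder.Language.{u', v'}}
    (T : InfTheory L) (S : InfTheory L') : Prop :=
  ∃ f : Mod T → Mod S, Measurable f ∧
    ∀ M N : Mod T, (f M : Str L').Iso (f N) ↔ (M : Str L).Iso N

/-- `T` is Borel complete: it is maximal for Borel reducibility, that is, every countable theory of
`L'_{ω₁ω}`, for every countable language `L'`, is Borel reducible to `T`. -/
def BorelComplete {L : FirstOrder.Language.{u, v}} (T : InfTheory L) : Prop :=
  ∀ (L' : FirstOrder.Language.{0, 0}) [Countable L'.Symbols] (S : InfTheory L'), S.Countable →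
    BorelReducible S T

/-! ### The theory of `R`-modules -/

/-- The symbols `0`, `+` and `r · _` (for `r ∈ R`) of the language of `R`-modules. -/
inductive ModuleFunc (R : Type u) : ℕ → Type u
  | zero : ModuleFunc R 0
  | add : ModuleFunc R 2
  | smul (r : R) : ModuleFunc R 1

/-- The language of `R`-modules. -/
def moduleLang (R : Type u) : FirstOrder.Language.{u, 0} := ⟨ModuleFunc R, fun _ => Empty⟩

section Terms

variable {R : Type u} {n : ℕ}

/-- The variable `vᵢ`. -/
def tvar (i : Fin n) : (moduleLang R).Term (Fin n) := .var i

/-- The term `0`. -/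
def tzero : (moduleLang R).Term (Fin n) := .func (l := 0) ModuleFunc.zero ![]

/-- The term `s + t`. -/
def tadd (s t : (moduleLang R).Term (Fin n)) : (moduleLang R).Term (Fin n) :=
  .func (l := 2) ModuleFunc.add ![s, t]

/-- The term `r · t`. -/
def tsmul (r : R) (t : (moduleLang R).Term (Fin n)) : (moduleLang R).Term (Fin n) :=
  .func (l := 1) (ModuleFunc.smul r) ![t]

end Terms

open InfFormula in
/-- The axioms of (left, unital) `R`-modules. -/
inductive ModuleAxiom (R : Type u) [Ring R] : InfFormula (moduleLang R) 0 → Prop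
  | add_assoc : ModuleAxiom R (all (all (all (equal
      (tadd (tadd (tvar 0) (tvar 1)) (tvar 2)) (tadd (tvar 0) (tadd (tvar 1) (tvar 2)))))))
  | add_comm : ModuleAxiom R (all (all (equal (tadd (tvar 0) (tvar 1)) (tadd (tvar 1) (tvar 0)))))
  | add_zero : ModuleAxiom R (all (equal (tadd (tvar 0) tzero) (tvar 0)))
  | add_neg : ModuleAxiom R (all (ex (equal (tadd (tvar 0) (tvar 1)) tzero)))
  | smul_add (r : R) : ModuleAxiom R (all (all (equal
      (tsmul r (tadd (tvar 0) (tvar 1))) (tadd (tsmul r (tvar 0)) (tsmul r (tvar 1))))))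
  | add_smul (r s : R) : ModuleAxiom R (all (equal
      (tsmul (r + s) (tvar 0)) (tadd (tsmul r (tvar 0)) (tsmul s (tvar 0)))))
  | mul_smul (r s : R) : ModuleAxiom R (all (equal
      (tsmul (r * s) (tvar 0)) (tsmul r (tsmul s (tvar 0)))))
  | one_smul : ModuleAxiom R (all (equal (tsmul 1 (tvar 0)) (tvar 0)))

/-- The theory of `R`-modules. -/
def moduleTheory (R : Type u) [Ring R] : InfTheory (moduleLang R) := {φ | ModuleAxiom R φ}

section Semantics

variable {R : Type u}

/-- The zero of a structure for the language of `R`-modules. -/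
def mzero (M : Str (moduleLang R)) : ℕ := M.funMap (n := 0) ModuleFunc.zero ![]

/-- The addition of a structure for the language of `R`-modules. -/
def madd (M : Str (moduleLang R)) (a b : ℕ) : ℕ := M.funMap (n := 2) ModuleFunc.add ![a, b]

/-- The scalar multiplication of a structure for the language of `R`-modules. -/
def msmul (M : Str (moduleLang R)) (r : R) (a : ℕ) : ℕ :=
  M.funMap (n := 1) (ModuleFunc.smul r) ![a]

variable {n : ℕ} (M : Str (moduleLang R)) (x : Fin n → ℕ)

theorem realize_tvar (i : Fin n) :
    @FirstOrder.Language.Term.realize (moduleLang R) ℕ M _ x (tvar i) = x i := rfl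

theorem realize_tzero :
    @FirstOrder.Language.Term.realize (moduleLang R) ℕ M _ x tzero = mzero M := by
  simp only [tzero, mzero, FirstOrder.Language.Term.realize]
  congr 1
  exact Subsingleton.elim _ _

theorem realize_tadd (s t : (moduleLang R).Term (Fin n)) :
    @FirstOrder.Language.Term.realize (moduleLang R) ℕ M _ x (tadd s t) =
      madd M (@FirstOrder.Language.Term.realize (moduleLang R) ℕ M _ x s)
        (@FirstOrder.Language.Term.realize (moduleLang R) ℕ M _ x t) := by
  simp only [tadd, madd, FirstOrder.Language.Term.realize]
  congr 1
  funext i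
  fin_cases i <;> rfl

theorem realize_tsmul (r : R) (t : (moduleLang R).Term (Fin n)) :
    @FirstOrder.Language.Term.realize (moduleLang R) ℕ M _ x (tsmul r t) =
      msmul M r (@FirstOrder.Language.Term.realize (moduleLang R) ℕ M _ x t) := by
  simp only [tsmul, msmul, FirstOrder.Language.Term.realize]
  congr 1
  funext i
  fin_cases i
  rfl

/-- The models of the theory of `R`-modules with universe `ℕ` are the `R`-module structures
on `ℕ`. -/
theorem mem_Mod_moduleTheory [Ring R] :
    M ∈ Mod (moduleTheory R) ↔
      (∀ a b c, madd M (madd M a b) c = madd M a (madd M b c)) ∧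
      (∀ a b, madd M a b = madd M b a) ∧
      (∀ a, madd M a (mzero M) = a) ∧
      (∀ a, ∃ b, madd M a b = mzero M) ∧
      (∀ r a b, msmul M r (madd M a b) = madd M (msmul M r a) (msmul M r b)) ∧
      (∀ r s a, msmul M (r + s) a = madd M (msmul M r a) (msmul M s a)) ∧
      (∀ r s a, msmul M (r * s) a = msmul M r (msmul M s a)) ∧
      (∀ a, msmul M 1 a = a) := by
  have s10 (x : Fin 0 → ℕ) (a : ℕ) : (Fin.snoc x a : Fin 1 → ℕ) 0 = a := rfl
  have s20 (x : Fin 0 → ℕ) (a b : ℕ) :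
    (Fin.snoc (Fin.snoc x a : Fin 1 → ℕ) b : Fin 2 → ℕ) 0 = a := rfl
  have s21 (x : Fin 0 → ℕ) (a b : ℕ) :
    (Fin.snoc (Fin.snoc x a : Fin 1 → ℕ) b : Fin 2 → ℕ) 1 = b := rfl
  have s30 (x : Fin 0 → ℕ) (a b c : ℕ) :
    (Fin.snoc (Fin.snoc (Fin.snoc x a : Fin 1 → ℕ) b : Fin 2 → ℕ) c : Fin 3 → ℕ) 0 = a := rfl
  have s31 (x : Fin 0 → ℕ) (a b c : ℕ) :
    (Fin.snoc (Fin.snoc (Fin.snoc x a : Fin 1 → ℕ) b : Fin 2 → ℕ) c : Fin 3 → ℕ) 1 = b := rfl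
  have s32 (x : Fin 0 → ℕ) (a b c : ℕ) :
    (Fin.snoc (Fin.snoc (Fin.snoc x a : Fin 1 → ℕ) b : Fin 2 → ℕ) c : Fin 3 → ℕ) 2 = c := rfl
  constructor
  · intro h
    have h' : ∀ φ, ModuleAxiom R φ → φ.Realize M Fin.elim0 := h
    refine ⟨?_, ?_, ?_, ?_, ?_, ?_, ?_, ?_⟩
    · simpa only [InfFormula.Realize, realize_tadd, realize_tvar, s30, s31, s32]
        using h' _ .add_assoc
    · simpa only [InfFormula.Realize, realize_tadd, realize_tvar, s20, s21] using h' _ .add_comm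
    · simpa only [InfFormula.Realize, realize_tadd, realize_tvar, realize_tzero, s10]
        using h' _ .add_zero
    · simpa only [InfFormula.ex, InfFormula.Realize, realize_tadd, realize_tvar, realize_tzero,
        s20, s21, not_forall, not_not] using h' _ .add_neg
    · intro r
      simpa only [InfFormula.Realize, realize_tadd, realize_tvar, realize_tsmul, s20, s21]
        using h' _ (.smul_add r)
    · intro r s
      simpa only [InfFormula.Realize, realize_tadd, realize_tvar, realize_tsmul, s10]
        using h' _ (.add_smul r s)
    · intro r s
      simpa only [InfFormula.Realize, realize_tvar, realize_tsmul, s10]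
        using h' _ (.mul_smul r s)
    · simpa only [InfFormula.Realize, realize_tvar, realize_tsmul, s10] using h' _ .one_smul
  · rintro ⟨h1, h2, h3, h4, h5, h6, h7, h8⟩ φ (hφ : ModuleAxiom R φ)
    cases hφ <;>
      simp only [InfFormula.ex, InfFormula.Realize, realize_tadd, realize_tvar, realize_tsmul,
        realize_tzero, s10, s20, s21, s30, s31, s32, not_forall, not_not]
    · exact h1
    · exact h2
    · exact h3
    · exact h4
    · exact h5 _
    · exact h6 _ _
    · exact h7 _ _
    · exact h8

end Semantics

end CountableModels

/-! ### Unique products in free groups and units of their group algebras -/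

namespace CountableModels

/-! The contrapositive is proved: unless `R` is Artinian and principal, `R`-modules can encode free
modules with countably many operators, and these already encode all countable structures.

A structure on `ℕ` is the set `E` of its atomic facts, which are tagged finite tuples; an
isomorphism is a permutation `π` of `ℕ` that carries `E` to `E'`. In the free module on
`BlockBasis`, each block `n` contains a copy of the free group on the transpositions and a copy of
all possible facts, while only the facts in `E` occur globally. A group element acts on `ℕ` with
finite support, so it cannot equal a general `π`; but block `n` can use some `u n` that agrees with
`π` below `n`. A fact mentions finitely many numbers, so each global fact needs only finitely many
corrections (`glue`). Conversely, the operators force an isomorphism over a domain `k` to act on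
block `n` as a unit of the group algebra. Such a unit is a scalar times a group element `u n`,
because free groups have two unique products. Finite support of the image of a global fact makes `u
n` eventually constant on it, and the limit is `π`. The forward direction holds over `ℤ`, the
backward one over every domain; `CodesOperator` exploits this slack, and
`CodesOperators.borelComplete` turns it into a Borel reduction.

To encode operators in `R`-modules, take the `R`-span of the basis elements `b` and of the graph
vectors `ξ c • b + η c • op c b`, with `ξ`, `η` in an extension of `R`. If these scalars are
independent enough, linear maps respect the operators after reduction to `k`. For a domain with a
prime `p` such that only `0` is divisible by all powers of `p`, algebraically independent elements
of the `p`-adic completion serve (`codesOperators_of_prime`). For a local ring with total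
divisibility and nonprincipal maximal ideal, they are replaced by sequences of partial sums
(`codesOperators_of_dvd_total`). If neither of `a`, `b` divides the other, multiplication by `X` on
a module over the polynomial ring of the residue field is recovered as "`b / a`", so
`codesOperators_of_prime` with the prime `X` applies (`codesOperators_of_not_dvd`). If the maximal
ideal is generated by a non-nilpotent `p`, factoring out the elements divisible by all `p ^ n` gives
a domain with prime `p`. The only case left is a nilpotent generator, and then every element is a
unit times a power of `p`. -/

theorem IsFreeGroup.exists_hom_ne_one (G : Type*) [Group G] [IsFreeGroup G] [Nontrivial G] :
    ∃ φ : G →* Multiplicative ℤ, ∃ g, φ g ≠ 1 := by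
  rcases isEmpty_or_nonempty (IsFreeGroup.Generators G) with h | ⟨⟨x⟩⟩
  · obtain ⟨g, hg⟩ := exists_ne (1 : G)
    have : MonoidHom.id G = 1 := IsFreeGroup.ext_hom fun a => h.elim a
    exact absurd (DFunLike.congr_fun this g) hg
  · refine ⟨IsFreeGroup.lift fun _ => Multiplicative.ofAdd 1, IsFreeGroup.of x, ?_⟩
    rw [IsFreeGroup.lift_of]
    decide

/-- Free groups are locally indicable. After translating `1` into both sets, map the subgroup they
generate nontrivially to `ℤ`, choose a unique product of the images, and recurse into the two fibres
above it, which are smaller in total. -/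
theorem exists_uniqueMul_of_isFreeGroup (n : ℕ) : ∀ (G : Type) [Group G] [IsFreeGroup G]
    (A B : Finset G), A.card + B.card ≤ n → A.Nonempty → B.Nonempty →
      ∃ a ∈ A, ∃ b ∈ B, UniqueMul A B a b := by
  classical
  induction n with
  | zero =>
    intro G _ _ A B h hA
    have := hA.card_pos
    omega
  | succ n ih =>
    intro G _ _ A B hn ⟨a, ha⟩ ⟨b, hb⟩
    by_cases hc : A.card ≤ 1 ∧ B.card ≤ 1
    · exact ⟨a, ha, b, hb, by
        have := UniqueMul.of_card_le_one ⟨a, ha⟩ ⟨b, hb⟩ hc.1 hc.2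
        obtain ⟨a', ha', b', hb', h⟩ := this
        rwa [Finset.card_le_one.1 hc.1 a ha a' ha', Finset.card_le_one.1 hc.2 b hb b' hb']⟩
    set A1 := A.image (a⁻¹ * ·) with hA1
    set B1 := B.image (· * b⁻¹) with hB1
    have hA1c : A1.card = A.card := Finset.card_image_of_injective _ (mul_right_injective _)
    have hB1c : B1.card = B.card := Finset.card_image_of_injective _ (mul_left_injective _)
    have h1A : (1 : G) ∈ A1 := Finset.mem_image.2 ⟨a, ha, by simp⟩
    have h1B : (1 : G) ∈ B1 := Finset.mem_image.2 ⟨b, hb, by simp⟩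
    suffices h : ∃ a ∈ A1, ∃ b ∈ B1, UniqueMul A1 B1 a b by
      obtain ⟨x, hx, y, hy, h⟩ := h
      obtain ⟨x, hx', rfl⟩ := Finset.mem_image.1 hx
      obtain ⟨y, hy', rfl⟩ := Finset.mem_image.1 hy
      refine ⟨_, hx', _, hy', fun x' y' hx' hy' he => ?_⟩
      have := @h (a⁻¹ * x') (y' * b⁻¹) (Finset.mem_image_of_mem _ hx')
        (Finset.mem_image_of_mem _ hy')
        (by rw [mul_assoc, ← mul_assoc x', he]; simp only [mul_assoc])
      simpa using this
    -- `K` is free by Nielsen–Schreier; the induction quantifies over all free groups so that it can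
    -- be applied to `K`.
    let K := Subgroup.closure ((A1 ∪ B1 : Finset G) : Set G)
    have hK : ∀ x ∈ A1 ∪ B1, x ∈ K := fun x hx => Subgroup.subset_closure hx
    have : Nontrivial K := by
      by_contra hK'
      rw [not_nontrivial_iff_subsingleton] at hK'
      have h1 : ∀ x ∈ A1 ∪ B1, x = 1 := fun x hx =>
        congrArg Subtype.val (Subsingleton.elim (⟨x, hK x hx⟩ : K) 1)
      apply hc
      rw [← hA1c, ← hB1c]
      constructor <;> refine Finset.card_le_one.2 fun x hx y hy => ?_ <;>
        rw [h1 x (by simp [hx]), h1 y (by simp [hy])]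
    obtain ⟨φ, g, hg⟩ := IsFreeGroup.exists_hom_ne_one K
    let A2 : Finset K := A1.subtype (· ∈ K)
    let B2 : Finset K := B1.subtype (· ∈ K)
    have hA2c : A2.card ≤ A.card := by
      rw [← hA1c, Finset.card_subtype]; exact Finset.card_filter_le _ _
    have hB2c : B2.card ≤ B.card := by
      rw [← hB1c, Finset.card_subtype]; exact Finset.card_filter_le _ _
    have h1A2 : (1 : K) ∈ A2 := Finset.mem_subtype.2 h1A
    have h1B2 : (1 : K) ∈ B2 := Finset.mem_subtype.2 h1B
    have hne : ∃ x ∈ A2 ∪ B2, φ x ≠ 1 := by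
      by_contra! hcon
      have hle : (⊤ : Subgroup K) ≤ φ.ker := by
        rw [← Subgroup.closure_closure_coe_preimage
          (k := ((A1 ∪ B1 : Finset G) : Set G)), Subgroup.closure_le]
        intro x hx
        apply hcon
        simpa [A2, B2] using hx
      exact hg (hle (Subgroup.mem_top g))
    obtain ⟨aH, haH, bH, hbH, hu⟩ := UniqueProds.uniqueMul_of_nonempty
      (A := A2.image φ) (B := B2.image φ) ⟨_, Finset.mem_image_of_mem _ h1A2⟩
      ⟨_, Finset.mem_image_of_mem _ h1B2⟩
    have hcard : ∀ (C : Finset K) (c : Multiplicative ℤ), 1 ∈ C → (∃ x ∈ C, φ x ≠ 1) →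
        (C.filter (φ · = c)).card < C.card := by
      rintro C c h1 ⟨x, hx, hx1⟩
      refine Finset.card_lt_card (Finset.filter_ssubset.2 ?_)
      by_contra! hcon
      exact hx1 ((hcon x hx).trans ((hcon 1 h1).symm.trans (map_one φ)))
    -- Both sets contain `1`, so no fibre can be all of a set on which `φ` is nontrivial.
    have hlt : (A2.filter (φ · = aH)).card + (B2.filter (φ · = bH)).card < A2.card + B2.card := by
      obtain ⟨x, hx, hx1⟩ := hne
      have h3 := Finset.card_filter_le A2 (φ · = aH)
      have h4 := Finset.card_filter_le B2 (φ · = bH)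
      rcases Finset.mem_union.1 hx with hx | hx
      · have := hcard A2 aH h1A2 ⟨x, hx, hx1⟩
        omega
      · have := hcard B2 bH h1B2 ⟨x, hx, hx1⟩
        omega
    obtain ⟨aG, haG, bG, hbG, h⟩ := ih K (A2.filter (φ · = aH)) (B2.filter (φ · = bH)) (by omega)
      (by
        obtain ⟨x, hx, hxa⟩ := Finset.mem_image.1 haH
        exact ⟨x, Finset.mem_filter.2 ⟨hx, hxa⟩⟩)
      (by
        obtain ⟨x, hx, hxa⟩ := Finset.mem_image.1 hbH
        exact ⟨x, Finset.mem_filter.2 ⟨hx, hxa⟩⟩)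
    rw [Finset.mem_filter] at haG hbG
    have key : UniqueMul A2 B2 aG bG :=
      UniqueMul.of_image_filter (φ : K →ₙ* Multiplicative ℤ) haG.2 hbG.2 hu h
    refine ⟨aG, Finset.mem_subtype.1 haG.1, bG, Finset.mem_subtype.1 hbG.1,
      fun x y hx hy he => ?_⟩
    have := @key ⟨x, hK x (by simp [hx])⟩ ⟨y, hK y (by simp [hy])⟩ (Finset.mem_subtype.2 hx)
      (Finset.mem_subtype.2 hy) (Subtype.ext he)
    exact ⟨congrArg Subtype.val this.1, congrArg Subtype.val this.2⟩

instance FreeGroup.uniqueProds (α : Type) : UniqueProds (FreeGroup α) where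
  uniqueMul_of_nonempty := fun {A B} hA hB =>
    exists_uniqueMul_of_isFreeGroup _ (FreeGroup α) A B le_rfl hA hB

instance FreeGroup.twoUniqueProds (α : Type) : TwoUniqueProds (FreeGroup α) :=
  UniqueProds.toTwoUniqueProds_of_group

/-- Over a domain, the group algebra of a group with two unique products has only trivial
units. -/
theorem exists_eq_single_of_convolution_eq_one {k G : Type*} [CommRing k] [IsDomain k]
    [Group G] [TwoUniqueProds G] {α β : G →₀ k}
    (h : (α.sum fun g c => β.sum fun g' c' => Finsupp.single (g * g') (c * c')) =
      Finsupp.single 1 1) :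
    ∃ g, ∃ c, c ≠ 0 ∧ α = Finsupp.single g c := by
  classical
  have hm : (MonoidAlgebra.ofCoeff α * MonoidAlgebra.ofCoeff β).coeff = Finsupp.single 1 1 := by
    rw [← h, MonoidAlgebra.mul_def]
    simp [MonoidAlgebra.coeff_finsuppSum]
  have hα : α ≠ 0 := by
    rintro rfl
    simp [eq_comm (a := (0 : G →₀ k))] at h
  have hβ : β ≠ 0 := by
    rintro rfl
    simp [eq_comm (a := (0 : G →₀ k))] at h
  have hle : ¬ 1 < α.support.card * β.support.card := by
    intro hlt
    obtain ⟨p, hp, q, hq, hpq, hup, huq⟩ := TwoUniqueProds.uniqueMul_of_one_lt_card hlt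
    rw [Finset.mem_product, Finsupp.mem_support_iff, Finsupp.mem_support_iff] at hp hq
    -- A unique product cannot cancel in the convolution, so it must be the only element of the
    -- support of `1`; two such pairs then have equal products and coincide.
    have e : ∀ p : G × G, α p.1 ≠ 0 → β p.2 ≠ 0 → UniqueMul α.support β.support p.1 p.2 →
        p.1 * p.2 = 1 := by
      intro p ha hb hu
      have h1 := MonoidAlgebra.coeff_mul_mul_of_uniqueMul (f := MonoidAlgebra.ofCoeff α)
        (g := MonoidAlgebra.ofCoeff β) hu
      rw [hm] at h1
      by_contra hne
      rw [Finsupp.single_apply, if_neg (Ne.symm hne)] at h1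
      exact mul_ne_zero ha hb h1.symm
    have := hup (Finsupp.mem_support_iff.2 hq.1) (Finsupp.mem_support_iff.2 hq.2)
      ((e q hq.1 hq.2 huq).trans (e p hp.1 hp.2 hup).symm)
    exact hpq (Prod.ext this.1.symm this.2.symm)
  have h1 : 0 < β.support.card := Finset.card_pos.2 (Finsupp.support_nonempty_iff.2 hβ)
  have h2 : α.support.card ≤ 1 := by
    by_contra h3
    exact hle (lt_of_lt_of_le (by omega) (Nat.le_mul_of_pos_right _ h1))
  obtain ⟨g, hg⟩ := Finsupp.card_support_le_one.1 h2
  refine ⟨g, _, fun h0 => hα ?_, hg⟩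
  rw [hg, h0, Finsupp.single_zero]

end CountableModels


/-! ### From permutations to isomorphisms of coding modules -/

namespace CountableModels

section Intertwined

variable {𝔅 ι : Type*} (S : Type*) [CommRing S]

/-- The `S`-linear endomorphism of the free module on `𝔅` with a given integral matrix. -/
noncomputable def intExt (p : 𝔅 → 𝔅 →₀ ℤ) : (𝔅 →₀ S) →ₗ[S] (𝔅 →₀ S) :=
  Finsupp.linearCombination S fun b => (p b).mapRange (Int.cast : ℤ → S) Int.cast_zero

theorem intExt_single (p : 𝔅 → 𝔅 →₀ ℤ) (b : 𝔅) (s : S) :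
    intExt S p (Finsupp.single b s) = s • (p b).mapRange (Int.cast : ℤ → S) Int.cast_zero :=
  Finsupp.linearCombination_single ..

/-- `f` maps the span of `B` to the span of `B'`, has `f'` as a left inverse there and commutes
with the operators `op`. -/
def IntertwinesOn (op : ι → 𝔅 → 𝔅 →₀ ℤ) (B B' : Set 𝔅) (f f' : (𝔅 →₀ S) →ₗ[S] (𝔅 →₀ S)) : Prop :=
  ∀ x ∈ Finsupp.supported S S B, f x ∈ Finsupp.supported S S B' ∧ f' (f x) = x ∧
    ∀ c, f (intExt S (op c) x) = intExt S (op c) (f x)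

/-- The spans of `B` and `B'` are isomorphic as modules with operators `op`. -/
def Intertwined (op : ι → 𝔅 → 𝔅 →₀ ℤ) (B B' : Set 𝔅) : Prop :=
  ∃ f f', IntertwinesOn S op B B' f f' ∧ IntertwinesOn S op B' B f' f

variable {S}

theorem IntertwinesOn.of_single {op : ι → 𝔅 → 𝔅 →₀ ℤ} {B B' : Set 𝔅}
    {f f' : (𝔅 →₀ S) →ₗ[S] (𝔅 →₀ S)}
    (h : ∀ b ∈ B, f (Finsupp.single b 1) ∈ Finsupp.supported S S B' ∧
      f' (f (Finsupp.single b 1)) = Finsupp.single b 1 ∧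
      ∀ c, f (intExt S (op c) (Finsupp.single b 1)) = intExt S (op c) (f (Finsupp.single b 1))) :
    IntertwinesOn S op B B' f f' := by
  intro x hx
  rw [Finsupp.supported_eq_span_single] at hx
  induction hx using Submodule.span_induction with
  | mem x hx =>
    obtain ⟨b, hb, rfl⟩ := hx
    exact h b hb
  | zero => simp
  | add x y _ _ hx hy =>
    refine ⟨?_, ?_, fun c => ?_⟩
    · rw [map_add]; exact add_mem hx.1 hy.1
    · rw [map_add, map_add, hx.2.1, hy.2.1]
    · simp only [map_add, hx.2.2 c, hy.2.2 c]
  | smul a x _ hx =>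
    refine ⟨?_, ?_, fun c => ?_⟩
    · rw [map_smul]; exact Submodule.smul_mem _ _ hx.1
    · rw [map_smul, map_smul, hx.2.1]
    · simp only [map_smul, hx.2.2 c]

end Intertwined

/-- The free group on the transpositions of `ℕ`. -/
abbrev SwapGroup : Type := FreeGroup (ℕ × ℕ)

namespace SwapGroup

def toPerm : SwapGroup →* Equiv.Perm ℕ := FreeGroup.lift fun p => Equiv.swap p.1 p.2

/-- Finite approximations are all that is needed of the group, so a free group can replace the
finitary permutations, whose torsion would destroy unique products. -/
theorem exists_toPerm_eq_of_lt (π : Equiv.Perm ℕ) (n : ℕ) :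
    ∃ h : SwapGroup, ∀ i < n, toPerm h i = π i := by
  induction n with
  | zero => exact ⟨1, fun i hi => absurd hi (Nat.not_lt_zero i)⟩
  | succ n ih =>
    obtain ⟨h, hh⟩ := ih
    -- The extra transposition corrects the value at `n`; by injectivity it does not move the values
    -- already fixed.
    refine ⟨FreeGroup.of (toPerm h n, π n) * h, fun i hi => ?_⟩
    have hs : toPerm (FreeGroup.of (toPerm h n, π n)) = Equiv.swap (toPerm h n) (π n) :=
      FreeGroup.lift_apply_of
    rw [map_mul, Equiv.Perm.mul_apply, hs]
    rcases Nat.lt_succ_iff_lt_or_eq.1 hi with hi | rfl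
    · rw [hh i hi, Equiv.swap_apply_of_ne_of_ne]
      · rw [← hh i hi]
        exact fun e => hi.ne ((toPerm h).injective e)
      · exact fun e => hi.ne (π.injective e)
    · exact Equiv.swap_apply_left ..

end SwapGroup

/-- A tag together with a finite tuple of natural numbers. -/
@[ext] structure TaggedTuple (A : Type) where
  tag : A
  args : List ℕ

namespace TaggedTuple

variable {A : Type}

instance : MulAction (Equiv.Perm ℕ) (TaggedTuple A) where
  smul π x := ⟨x.tag, x.args.map π⟩
  one_smul x := TaggedTuple.ext rfl (List.map_id _)
  mul_smul π σ x := TaggedTuple.ext rfl (by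
    change x.args.map (π * σ) = (x.args.map σ).map π
    rw [List.map_map]; rfl)

theorem smul_def (π : Equiv.Perm ℕ) (x : TaggedTuple A) : π • x = ⟨x.tag, x.args.map π⟩ := rfl

instance : MulAction SwapGroup (TaggedTuple A) := MulAction.compHom _ SwapGroup.toPerm

theorem swapGroup_smul_def (h : SwapGroup) (x : TaggedTuple A) : h • x = SwapGroup.toPerm h • x := rfl

instance [Countable A] : Countable (TaggedTuple A) :=
  Function.Injective.countable (f := fun x : TaggedTuple A => (x.tag, x.args)) fun x y h => by
    rw [Prod.mk.injEq] at h
    exact TaggedTuple.ext h.1 h.2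

end TaggedTuple

/-- The basis of the modules that code sets of facts: blocks numbered by `ℕ`, each with a copy of
the group `SwapGroup` and of the set of all facts, and a copy of the facts. -/
inductive BlockBasis (A : Type)
  | grp (n : ℕ) (h : SwapGroup)
  | pt (n : ℕ) (x : TaggedTuple A)
  | glob (x : TaggedTuple A)

/-- The operators on the modules that code sets of facts. -/
inductive BlockOp (A : Type)
  | right (g : SwapGroup)
  | eval (x : TaggedTuple A)
  | proj (n : ℕ)
  | restr (n : ℕ)

section Block

variable {A : Type}

open BlockBasis BlockOp

instance [Countable A] : Countable (BlockBasis A) := by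
  have : Countable SwapGroup := Quotient.countable
  refine Function.Injective.countable
    (f := fun b : BlockBasis A => show (ℕ × SwapGroup) ⊕ (ℕ × TaggedTuple A) ⊕ TaggedTuple A from
      match b with
      | grp n h => .inl (n, h)
      | pt n x => .inr (.inl (n, x))
      | glob x => .inr (.inr x)) ?_
  intro a b h
  cases a <;> cases b <;> simp_all

instance [Countable A] : Countable (BlockOp A) := by
  have : Countable SwapGroup := Quotient.countable
  refine Function.Injective.countable
    (f := fun b : BlockOp A => show SwapGroup ⊕ TaggedTuple A ⊕ ℕ ⊕ ℕ from
      match b with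
      | right h => .inl h
      | eval x => .inr (.inl x)
      | proj n => .inr (.inr (.inl n))
      | restr n => .inr (.inr (.inr n))) ?_
  intro a b h
  cases a <;> cases b <;> simp_all

/-- Commuting with `right` and `proj` makes a map act on each block's group as a left
multiplication, `eval` transfers this multiplication to the facts of the block, and `restr` compares
a global fact with its copies in all blocks. -/
noncomputable def blockOp : BlockOp A → BlockBasis A → BlockBasis A →₀ ℤ
  | right g, grp n h => Finsupp.single (grp n (h * g)) 1
  | right _, _ => 0
  | eval x, grp n h => Finsupp.single (pt n (h • x)) 1
  | eval _, _ => 0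
  | proj n, grp m h => if m = n then Finsupp.single (grp n h) 1 else 0
  | proj _, _ => 0
  | restr n, glob x => Finsupp.single (pt n x) 1
  | restr n, pt m x => if m = n then Finsupp.single (pt n x) 1 else 0
  | restr _, grp _ _ => 0

/-- The basis elements of the module that codes the set of facts `E`. -/
def blockSet (E : Set (TaggedTuple A)) : Set (BlockBasis A) := {b | ∀ x, b = glob x → x ∈ E}

theorem grp_mem_blockSet (E : Set (TaggedTuple A)) (n : ℕ) (h : SwapGroup) : grp n h ∈ blockSet E :=
  fun _ e => nomatch e

theorem pt_mem_blockSet (E : Set (TaggedTuple A)) (n : ℕ) (x : TaggedTuple A) : pt n x ∈ blockSet E :=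
  fun _ e => nomatch e

theorem glob_mem_blockSet {E : Set (TaggedTuple A)} {x : TaggedTuple A} : glob x ∈ blockSet E ↔ x ∈ E :=
  ⟨fun h => h x rfl, fun h _ e => by cases e; exact h⟩

theorem blockSet_infinite (E : Set (TaggedTuple A)) : (blockSet E).Infinite :=
  Set.infinite_of_injective_forall_mem (f := fun n : ℕ => (grp n 1 : BlockBasis A))
    (fun _ _ h => by simpa using h) fun n => grp_mem_blockSet E n 1

theorem blockOp_mem_supported (E : Set (TaggedTuple A)) (c : BlockOp A) (b : BlockBasis A) :
    blockOp c b ∈ Finsupp.supported ℤ ℤ (blockSet E) := by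
  have h1 : ∀ n h, (Finsupp.single (grp n h) 1 : BlockBasis A →₀ ℤ) ∈
      Finsupp.supported ℤ ℤ (blockSet E) := fun n h =>
    Finsupp.single_mem_supported ℤ _ (grp_mem_blockSet E n h)
  have h2 : ∀ n x, (Finsupp.single (pt n x) 1 : BlockBasis A →₀ ℤ) ∈
      Finsupp.supported ℤ ℤ (blockSet E) := fun n x =>
    Finsupp.single_mem_supported ℤ _ (pt_mem_blockSet E n x)
  cases c <;> cases b <;> simp only [blockOp] <;>
    first
      | exact h1 _ _
      | exact h2 _ _
      | exact zero_mem _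
      | (split_ifs <;> first | exact h1 _ _ | exact h2 _ _ | exact zero_mem _)

section Ops

variable (S : Type*) [CommRing S] (n m : ℕ) (g h : SwapGroup) (x y : TaggedTuple A) (s : S)

theorem right_grp : intExt S (blockOp (right g)) (.single (grp n h : BlockBasis A) s) =
    .single (grp n (h * g)) s := by
  simp [intExt_single, blockOp]

theorem right_pt : intExt S (blockOp (right g)) (.single (pt n x) s) = 0 := by
  simp [intExt_single, blockOp]

theorem right_glob : intExt S (blockOp (right g)) (.single (glob x) s) = 0 := by
  simp [intExt_single, blockOp]

theorem eval_grp : intExt S (blockOp (eval x)) (.single (grp n h) s) =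
    .single (pt n (h • x)) s := by
  simp [intExt_single, blockOp]

theorem eval_pt : intExt S (blockOp (eval x)) (.single (pt n y) s) = 0 := by
  simp [intExt_single, blockOp]

theorem eval_glob : intExt S (blockOp (eval x)) (.single (glob y) s) = 0 := by
  simp [intExt_single, blockOp]

theorem proj_grp : intExt S (blockOp (proj n)) (.single (grp m h : BlockBasis A) s) =
    if m = n then .single (grp n h) s else 0 := by
  split_ifs with e <;> simp [intExt_single, blockOp, e]

theorem proj_pt : intExt S (blockOp (proj n)) (.single (pt m x) s) = 0 := by
  simp [intExt_single, blockOp]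

theorem proj_glob : intExt S (blockOp (proj n)) (.single (glob x) s) = 0 := by
  simp [intExt_single, blockOp]

theorem restr_grp : intExt S (blockOp (restr n)) (.single (grp m h : BlockBasis A) s) = 0 := by
  simp [intExt_single, blockOp]

theorem restr_pt : intExt S (blockOp (restr n)) (.single (pt m x) s) =
    if m = n then .single (pt n x) s else 0 := by
  split_ifs with e <;> simp [intExt_single, blockOp, e]

theorem restr_glob : intExt S (blockOp (restr n)) (.single (glob x) s) =
    .single (pt n x) s := by
  simp [intExt_single, blockOp]

end Ops

/-- The map of coding modules that is `u n` on the `n`-th block and `π` modulo the blocks. -/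
noncomputable def glue (π : Equiv.Perm ℕ) (u : ℕ → SwapGroup) (d : TaggedTuple A → ℕ) :
    (BlockBasis A →₀ ℤ) →ₗ[ℤ] (BlockBasis A →₀ ℤ) :=
  Finsupp.linearCombination ℤ fun
    | grp n h => .single (grp n (u n * h)) 1
    | pt n x => .single (pt n (u n • x)) 1
    | glob x => .single (glob (π • x)) 1 +
        ∑ n ∈ Finset.range (d x), (.single (pt n (u n • x)) 1 - .single (pt n (π • x)) 1)

section Glue

variable (π : Equiv.Perm ℕ) (u : ℕ → SwapGroup) (d : TaggedTuple A → ℕ)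

theorem glue_grp (n : ℕ) (h : SwapGroup) :
    glue π u d (.single (grp n h) 1) = .single (grp n (u n * h)) 1 := by
  rw [glue, Finsupp.linearCombination_single, one_smul]

theorem glue_pt (n : ℕ) (x : TaggedTuple A) :
    glue π u d (.single (pt n x) 1) = .single (pt n (u n • x)) 1 := by
  rw [glue, Finsupp.linearCombination_single, one_smul]

theorem glue_glob (x : TaggedTuple A) :
    glue π u d (.single (glob x) 1) = .single (glob (π • x)) 1 +
        ∑ n ∈ Finset.range (d x), (.single (pt n (u n • x)) 1 - .single (pt n (π • x)) 1) := by
  rw [glue, Finsupp.linearCombination_single, one_smul]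

/-- Only `restr` links the global facts to the blocks. The correction terms in `glue` are what it
needs, and all other operators vanish on them. -/
theorem intertwinesOn_glue (hd : ∀ x n, d x ≤ n → u n • x = π • x) {E E' : Set (TaggedTuple A)}
    (hE : ∀ x ∈ E, π • x ∈ E') :
    IntertwinesOn ℤ blockOp (blockSet E) (blockSet E') (glue π u d)
      (glue π⁻¹ (fun n => (u n)⁻¹) fun x => d (π⁻¹ • x)) := by
  apply IntertwinesOn.of_single
  rintro (⟨n, h⟩ | ⟨n, x⟩ | x) hb
  · rw [glue_grp]
    refine ⟨Finsupp.single_mem_supported ℤ _ (grp_mem_blockSet E' _ _), ?_, ?_⟩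
    · rw [glue_grp, inv_mul_cancel_left]
    · rintro (g | x | m | m)
      · rw [right_grp, right_grp, glue_grp, mul_assoc]
      · rw [eval_grp, eval_grp, glue_pt, mul_smul]
      · rw [proj_grp, proj_grp]
        split_ifs with e
        · rw [glue_grp, e]
        · rw [map_zero]
      · rw [restr_grp, restr_grp, map_zero]
  · rw [glue_pt]
    refine ⟨Finsupp.single_mem_supported ℤ _ (pt_mem_blockSet E' _ _), ?_, ?_⟩
    · rw [glue_pt, inv_smul_smul]
    · rintro (g | x | m | m)
      · rw [right_pt, right_pt, map_zero]
      · rw [eval_pt, eval_pt, map_zero]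
      · rw [proj_pt, proj_pt, map_zero]
      · rw [restr_pt, restr_pt]
        split_ifs with e
        · rw [glue_pt, e]
        · rw [map_zero]
  · have hx : π • x ∈ E' := hE x (glob_mem_blockSet.1 hb)
    rw [glue_glob]
    refine ⟨?_, ?_, ?_⟩
    · refine add_mem (Finsupp.single_mem_supported ℤ _ (glob_mem_blockSet.2 hx))
        (sum_mem fun n _ => sub_mem ?_ ?_) <;>
        exact Finsupp.single_mem_supported ℤ _ (pt_mem_blockSet E' _ _)
    · simp only [map_add, map_sum, map_sub, glue_pt, glue_glob, inv_smul_smul]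
      rw [add_assoc, ← Finset.sum_add_distrib, Finset.sum_eq_zero, add_zero]
      intro n _
      abel
    · rintro (g | y | m | m)
      · simp only [map_add, map_sum, map_sub, right_pt, right_glob, sub_self,
          Finset.sum_const_zero, map_zero, add_zero]
      · simp only [map_add, map_sum, map_sub, eval_pt, eval_glob, sub_self,
          Finset.sum_const_zero, map_zero, add_zero]
      · simp only [map_add, map_sum, map_sub, proj_pt, proj_glob, sub_self,
          Finset.sum_const_zero, map_zero, add_zero]
      -- `restr m` keeps only the `m`-th correction, which turns `π • x` into `u m • x`; from `d x`
      -- on, the two are equal and no correction is present.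
      · simp only [map_add, map_sum, map_sub, restr_pt, restr_glob, glue_pt]
        have : ∀ n ∈ Finset.range (d x),
            ((if n = m then .single (pt m (u n • x)) 1 else 0 : BlockBasis A →₀ ℤ) -
              if n = m then .single (pt m (π • x)) 1 else 0) =
            if n = m then .single (pt m (u m • x)) 1 - .single (pt m (π • x)) 1 else 0 := by
          intro n _
          split_ifs with e
          · rw [e]
          · rw [sub_zero]
        rw [Finset.sum_congr rfl this, Finset.sum_ite_eq' (Finset.range (d x)) m]
        split_ifs with e
        · abel
        · rw [Finset.mem_range, not_lt] at e
          rw [hd x m e, add_zero]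

theorem exists_intertwined_of_perm {E E' : Set (TaggedTuple A)} (hE : ∀ x ∈ E, π • x ∈ E')
    (hE' : ∀ x ∈ E', π⁻¹ • x ∈ E) : Intertwined ℤ blockOp (blockSet E) (blockSet E') := by
  choose u hu using SwapGroup.exists_toPerm_eq_of_lt π
  have hd : ∀ x : TaggedTuple A, ∃ d, ∀ n, d ≤ n → u n • x = π • x := by
    intro x
    -- Each entry is at most the sum of all entries, hence below every such `n`, where `u n` agrees
    -- with `π`.
    refine ⟨x.args.sum + 1, fun n hn => TaggedTuple.ext rfl (List.map_congr_left fun i hi => hu n i ?_)⟩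
    have := List.single_le_sum (l := x.args) (fun _ _ => Nat.zero_le _) i hi
    omega
  choose d hd using hd
  refine ⟨glue π u d, glue π⁻¹ (fun n => (u n)⁻¹) fun x => d (π⁻¹ • x),
    intertwinesOn_glue π u d hd hE, ?_⟩
  have := intertwinesOn_glue (A := A) π⁻¹ (fun n => (u n)⁻¹) (fun x => d (π⁻¹ • x))
    (fun x n hn => by rw [inv_smul_eq_iff, hd _ _ hn, smul_inv_smul]) hE'
  simpa only [inv_inv, inv_smul_smul] using this

end Glue

end Block

end CountableModels


/-! ### From isomorphisms of coding modules to permutations -/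

namespace CountableModels

section Block

variable {A : Type}

open BlockBasis BlockOp

section Recover

variable {k : Type*} [CommRing k]

theorem exists_proj_eq (n : ℕ) (y : BlockBasis A →₀ k) :
    ∃ α : SwapGroup →₀ k, intExt k (blockOp (proj n)) y = α.mapDomain (grp n) := by
  induction y using Finsupp.induction_linear with
  | zero => exact ⟨0, by rw [map_zero, Finsupp.mapDomain_zero]⟩
  | add x y hx hy =>
    obtain ⟨α, hα⟩ := hx
    obtain ⟨β, hβ⟩ := hy
    exact ⟨α + β, by rw [map_add, hα, hβ, Finsupp.mapDomain_add]⟩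
  | single b s =>
    rcases b with ⟨m, h⟩ | ⟨m, x⟩ | x
    · rw [proj_grp]
      split_ifs with e
      · exact ⟨.single h s, by rw [Finsupp.mapDomain_single]⟩
      · exact ⟨0, by rw [Finsupp.mapDomain_zero]⟩
    · exact ⟨0, by rw [proj_pt, Finsupp.mapDomain_zero]⟩
    · exact ⟨0, by rw [proj_glob, Finsupp.mapDomain_zero]⟩

/-- When `y` has no component in block `n`, this reads off its global coefficients. -/
theorem restr_apply_pt (n : ℕ) (x : TaggedTuple A) (y : BlockBasis A →₀ k) :
    intExt k (blockOp (restr n)) y (pt n x) = y (glob x) + y (pt n x) := by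
  classical
  induction y using Finsupp.induction_linear with
  | zero => simp
  | add a b ha hb =>
    rw [map_add, Finsupp.add_apply, ha, hb, Finsupp.add_apply, Finsupp.add_apply]
    abel
  | single b s =>
    rcases b with ⟨m, h⟩ | ⟨m, z⟩ | z
    · rw [restr_grp]; simp
    · rw [restr_pt]
      split_ifs with e
      · subst e; simp [Finsupp.single_apply]
      · simp [e]
    · rw [restr_glob]; simp [Finsupp.single_apply]

theorem right_mapDomain (n : ℕ) (g : SwapGroup) (α : SwapGroup →₀ k) :
    intExt k (blockOp (A := A) (right g)) (α.mapDomain (grp n)) =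
      α.sum fun h c => .single (grp n (h * g)) c := by
  rw [Finsupp.mapDomain, map_finsuppSum]
  simp only [right_grp]

variable {E E' : Set (TaggedTuple A)} {f f' : (BlockBasis A →₀ k) →ₗ[k] (BlockBasis A →₀ k)}

/-- Commuting with `proj n` keeps the image in the block, and commuting with `right` determines
everything from the image `α` of the identity: `f` is left convolution by `α`. -/
theorem IntertwinesOn.exists_map_grp_one
    (hf : IntertwinesOn k blockOp (blockSet E) (blockSet E') f f') (n : ℕ) :
    ∃ α : SwapGroup →₀ k, ∀ g, f (.single (grp n g) 1) =
      α.sum fun h c => .single (grp n (h * g)) c := by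
  have hmem : ∀ g, (.single (grp n g) 1 : BlockBasis A →₀ k) ∈ Finsupp.supported k k (blockSet E) :=
    fun g => Finsupp.single_mem_supported k _ (grp_mem_blockSet E n g)
  obtain ⟨α, hα⟩ := exists_proj_eq n (f (.single (grp n 1) 1))
  rw [← (hf _ (hmem 1)).2.2, proj_grp, if_pos rfl] at hα
  refine ⟨α, fun g => ?_⟩
  rw [← right_mapDomain, ← hα, ← (hf _ (hmem 1)).2.2, right_grp, one_mul]

/-- The elements `α` and `β` that belong to `f` and `f'` satisfy `α * β = 1` in the group algebra,
where such factors are monomials. -/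
theorem IntertwinesOn.exists_map_grp [IsDomain k]
    (hf : IntertwinesOn k blockOp (blockSet E) (blockSet E') f f')
    (hf' : IntertwinesOn k blockOp (blockSet E') (blockSet E) f' f) (n : ℕ) :
    ∃ u : SwapGroup, ∃ c : k, c ≠ 0 ∧ ∀ g, f (.single (grp n g) 1) = .single (grp n (u * g)) c := by
  obtain ⟨α, hα⟩ := hf.exists_map_grp_one n
  obtain ⟨β, hβ⟩ := hf'.exists_map_grp_one n
  have h1 := (hf' _ (Finsupp.single_mem_supported k (1 : k) (grp_mem_blockSet E' n 1))).2.1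
  have hs : ∀ (g : SwapGroup) (c : k), f (.single (grp n g) c) =
      α.sum fun h d => .single (grp n (h * g)) (c * d) := by
    intro g c
    have := congrArg (c • ·) (hα g)
    simp only [← map_smul, Finsupp.smul_single, smul_eq_mul, mul_one] at this
    rw [this, Finsupp.smul_sum]
    simp only [Finsupp.smul_single, smul_eq_mul]
  rw [hβ, map_finsuppSum] at h1
  simp only [hs, mul_one] at h1
  have h2 : (α.sum fun g c => β.sum fun g' c' => Finsupp.single (g * g') (c * c')) =
      Finsupp.single 1 1 := by
    apply Finsupp.mapDomain_injective (f := (grp n : SwapGroup → BlockBasis A))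
      (fun _ _ e => by simpa using e)
    rw [Finsupp.mapDomain_single, ← h1, Finsupp.sum_comm]
    simp only [Finsupp.sum, Finsupp.mapDomain_finsetSum, Finsupp.mapDomain_single, mul_comm]
  obtain ⟨u, c, hc, rfl⟩ := exists_eq_single_of_convolution_eq_one h2
  exact ⟨u, c, hc, fun g => by rw [hα, Finsupp.sum_single_index (Finsupp.single_zero _)]⟩

/-- The image of a global fact has finite support, so it misses all late blocks. There `restr n`
shows that its global part is concentrated at `u n • x`; this part does not depend on `n`. -/
theorem IntertwinesOn.exists_eventually_smul_eq
    (hf : IntertwinesOn k blockOp (blockSet E) (blockSet E') f f')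
    {u : ℕ → SwapGroup} {c : ℕ → k} (hc : ∀ n, c n ≠ 0)
    (hu : ∀ n g, f (.single (grp n g) 1) = .single (grp n (u n * g)) (c n))
    {x : TaggedTuple A} (hx : x ∈ E) : ∃ x' ∈ E', ∃ N, ∀ n, N ≤ n → u n • x = x' := by
  classical
  have hpt : ∀ n, f (.single (pt n x) 1) = .single (pt n (u n • x)) (c n) := by
    intro n
    have := (hf _ (Finsupp.single_mem_supported k (1 : k) (grp_mem_blockSet E n 1))).2.2 (eval x)
    rw [eval_grp, one_smul, hu, eval_grp, mul_one] at this
    exact this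
  obtain ⟨hy, -, hyc⟩ := hf _ (Finsupp.single_mem_supported k (1 : k) (glob_mem_blockSet.2 hx))
  set y := f (.single (glob x) 1) with hydef
  have hfin : ∃ N, ∀ n, N ≤ n → ∀ x', y (pt n x') = 0 := by
    let r : BlockBasis A → ℕ := fun | grp _ _ => 0 | pt n _ => n | glob _ => 0
    refine ⟨y.support.sup r + 1, fun n hn x' => ?_⟩
    by_contra hne
    have h1 : n ≤ y.support.sup r := Finset.le_sup (f := r) (Finsupp.mem_support_iff.2 hne)
    omega
  obtain ⟨N, hN⟩ := hfin
  have hq : ∀ n, N ≤ n → ∀ x', y (glob x') = if u n • x = x' then c n else 0 := by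
    intro n hn x'
    have h1 := restr_apply_pt n x' y
    rw [hN n hn, add_zero, ← hyc, restr_glob, hpt, Finsupp.single_apply] at h1
    rw [← h1]
    simp
  have hne : ∀ n, N ≤ n → y (glob (u n • x)) ≠ 0 := fun n hn => by
    rw [hq n hn, if_pos rfl]
    exact hc n
  refine ⟨u N • x, glob_mem_blockSet.1 (hy (Finsupp.mem_support_iff.2 (hne N le_rfl))), N,
    fun n hn => ?_⟩
  by_contra h
  exact hne N le_rfl (by rw [hq n hn, if_neg h])

/-- The one-point facts with tag `a` make `u n` and its inverse converge pointwise on `ℕ`, and the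
two limits are mutually inverse. A general fact has finitely many entries, so the limit acts on it
as late `u n` do. -/
theorem exists_perm_of_intertwined [IsDomain k] (a : A)
    (hE : ∀ i, (⟨a, [i]⟩ : TaggedTuple A) ∈ E) (hE' : ∀ i, (⟨a, [i]⟩ : TaggedTuple A) ∈ E')
    (h : Intertwined k blockOp (blockSet E) (blockSet E')) :
    ∃ π : Equiv.Perm ℕ, (∀ x ∈ E, π • x ∈ E') ∧ ∀ x ∈ E', π⁻¹ • x ∈ E := by
  obtain ⟨f, f', hf, hf'⟩ := h
  choose u c hc hu using hf.exists_map_grp hf'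
  choose v d hd hv using hf'.exists_map_grp hf
  have huv : ∀ n, v n = (u n)⁻¹ := by
    intro n
    have := (hf _ (Finsupp.single_mem_supported k (1 : k) (grp_mem_blockSet E n 1))).2.1
    rw [hu, mul_one, ← mul_one (c n), ← smul_eq_mul, ← Finsupp.smul_single, map_smul, hv,
      Finsupp.smul_single, Finsupp.single_eq_single_iff] at this
    rcases this with ⟨h1, -⟩ | ⟨h1, -⟩
    · rw [eq_inv_iff_mul_eq_one]
      simpa using h1
    · exact absurd h1 (mul_ne_zero (hc n) (hd n))
  have key := fun x hx => hf.exists_eventually_smul_eq hc hu (x := x) hx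
  have key' := fun x hx => hf'.exists_eventually_smul_eq hd hv (x := x) hx
  have hpt : ∀ (w : ℕ → SwapGroup) (i : ℕ) (F : Set (TaggedTuple A)),
      (∃ x' ∈ F, ∃ N, ∀ n, N ≤ n → w n • (⟨a, [i]⟩ : TaggedTuple A) = x') →
      ∃ j, ∃ N, ∀ n, N ≤ n → SwapGroup.toPerm (w n) i = j := by
    rintro w i F ⟨x', -, N, hN⟩
    refine ⟨SwapGroup.toPerm (w N) i, N, fun n hn => ?_⟩
    have := (hN n hn).trans (hN N le_rfl).symm
    simpa [TaggedTuple.swapGroup_smul_def, TaggedTuple.smul_def] using this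
  choose σ N hσ using fun i => hpt u i _ (key _ (hE i))
  choose τ N' hτ using fun i => hpt v i _ (key' _ (hE' i))
  let π : Equiv.Perm ℕ :=
    { toFun := σ
      invFun := τ
      left_inv := fun i => by
        have h1 := hτ (σ i) (max (N i) (N' (σ i))) (le_max_right _ _)
        rw [huv, map_inv] at h1
        exact h1.symm.trans
          (Equiv.Perm.inv_eq_iff_eq.2 (hσ i (max (N i) (N' (σ i))) (le_max_left _ _)).symm)
      right_inv := fun i => by
        have h1 := hτ i (max (N' i) (N (τ i))) (le_max_left _ _)
        rw [huv, map_inv] at h1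
        exact (hσ (τ i) (max (N' i) (N (τ i))) (le_max_right _ _)).symm.trans
          (Equiv.Perm.inv_eq_iff_eq.1 h1).symm }
  have hev : ∀ (w : ℕ → SwapGroup) (ρ : Equiv.Perm ℕ) (M : ℕ → ℕ)
      (_ : ∀ i n, M i ≤ n → SwapGroup.toPerm (w n) i = ρ i) (F : Set (TaggedTuple A))
      (x : TaggedTuple A), (∃ x' ∈ F, ∃ N, ∀ n, N ≤ n → w n • x = x') → ρ • x ∈ F := by
    rintro w ρ M hM F x ⟨x', hx', N, hN⟩
    have : ρ • x = x' := by
      rw [← hN (N + (x.args.map M).sum) (Nat.le_add_right _ _)]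
      refine TaggedTuple.ext rfl (List.map_congr_left fun i hi => (hM i _ ?_).symm)
      have := List.single_le_sum (l := x.args.map M) (fun _ _ => Nat.zero_le _) (M i)
        (List.mem_map_of_mem hi)
      omega
    rwa [this]
  exact ⟨π, fun x hx => hev u π N hσ _ x (key x hx), fun x hx => hev v π⁻¹ N' hτ _ x (key' x hx)⟩

end Recover

end Block

end CountableModels


/-! ### Structures as sets of facts -/

namespace CountableModels

universe u v

section Facts

variable {L : FirstOrder.Language.{u, v}}

theorem Str.measurableSet_funMap_eq {n : ℕ} (f : L.Functions n) (x : Fin n → ℕ) (y : ℕ) :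
    MeasurableSet {M : Str L | M.funMap f x = y} :=
  MeasurableSpace.measurableSet_generateFrom
    (TopologicalSpace.isOpen_generateFrom_of_mem (.inl ⟨n, f, x, y, rfl⟩))

theorem Str.measurableSet_relMap {n : ℕ} (r : L.Relations n) (x : Fin n → ℕ) :
    MeasurableSet {M : Str L | M.RelMap r x} :=
  MeasurableSpace.measurableSet_generateFrom
    (TopologicalSpace.isOpen_generateFrom_of_mem (.inr ⟨n, r, x, .inl rfl⟩))

end Facts

variable {L : FirstOrder.Language.{0, 0}}

def functionFact {n : ℕ} (f : L.Functions n) (x : Fin n → ℕ) (y : ℕ) :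
    TaggedTuple (Option L.Symbols) := ⟨some (.inl ⟨n, f⟩), y :: List.ofFn x⟩

def relationFact {n : ℕ} (r : L.Relations n) (x : Fin n → ℕ) :
    TaggedTuple (Option L.Symbols) := ⟨some (.inr ⟨n, r⟩), List.ofFn x⟩

/-- The points and the atomic facts of a structure. -/
def Str.facts (M : Str L) : Set (TaggedTuple (Option L.Symbols)) :=
  {t | (∃ i, t = ⟨none, [i]⟩) ∨
    (∃ (n : ℕ) (f : L.Functions n) (x : Fin n → ℕ) (y : ℕ), M.funMap f x = y ∧
      t = functionFact f x y) ∨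
    ∃ (n : ℕ) (r : L.Relations n) (x : Fin n → ℕ), M.RelMap r x ∧ t = relationFact r x}

/-- These facts, present in every structure, allow the permutation of `ℕ` to be recovered from a
module isomorphism. -/
theorem Str.point_mem_facts (M : Str L) (i : ℕ) : ⟨none, [i]⟩ ∈ M.facts := .inl ⟨i, rfl⟩

theorem Str.functionFact_mem_facts (M : Str L) {n : ℕ} (f : L.Functions n) (x : Fin n → ℕ)
    (y : ℕ) : functionFact f x y ∈ M.facts ↔ M.funMap f x = y := by
  refine ⟨?_, fun h => .inr (.inl ⟨n, f, x, y, h, rfl⟩)⟩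
  rintro (⟨i, h⟩ | ⟨m, g, x', y', h, e⟩ | ⟨m, r, x', h, e⟩)
  · simp [functionFact] at h
  · simp only [functionFact, TaggedTuple.mk.injEq, Option.some.injEq, Sum.inl.injEq,
      List.cons.injEq, Sigma.mk.injEq] at e
    obtain ⟨⟨rfl, e1⟩, e2, e3⟩ := e
    rw [heq_iff_eq] at e1
    rw [e1, e2, List.ofFn_injective e3, h]
  · simp [functionFact, relationFact] at e

theorem Str.relationFact_mem_facts (M : Str L) {n : ℕ} (r : L.Relations n) (x : Fin n → ℕ) :
    relationFact r x ∈ M.facts ↔ M.RelMap r x := by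
  refine ⟨?_, fun h => .inr (.inr ⟨n, r, x, h, rfl⟩)⟩
  rintro (⟨i, h⟩ | ⟨m, g, x', y', h, e⟩ | ⟨m, r', x', h, e⟩)
  · simp [relationFact] at h
  · simp [functionFact, relationFact] at e
  · simp only [relationFact, TaggedTuple.mk.injEq, Option.some.injEq, Sum.inr.injEq,
      Sigma.mk.injEq] at e
    obtain ⟨⟨rfl, e1⟩, e3⟩ := e
    rw [heq_iff_eq] at e1
    rwa [e1, List.ofFn_injective e3]

theorem smul_functionFact (π : Equiv.Perm ℕ) {n : ℕ} (f : L.Functions n) (x : Fin n → ℕ) (y : ℕ) :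
    π • functionFact f x y = functionFact f (π ∘ x) (π y) := by
  simp [functionFact, TaggedTuple.smul_def, List.map_ofFn]

theorem smul_relationFact (π : Equiv.Perm ℕ) {n : ℕ} (r : L.Relations n) (x : Fin n → ℕ) :
    π • relationFact r x = relationFact r (π ∘ x) := by
  simp [relationFact, TaggedTuple.smul_def, List.map_ofFn]

/-- Graphs of functions need only be carried forward, but relations must also be reflected; the
second inclusion serves for that. -/
theorem Str.iso_iff_exists_perm (M N : Str L) :
    M.Iso N ↔ ∃ π : Equiv.Perm ℕ, (∀ t ∈ M.facts, π • t ∈ N.facts) ∧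
      ∀ t ∈ N.facts, π⁻¹ • t ∈ M.facts := by
  constructor
  · rintro ⟨e⟩
    have h : ∀ (M N : Str L) (π : Equiv.Perm ℕ) (_ : ∀ (n : ℕ) (f : L.Functions n) (x : Fin n → ℕ),
        π (M.funMap f x) = N.funMap f (π ∘ x)) (_ : ∀ (n : ℕ) (r : L.Relations n) (x : Fin n → ℕ),
        M.RelMap r x → N.RelMap r (π ∘ x)), ∀ t ∈ M.facts, π • t ∈ N.facts := by
      rintro M N π h1 h2 t (⟨i, rfl⟩ | ⟨n, f, x, y, h, rfl⟩ | ⟨n, r, x, h, rfl⟩)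
      · exact N.point_mem_facts (π i)
      · rw [smul_functionFact, functionFact_mem_facts, ← h1, h]
      · rw [smul_relationFact, relationFact_mem_facts]
        exact h2 _ _ _ h
    have hf := @FirstOrder.Language.Equiv.map_fun' L ℕ ℕ M N e
    have hr' := @FirstOrder.Language.Equiv.map_rel' L ℕ ℕ M N e
    generalize @FirstOrder.Language.Equiv.toEquiv L ℕ ℕ M N e = π at hf hr'
    refine ⟨π, h M N _ (fun n f x => ?_) fun n r x hr => ?_,
      h N M _ (fun n f x => ?_) fun n r x hr => ?_⟩
    · exact hf f x
    · exact (hr' r x).2 hr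
    · refine π.injective ((hf f _).trans ?_).symm
      change N.funMap f (π ∘ π.symm ∘ x) = π (π.symm (N.funMap f x))
      rw [← Function.comp_assoc, Equiv.self_comp_symm, Function.id_comp, Equiv.apply_symm_apply]
    · refine (hr' r _).1 ?_
      change N.RelMap r (π ∘ π.symm ∘ x)
      rwa [← Function.comp_assoc, Equiv.self_comp_symm, Function.id_comp]
  · rintro ⟨π, h, h'⟩
    refine ⟨@FirstOrder.Language.Equiv.mk L ℕ ℕ M N π (fun {n} f x => ?_) fun {n} r x => ?_⟩
    · have := h _ ((M.functionFact_mem_facts f x _).2 rfl)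
      rw [smul_functionFact, functionFact_mem_facts] at this
      exact this.symm
    · constructor
      · intro hr
        have := h' _ ((N.relationFact_mem_facts r (π ∘ x)).2 hr)
        rw [smul_relationFact, relationFact_mem_facts] at this
        convert this
        funext i
        simp
      · intro hr
        have := h _ ((M.relationFact_mem_facts r x).2 hr)
        rwa [smul_relationFact, relationFact_mem_facts] at this

theorem Str.measurableSet_mem_facts [Countable L.Symbols] (t : TaggedTuple (Option L.Symbols)) :
    MeasurableSet {M : Str L | t ∈ M.facts} := by
  have hf : ∀ n, Countable (L.Functions n) := fun n =>
    Function.Injective.countable (f := fun f => (.inl ⟨n, f⟩ : L.Symbols)) fun f g h => by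
      simpa using h
  have hr : ∀ n, Countable (L.Relations n) := fun n =>
    Function.Injective.countable (f := fun f => (.inr ⟨n, f⟩ : L.Symbols)) fun f g h => by
      simpa using h
  have h : {M : Str L | t ∈ M.facts} = {_M : Str L | ∃ i, t = ⟨none, [i]⟩} ∪
      ((⋃ (n : ℕ) (f : L.Functions n) (x : Fin n → ℕ) (y : ℕ),
        {M : Str L | M.funMap f x = y} ∩ {_M : Str L | t = functionFact f x y}) ∪
      ⋃ (n : ℕ) (r : L.Relations n) (x : Fin n → ℕ),
        {M : Str L | M.RelMap r x} ∩ {_M : Str L | t = relationFact r x}) := by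
    ext M
    simp only [Set.mem_union, Set.mem_iUnion, Set.mem_inter_iff]
    rfl
  rw [h]
  refine (MeasurableSet.const _).union (MeasurableSet.union ?_ ?_)
  · exact .iUnion fun n => .iUnion fun f => .iUnion fun x => .iUnion fun y =>
      (measurableSet_funMap_eq f x y).inter (.const _)
  · exact .iUnion fun n => .iUnion fun r => .iUnion fun x =>
      (measurableSet_relMap r x).inter (.const _)

/-- The basis elements of the module that codes a structure. -/
def Str.basis (M : Str L) : Set (BlockBasis (Option L.Symbols)) := blockSet M.facts

theorem Str.measurableSet_mem_basis [Countable L.Symbols] (b : BlockBasis (Option L.Symbols)) :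
    MeasurableSet {M : Str L | b ∈ M.basis} := by
  rcases b with ⟨n, h⟩ | ⟨n, x⟩ | x
  · simp only [Str.basis, grp_mem_blockSet]
    exact .const _
  · simp only [Str.basis, pt_mem_blockSet]
    exact .const _
  · simp only [Str.basis, glob_mem_blockSet]
    exact measurableSet_mem_facts x

theorem Str.Iso.intertwined {M N : Str L} (h : M.Iso N) :
    Intertwined ℤ blockOp M.basis N.basis := by
  obtain ⟨π, h1, h2⟩ := (M.iso_iff_exists_perm N).1 h
  exact exists_intertwined_of_perm π h1 h2

theorem Str.Iso.of_intertwined {M N : Str L} (k : Type*) [CommRing k] [IsDomain k]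
    (h : Intertwined k blockOp M.basis N.basis) : M.Iso N :=
  (M.iso_iff_exists_perm N).2
    (exists_perm_of_intertwined none M.point_mem_facts N.point_mem_facts h)

end CountableModels


/-! ### Coding of operators implies Borel completeness -/

namespace CountableModels

universe u v

/-- `B` spans a submodule that is closed under the operators `op`. -/
def IsOpClosed {𝔅 ι : Type*} (op : ι → 𝔅 → 𝔅 →₀ ℤ) (B : Set 𝔅) : Prop :=
  ∀ c, ∀ b ∈ B, op c b ∈ Finsupp.supported ℤ ℤ B

/-- The submodules spanned by sets of basis elements of a free module with operators `op` are coded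
by countable `R`-modules. -/
def CodesOperator (R : Type u) [CommRing R] {𝔅 ι : Type} (op : ι → 𝔅 → 𝔅 →₀ ℤ) : Prop :=
  ∃ (W : Type u) (_ : AddCommGroup W) (_ : Module R W) (G : Set 𝔅 → Submodule R W),
    Countable (G Set.univ) ∧
    (∀ B w, w ∈ G B ↔ ∃ F : Finset 𝔅, (F : Set 𝔅) ⊆ B ∧ w ∈ G F) ∧
    (∀ B, B.Infinite → Infinite (G B)) ∧
    (∀ B B', IsOpClosed op B → IsOpClosed op B' → Intertwined ℤ op B B' →
      Nonempty (G B ≃ₗ[R] G B')) ∧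
    ∃ (k : Type u) (_ : CommRing k) (_ : IsDomain k), ∀ B B', IsOpClosed op B →
      IsOpClosed op B' → Nonempty (G B ≃ₗ[R] G B') → Intertwined k op B B'

/-- Free modules with countably many operators are coded by countable `R`-modules. -/
def CodesOperators (R : Type u) [CommRing R] : Prop :=
  ∀ (𝔅 ι : Type) [Countable 𝔅] [Countable ι] (op : ι → 𝔅 → 𝔅 →₀ ℤ), CodesOperator R op

/-- List `P ω` in the order of an injective numbering of `V`. Then `v` has place `n` exactly if it
belongs to `P ω` and `n` elements of `P ω` have a smaller number, a condition on countably many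
membership events. -/
theorem exists_measurable_enumeration {Ω V : Type*} [MeasurableSpace Ω] [Countable V]
    (P : Ω → Set V) (hinf : ∀ ω, (P ω).Infinite) (hP : ∀ v, MeasurableSet {ω | v ∈ P ω}) :
    ∃ E : Ω → ℕ → V, (∀ ω, Function.Injective (E ω)) ∧ (∀ ω, Set.range (E ω) = P ω) ∧
      ∀ n v, MeasurableSet {ω | E ω n = v} := by
  classical
  obtain ⟨code, hcode⟩ := exists_injective_nat V
  let D : Ω → ℕ → Prop := fun ω i => ∃ v ∈ P ω, code v = i
  have hDinf : ∀ ω, {i | D ω i}.Infinite := fun ω => (hinf ω).image hcode.injOn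
  have hDm : ∀ i, MeasurableSet {ω | D ω i} := by
    intro i
    by_cases hi : ∃ v, code v = i
    · obtain ⟨v, rfl⟩ := hi
      convert hP v using 1
      ext ω
      exact ⟨fun ⟨w, hw, e⟩ => hcode e ▸ hw, fun hv => ⟨v, hv, rfl⟩⟩
    · convert MeasurableSet.empty using 1
      ext ω
      exact ⟨fun ⟨w, _, e⟩ => hi ⟨w, e⟩, fun h => h.elim⟩
  have hcount : ∀ i, ∀ n, MeasurableSet {ω | Nat.count (D ω) i = n} := by
    intro i
    induction i with
    | zero =>
      intro n
      simp only [Nat.count_zero]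
      exact .const _
    | succ i ih =>
      intro n
      have : {ω | Nat.count (D ω) (i + 1) = n} =
          ({ω | D ω i} ∩ {ω | Nat.count (D ω) i + 1 = n}) ∪
          ({ω | D ω i}ᶜ ∩ {ω | Nat.count (D ω) i = n}) := by
        ext ω
        by_cases h : D ω i <;> simp [Nat.count_succ, h]
      rw [this]
      refine ((hDm i).inter ?_).union ((hDm i).compl.inter (ih n))
      cases n with
      | zero => simp
      | succ n => simpa using ih n
  choose E hE hEc using fun ω n => Nat.nth_mem_of_infinite (hDinf ω) n
  refine ⟨E, fun ω m n h => ?_, fun ω => ?_, fun n v => ?_⟩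
  · apply Nat.nth_injective (hDinf ω)
    rw [← hEc, ← hEc, h]
  · ext v
    constructor
    · rintro ⟨n, rfl⟩
      exact hE ω n
    · intro hv
      have : code v ∈ Set.range (Nat.nth (D ω)) := by
        rw [Nat.range_nth_of_infinite (hDinf ω)]
        exact ⟨v, hv, rfl⟩
      obtain ⟨n, hn⟩ := this
      exact ⟨n, hcode ((hEc ω n).trans hn)⟩
  · have : {ω | E ω n = v} = {ω | D ω (code v)} ∩ {ω | Nat.count (D ω) (code v) = n} := by
      ext ω
      constructor
      · rintro (rfl : E ω n = v)
        refine ⟨⟨_, hE ω n, rfl⟩, ?_⟩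
        change Nat.count (D ω) _ = n
        rw [hEc, Nat.count_nth_of_infinite (hDinf ω)]
      · rintro ⟨h1, h2⟩
        change Nat.count (D ω) _ = n at h2
        apply hcode
        rw [hEc, ← h2, Nat.nth_count h1]
    rw [this]
    exact (hDm _).inter (hcount _ _)

section Pull

variable {R : Type u} [CommRing R] {G : Type*} [AddCommGroup G] [Module R G]

/-- The structure on `ℕ` that corresponds to a numbering of an `R`-module. -/
def numbered (R : Type u) [CommRing R] {G : Type*} [AddCommGroup G] [Module R G] (e : ℕ ≃ G) :
    Str (moduleLang R) where
  funMap {n} (f : ModuleFunc R n) := match n, f with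
    | _, .zero => fun _ => e.symm 0
    | _, .add => fun x => e.symm (e (x 0) + e (x 1))
    | _, .smul r => fun x => e.symm (r • e (x 0))
  RelMap r := nomatch r

theorem mzero_numbered (e : ℕ ≃ G) : mzero (numbered R e) = e.symm 0 := rfl

theorem madd_numbered (e : ℕ ≃ G) (a b : ℕ) : madd (numbered R e) a b = e.symm (e a + e b) := rfl

theorem msmul_numbered (e : ℕ ≃ G) (r : R) (a : ℕ) : msmul (numbered R e) r a = e.symm (r • e a) :=
  rfl

theorem numbered_mem_Mod (e : ℕ ≃ G) : numbered R e ∈ Mod (moduleTheory R) := by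
  rw [mem_Mod_moduleTheory]
  simp only [mzero_numbered, madd_numbered, msmul_numbered, Equiv.apply_symm_apply]
  refine ⟨fun a b c => by rw [add_assoc], fun a b => by rw [add_comm], fun a => by simp,
    fun a => ⟨e.symm (-e a), by simp⟩, fun r a b => by rw [smul_add],
    fun r s a => by rw [add_smul], fun r s a => by rw [mul_smul], fun a => by simp⟩

theorem numbered_iso_iff {G' : Type*} [AddCommGroup G'] [Module R G'] (e : ℕ ≃ G) (e' : ℕ ≃ G') :
    (numbered R e).Iso (numbered R e') ↔ Nonempty (G ≃ₗ[R] G') := by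
  constructor
  · rintro ⟨π⟩
    have hf := @FirstOrder.Language.Equiv.map_fun' (moduleLang R) ℕ ℕ
      (numbered R e) (numbered R e') π
    generalize @FirstOrder.Language.Equiv.toEquiv (moduleLang R) ℕ ℕ
      (numbered R e) (numbered R e') π = π at hf
    have hadd : ∀ a b, π (e.symm (e a + e b)) = e'.symm (e' (π a) + e' (π b)) := fun a b =>
      hf (n := 2) ModuleFunc.add ![a, b]
    have hsmul : ∀ r a, π (e.symm (r • e a)) = e'.symm (r • e' (π a)) := fun r a =>
      hf (n := 1) (ModuleFunc.smul r) ![a]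
    refine ⟨{ (e.symm.trans π).trans e' with
      map_add' := fun x y => ?_
      map_smul' := fun r x => ?_ }⟩
    · have := hadd (e.symm x) (e.symm y)
      simp only [Equiv.apply_symm_apply] at this
      simp [this]
    · have := hsmul r (e.symm x)
      simp only [Equiv.apply_symm_apply] at this
      simp [this]
  · rintro ⟨φ⟩
    refine ⟨@FirstOrder.Language.Equiv.mk (moduleLang R) ℕ ℕ (numbered R e) (numbered R e')
      ((e.trans φ.toEquiv).trans e'.symm) (fun {n} (f : ModuleFunc R n) x => ?_)
      fun {n} r => nomatch r⟩
    cases f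
    · change e'.symm (φ (e (e.symm 0))) = e'.symm 0
      simp
    · change e'.symm (φ (e (e.symm (e (x 0) + e (x 1))))) =
        e'.symm (e' (e'.symm (φ (e (x 0)))) + e' (e'.symm (φ (e (x 1)))))
      simp
    · change e'.symm (φ (e (e.symm (_ • e (x 0))))) = e'.symm (_ • e' (e'.symm (φ (e (x 0)))))
      simp

end Pull

theorem countable_moduleFunc (R : Type u) [Countable R] (n : ℕ) : Countable (ModuleFunc R n) := by
  refine Function.Injective.countable (f := fun f : ModuleFunc R n => match n, f with
    | _, .zero => (none : Option R)
    | _, .add => none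
    | _, .smul r => some r) ?_
  intro f g h
  cases f <;> cases g <;> simp_all

/-- The defining subbasis is countable, so it generates the Borel sets, and there are no relation
symbols to test. -/
theorem measurable_moduleLang {R : Type u} [Countable R] {Ω : Type*} [MeasurableSpace Ω]
    {g : Ω → Str (moduleLang R)}
    (h : ∀ (n : ℕ) (f : ModuleFunc R n) (x : Fin n → ℕ) (y : ℕ),
      MeasurableSet {ω | (g ω).funMap f x = y}) : Measurable g := by
  have hc : ∀ n, Countable ((moduleLang R).Functions n) := countable_moduleFunc R
  have hcount : ({U | ∃ (n : ℕ) (f : (moduleLang R).Functions n) (x : Fin n → ℕ) (y : ℕ),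
      U = {M : Str (moduleLang R) | M.funMap f x = y}} ∪
    {U | ∃ (n : ℕ) (r : (moduleLang R).Relations n) (x : Fin n → ℕ),
      U = {M : Str (moduleLang R) | M.RelMap r x} ∨
        U = {M : Str (moduleLang R) | ¬ M.RelMap r x}}).Countable := by
    refine Set.Countable.union ?_ (Set.Countable.mono (s₂ := ∅) ?_ Set.countable_empty)
    · refine Set.Countable.mono ?_ (Set.countable_range
        fun p : Σ (n : ℕ), (moduleLang R).Functions n × (Fin n → ℕ) × ℕ =>
          {M : Str (moduleLang R) | M.funMap p.2.1 p.2.2.1 = p.2.2.2})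
      rintro U ⟨n, f, x, y, rfl⟩
      exact ⟨⟨n, f, x, y⟩, rfl⟩
    · rintro U ⟨n, r, -⟩
      exact nomatch r
  have : SecondCountableTopology (Str (moduleLang R)) := ⟨⟨_, hcount, rfl⟩⟩
  have hb : Str.instMeasurableSpace (moduleLang R) = MeasurableSpace.generateFrom _ :=
    borel_eq_generateFrom_of_subbasis rfl
  rw [hb]
  refine measurable_generateFrom ?_
  rintro U (⟨n, f, x, y, rfl⟩ | ⟨n, r, -⟩)
  · exact h n f x y
  · exact nomatch r

/-- All the modules `G B` lie in the countable module `G Set.univ`; a structure is sent to the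
module of its basis set, numbered measurably. -/
theorem CodesOperators.borelComplete {R : Type u} [CommRing R] [Countable R]
    (hR : CodesOperators R) : BorelComplete (moduleTheory R) := by
  intro L _ T _
  obtain ⟨W, _, _, G, hcount, hfin, hinf, hiso, k, _, _, hiso'⟩ :=
    hR (BlockBasis (Option L.Symbols)) (BlockOp (Option L.Symbols)) blockOp
  have hle : ∀ B, G B ≤ G Set.univ := fun B w hw => by
    obtain ⟨F, -, hw⟩ := (hfin B w).1 hw
    exact (hfin _ w).2 ⟨F, Set.subset_univ _, hw⟩
  have hclosed : ∀ M : Str L, IsOpClosed blockOp M.basis := fun M c b _ =>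
    blockOp_mem_supported M.facts c b
  let P : Mod T → Set (G Set.univ) := fun M => {v | (v : W) ∈ G (M : Str L).basis}
  obtain ⟨E, hEinj, hErange, hEm⟩ := exists_measurable_enumeration P
    (fun M => by
      have : Infinite (G (M : Str L).basis) := hinf _ (blockSet_infinite (M : Str L).facts)
      refine Set.infinite_of_injective_forall_mem (f := fun w : G (M : Str L).basis =>
        (⟨w, hle _ w.2⟩ : G Set.univ)) (fun x y h => ?_) fun w => w.2
      exact Subtype.ext (congrArg (fun z : G Set.univ => (z : W)) h))
    (fun v => by
      -- Membership in `G B` is witnessed by a finite part of `B`, which makes it a countable union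
      -- of finite intersections.
      have : {M | v ∈ P M} = ⋃ F : {F : Finset (BlockBasis (Option L.Symbols)) // (v : W) ∈ G F},
          ⋂ b ∈ F.1, {M : Mod T | b ∈ (M : Str L).basis} := by
        ext M
        simp only [Set.mem_iUnion, Set.mem_iInter]
        refine (hfin (M : Str L).basis v).trans ⟨?_, ?_⟩
        · rintro ⟨F, h1, h2⟩
          exact ⟨⟨F, h2⟩, fun b hb => h1 hb⟩
        · rintro ⟨⟨F, h2⟩, h1⟩
          exact ⟨F, fun b hb => h1 b hb, h2⟩
      rw [this]
      exact .iUnion fun F => Finset.measurableSet_biInter _ fun b _ =>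
        measurable_subtype_coe (Str.measurableSet_mem_basis b))
  have hmem : ∀ (M : Mod T) n, (E M n : W) ∈ G (M : Str L).basis := fun M n =>
    (hErange M).subset ⟨n, rfl⟩
  let e : ∀ M : Mod T, ℕ ≃ G (M : Str L).basis := fun M =>
    Equiv.ofBijective (fun n => ⟨E M n, hmem M n⟩) ⟨fun m n h => hEinj M
      (Subtype.ext (congrArg (fun z : G (M : Str L).basis => (z : W)) h)), fun w => by
        obtain ⟨n, hn⟩ := (hErange M).superset (show ⟨w, hle _ w.2⟩ ∈ P M from w.2)
        exact ⟨n, Subtype.ext (congrArg (fun z : G Set.univ => (z : W)) hn)⟩⟩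
  have he : ∀ (M : Mod T) n, ((e M n : G (M : Str L).basis) : W) = E M n := fun M n => rfl
  refine ⟨fun M => ⟨numbered R (e M), numbered_mem_Mod (e M)⟩, ?_, fun M N => ?_⟩
  · refine Measurable.subtype_mk (measurable_moduleLang ?_)
    intro n f x y
    cases f with
    | zero =>
      convert hEm y 0 using 1
      ext M
      change (e M).symm 0 = y ↔ E M y = 0
      rw [Equiv.symm_apply_eq, eq_comm, Subtype.ext_iff, Subtype.ext_iff, he]
      rfl
    | add =>
      -- Splitting according to the two summands costs only a countable union, since `G Set.univ` is
      -- countable.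
      have : {M | (numbered R (e M)).funMap (n := 2) ModuleFunc.add x = y} =
          ⋃ (a : G Set.univ) (b : G Set.univ),
          {M | E M (x 0) = a} ∩ ({M | E M (x 1) = b} ∩ {M | E M y = a + b}) := by
        ext M
        change (e M).symm (e M (x 0) + e M (x 1)) = y ↔ _
        rw [Equiv.symm_apply_eq, eq_comm, Subtype.ext_iff]
        constructor
        · exact fun h => Set.mem_iUnion.2 ⟨E M (x 0), Set.mem_iUnion.2
            ⟨E M (x 1), rfl, rfl, Subtype.ext h⟩⟩
        · intro h
          obtain ⟨a, h⟩ := Set.mem_iUnion.1 h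
          obtain ⟨b, rfl, rfl, h⟩ := Set.mem_iUnion.1 h
          exact congrArg (fun z : G Set.univ => (z : W)) h
      exact this ▸ .iUnion fun a => .iUnion fun b =>
        (hEm _ _).inter ((hEm _ _).inter (hEm _ _))
    | smul r =>
      have : {M | (numbered R (e M)).funMap (n := 1) (ModuleFunc.smul r) x = y} =
          ⋃ (a : G Set.univ), {M | E M (x 0) = a} ∩ {M | E M y = r • a} := by
        ext M
        change (e M).symm (r • e M (x 0)) = y ↔ _
        rw [Equiv.symm_apply_eq, eq_comm, Subtype.ext_iff]
        constructor
        · exact fun h => Set.mem_iUnion.2 ⟨E M (x 0), rfl, Subtype.ext h⟩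
        · intro h
          obtain ⟨a, rfl, h⟩ := Set.mem_iUnion.1 h
          exact congrArg (fun z : G Set.univ => (z : W)) h
      exact this ▸ .iUnion fun a => (hEm _ _).inter (hEm _ _)
  · refine (numbered_iso_iff (e M) (e N)).trans ⟨fun h => ?_, fun h => ?_⟩
    · exact Str.Iso.of_intertwined k (hiso' _ _ (hclosed M) (hclosed N) h)
    · exact hiso _ _ (hclosed M) (hclosed N) h.intertwined

end CountableModels


/-! ### Lattices spanned by graphs of operators -/

namespace CountableModels

universe u

section Vectors

variable {𝔅 : Type*} (S : Type*) [CommRing S]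

/-- Integral vectors as vectors over a ring. -/
noncomputable def castVec : (𝔅 →₀ ℤ) →+ (𝔅 →₀ S) :=
  Finsupp.mapRange.addMonoidHom (Int.castAddHom S)

theorem castVec_single (b : 𝔅) (n : ℤ) : castVec S (.single b n) = .single b (n : S) :=
  Finsupp.mapRange_single (hf := Int.cast_zero)

theorem castVec_int (x : 𝔅 →₀ ℤ) : castVec ℤ x = x := Finsupp.ext fun _ => rfl

theorem intExt_single_one (q : 𝔅 → 𝔅 →₀ ℤ) (b : 𝔅) :
    intExt S q (.single b 1) = castVec S (q b) := by
  rw [intExt_single, one_smul]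
  rfl

theorem intExt_castVec (q : 𝔅 → 𝔅 →₀ ℤ) (x : 𝔅 →₀ ℤ) :
    intExt S q (castVec S x) = castVec S (intExt ℤ q x) := by
  induction x using Finsupp.induction_linear with
  | zero => simp
  | add x y hx hy => simp only [map_add, hx, hy]
  | single b n =>
    have h1 : (.single b n : 𝔅 →₀ ℤ) = n • .single b 1 := by simp
    rw [h1, map_zsmul, map_zsmul, map_zsmul, map_zsmul, castVec_single, Int.cast_one,
      intExt_single_one, intExt_single_one]
    rw [castVec_int]

variable {S}

theorem castVec_mem_supported {B : Set 𝔅} {x : 𝔅 →₀ ℤ} (hx : x ∈ Finsupp.supported ℤ ℤ B) :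
    castVec S x ∈ Finsupp.supported S S B :=
  fun _ hb => hx (Finsupp.support_mapRange (hf := Int.cast_zero) hb)

theorem intExt_apply_single (f : (𝔅 →₀ ℤ) →ₗ[ℤ] (𝔅 →₀ ℤ)) :
    intExt ℤ (fun b => f (.single b 1)) = f := by
  refine Finsupp.lhom_ext' fun b => LinearMap.ext_ring ?_
  change intExt ℤ (fun b => f (.single b 1)) (.single b 1) = f (.single b 1)
  rw [intExt_single_one, castVec_int]

/-- Reduction of the coordinates of a vector. -/
noncomputable def mapVec {k : Type*} [CommRing k] (res : S →+* k) : (𝔅 →₀ S) →+ (𝔅 →₀ k) :=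
  Finsupp.mapRange.addMonoidHom res.toAddMonoidHom

theorem mapVec_single {k : Type*} [CommRing k] (res : S →+* k) (b : 𝔅) (s : S) :
    mapVec res (.single b s) = .single b (res s) :=
  Finsupp.mapRange_single (hf := map_zero res)

theorem mapVec_smul {k : Type*} [CommRing k] (res : S →+* k) (s : S) (x : 𝔅 →₀ S) :
    mapVec res (s • x) = res s • mapVec res x :=
  Finsupp.ext fun _ => map_mul res _ _

theorem mapVec_algebra_smul {R k : Type*} [CommRing R] [Algebra R S] [CommRing k] (res : S →+* k)
    (r : R) (x : 𝔅 →₀ S) : mapVec res (r • x) = res (algebraMap R S r) • mapVec res x := by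
  rw [← mapVec_smul, algebraMap_smul]

theorem mapVec_castVec {k : Type*} [CommRing k] (res : S →+* k) (x : 𝔅 →₀ ℤ) :
    mapVec res (castVec S x) = castVec k x :=
  Finsupp.ext fun _ => map_intCast res _

theorem mapVec_mem_supported {k : Type*} [CommRing k] (res : S →+* k) {B : Set 𝔅} {x : 𝔅 →₀ S}
    (hx : x ∈ Finsupp.supported S S B) : mapVec res x ∈ Finsupp.supported k k B :=
  fun _ hb => hx (Finsupp.support_mapRange (hf := map_zero res) hb)

end Vectors

section Lattice

variable (R : Type u) {S : Type u} [CommRing R] [CommRing S] [Algebra R S] {𝔅 ι : Type}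
  (op : ι → 𝔅 → 𝔅 →₀ ℤ) (ξ η : ι → S) (p : R)

/-- The generators of `lattice`. -/
noncomputable def latticeGen : Option ι × 𝔅 → 𝔅 →₀ S
  | (none, b) => .single b 1
  | (some c, b) => ξ c • .single b 1 + η c • castVec S (op c b)

/-- The `R`-lattice spanned by the basis elements in `B` and by the graphs of the operators, placed
in general position by `ξ` and `η`. -/
noncomputable def lattice (B : Set 𝔅) : Submodule R (𝔅 →₀ S) :=
  Submodule.span R (latticeGen op ξ η '' {x | x.2 ∈ B})

/-- The elements of which a multiple by a power of `p` lies in `lattice`. -/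
noncomputable def purified (B : Set 𝔅) : Submodule R (𝔅 →₀ S) where
  carrier := {g | ∃ N, p ^ N • g ∈ lattice R op ξ η B}
  zero_mem' := ⟨0, by rw [smul_zero]; exact zero_mem _⟩
  add_mem' := by
    rintro x y ⟨m, hx⟩ ⟨n, hy⟩
    refine ⟨m + n, ?_⟩
    rw [smul_add]
    refine add_mem ?_ ?_
    · rw [pow_add, mul_comm, mul_smul]
      exact Submodule.smul_mem _ _ hx
    · rw [pow_add, mul_smul]
      exact Submodule.smul_mem _ _ hy
  smul_mem' := by
    rintro r x ⟨n, hx⟩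
    refine ⟨n, ?_⟩
    rw [smul_comm]
    exact Submodule.smul_mem _ _ hx

variable {R op ξ η p} {B B' : Set 𝔅}

theorem lattice_le_purified : lattice R op ξ η B ≤ purified R op ξ η p B := fun x hx =>
  ⟨0, by rwa [pow_zero, one_smul]⟩

theorem mem_purified_of_smul_mem {x : 𝔅 →₀ S} {n : ℕ} (h : p ^ n • x ∈ purified R op ξ η p B) :
    x ∈ purified R op ξ η p B := by
  obtain ⟨N, h⟩ := h
  exact ⟨N + n, by rwa [pow_add, mul_smul]⟩

theorem lattice_mono (h : B ⊆ B') : lattice R op ξ η B ≤ lattice R op ξ η B' :=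
  Submodule.span_mono (Set.image_mono fun _ hx => h hx)

theorem single_mem_lattice {b : 𝔅} (hb : b ∈ B) : .single b 1 ∈ lattice R op ξ η B :=
  Submodule.subset_span ⟨(none, b), hb, rfl⟩

theorem graph_mem_lattice {b : 𝔅} (hb : b ∈ B) (c : ι) :
    ξ c • .single b 1 + η c • castVec S (op c b) ∈ lattice R op ξ η B :=
  Submodule.subset_span ⟨(some c, b), hb, rfl⟩

theorem castVec_mem_lattice {x : 𝔅 →₀ ℤ} (hx : x ∈ Finsupp.supported ℤ ℤ B) :
    castVec S x ∈ lattice R op ξ η B := by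
  rw [Finsupp.supported_eq_span_single] at hx
  induction hx using Submodule.span_induction with
  | mem x hx =>
    obtain ⟨b, hb, rfl⟩ := hx
    rw [castVec_single, Int.cast_one]
    exact single_mem_lattice hb
  | zero => rw [map_zero]; exact zero_mem _
  | add x y _ _ hx hy => rw [map_add]; exact add_mem hx hy
  | smul a x _ hx => rw [map_zsmul]; exact zsmul_mem hx a

theorem graph_castVec_mem_lattice {x : 𝔅 →₀ ℤ} (hx : x ∈ Finsupp.supported ℤ ℤ B) (c : ι) :
    ξ c • castVec S x + η c • intExt S (op c) (castVec S x) ∈ lattice R op ξ η B := by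
  rw [Finsupp.supported_eq_span_single] at hx
  induction hx using Submodule.span_induction with
  | mem x hx =>
    obtain ⟨b, hb, rfl⟩ := hx
    rw [castVec_single, Int.cast_one, intExt_single_one]
    exact graph_mem_lattice hb c
  | zero => simp only [map_zero, smul_zero, add_zero]; exact zero_mem _
  | add x y _ _ hx hy =>
    simp only [map_add, smul_add]
    rw [add_add_add_comm]
    exact add_mem hx hy
  | smul a x _ hx =>
    simp only [map_zsmul]
    rw [smul_comm _ a, smul_comm _ a, ← smul_add]
    exact zsmul_mem hx a

theorem purified_le_supported (hp : ∀ s : S, p • s = 0 → s = 0) (hB : IsOpClosed op B) :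
    ∀ x ∈ purified R op ξ η p B, x ∈ Finsupp.supported S S B := by
  have h : ∀ x ∈ lattice R op ξ η B, x ∈ Finsupp.supported S S B := by
    intro x hx
    induction hx using Submodule.span_induction with
    | mem x hx =>
      obtain ⟨⟨c, b⟩, hb, rfl⟩ := hx
      have hs : (.single b 1 : 𝔅 →₀ S) ∈ Finsupp.supported S S B :=
        Finsupp.single_mem_supported S (1 : S) hb
      rcases c with _ | c
      · exact hs
      · exact add_mem (Submodule.smul_mem _ _ hs)
          (Submodule.smul_mem _ _ (castVec_mem_supported (hB c b hb)))
    | zero => exact zero_mem _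
    | add x y _ _ hx hy => exact add_mem hx hy
    | smul a x _ hx =>
      rw [← algebraMap_smul S]
      exact Submodule.smul_mem _ _ hx
  have hpN : ∀ (N : ℕ) (s : S), p ^ N • s = 0 → s = 0 := by
    intro N
    induction N with
    | zero => simp
    | succ N ih =>
      intro s hs
      rw [pow_succ', mul_smul] at hs
      exact ih s (hp _ hs)
  rintro x ⟨N, hx⟩ b hb
  apply h _ hx
  rw [Finset.mem_coe, Finsupp.mem_support_iff] at hb ⊢
  exact fun h0 => hb (hpN N _ h0)

theorem pow_smul_vec_injective (hp : ∀ s : S, p • s = 0 → s = 0) (N : ℕ) {x y : 𝔅 →₀ S}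
    (h : p ^ N • x = p ^ N • y) : x = y := by
  induction N with
  | zero => simpa using h
  | succ N ih =>
    rw [pow_succ', mul_smul, mul_smul] at h
    refine ih (Finsupp.ext fun b => sub_eq_zero.1 (hp _ ?_))
    rw [smul_sub]
    exact sub_eq_zero.2 (DFunLike.congr_fun h b)

/-- An integral matrix commutes with the scalars `ξ c`, `η c`, so a map that commutes with the
operators sends graph vectors to integral combinations of graph vectors. -/
theorem IntertwinesOn.map_lattice {f f' : (𝔅 →₀ ℤ) →ₗ[ℤ] (𝔅 →₀ ℤ)}
    (h : IntertwinesOn ℤ op B B' f f') {x : 𝔅 →₀ S} (hx : x ∈ lattice R op ξ η B) :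
    intExt S (fun b => f (.single b 1)) x ∈ lattice R op ξ η B' := by
  induction hx using Submodule.span_induction with
  | mem x hx =>
    obtain ⟨⟨c, b⟩, hb, rfl⟩ := hx
    have hs := h _ (Finsupp.single_mem_supported ℤ (1 : ℤ) hb)
    rcases c with _ | c
    · rw [latticeGen, intExt_single_one]
      exact castVec_mem_lattice hs.1
    · rw [latticeGen, map_add, map_smul, map_smul, intExt_single_one, intExt_castVec,
        intExt_apply_single]
      have := hs.2.2 c
      rw [intExt_single_one, castVec_int] at this
      rw [this, ← intExt_castVec]
      exact graph_castVec_mem_lattice hs.1 c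
  | zero => rw [map_zero]; exact zero_mem _
  | add x y _ _ hx hy => rw [map_add]; exact add_mem hx hy
  | smul a x _ hx =>
    rw [LinearMap.map_smul_of_tower]
    exact Submodule.smul_mem _ _ hx

theorem IntertwinesOn.leftInverse_lattice {f f' : (𝔅 →₀ ℤ) →ₗ[ℤ] (𝔅 →₀ ℤ)}
    (h : IntertwinesOn ℤ op B B' f f') (hB : IsOpClosed op B) {x : 𝔅 →₀ S}
    (hx : x ∈ lattice R op ξ η B) :
    intExt S (fun b => f' (.single b 1)) (intExt S (fun b => f (.single b 1)) x) = x := by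
  have key : ∀ y ∈ Finsupp.supported ℤ ℤ B, intExt S (fun b => f' (.single b 1))
      (intExt S (fun b => f (.single b 1)) (castVec S y)) = castVec S y := by
    intro y hy
    rw [intExt_castVec, intExt_castVec, intExt_apply_single, intExt_apply_single, (h y hy).2.1]
  induction hx using Submodule.span_induction with
  | mem x hx =>
    obtain ⟨⟨c, b⟩, hb, rfl⟩ := hx
    have h1 := key _ (Finsupp.single_mem_supported ℤ (1 : ℤ) hb)
    rw [castVec_single, Int.cast_one] at h1
    rcases c with _ | c
    · exact h1
    · rw [latticeGen, map_add, map_smul, map_smul, map_add, map_smul, map_smul, h1,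
        key _ (hB c b hb)]
  | zero => simp only [map_zero]
  | add x y _ _ hx hy => simp only [map_add, hx, hy]
  | smul a x _ hx => rw [LinearMap.map_smul_of_tower, LinearMap.map_smul_of_tower, hx]

/-- Integral isomorphisms of modules with operators induce isomorphisms of the lattices. -/
theorem Intertwined.nonempty_purified_equiv (hp : ∀ s : S, p • s = 0 → s = 0)
    (hB : IsOpClosed op B) (hB' : IsOpClosed op B') (h : Intertwined ℤ op B B') :
    Nonempty (purified R op ξ η p B ≃ₗ[R] purified R op ξ η p B') := by
  obtain ⟨f, f', hf, hf'⟩ := h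
  refine ⟨{
    toFun x := ⟨intExt S (fun b => f (.single b 1)) x, ?_⟩
    invFun x := ⟨intExt S (fun b => f' (.single b 1)) x, ?_⟩
    map_add' x y := Subtype.ext (map_add _ _ _)
    map_smul' r x := Subtype.ext (LinearMap.map_smul_of_tower _ _ _)
    left_inv x := Subtype.ext ?_
    right_inv x := Subtype.ext ?_ }⟩
  · obtain ⟨N, hN⟩ := x.2
    exact ⟨N, by rw [← LinearMap.map_smul_of_tower]; exact hf.map_lattice hN⟩
  · obtain ⟨N, hN⟩ := x.2
    exact ⟨N, by rw [← LinearMap.map_smul_of_tower]; exact hf'.map_lattice hN⟩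
  · obtain ⟨N, hN⟩ := x.2
    apply pow_smul_vec_injective hp N
    rw [← LinearMap.map_smul_of_tower, ← LinearMap.map_smul_of_tower]
    exact hf.leftInverse_lattice hB hN
  · obtain ⟨N, hN⟩ := x.2
    apply pow_smul_vec_injective hp N
    rw [← LinearMap.map_smul_of_tower, ← LinearMap.map_smul_of_tower]
    exact hf'.leftInverse_lattice hB' hN

theorem mem_purified_iff_exists_finset {x : 𝔅 →₀ S} : x ∈ purified R op ξ η p B ↔
    ∃ F : Finset 𝔅, (F : Set 𝔅) ⊆ B ∧ x ∈ purified R op ξ η p F := by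
  classical
  constructor
  · rintro ⟨N, hN⟩
    rw [lattice, Finsupp.mem_span_image_iff_linearCombination] at hN
    obtain ⟨l, hl, e⟩ := hN
    refine ⟨l.support.image Prod.snd, ?_, N, ?_⟩
    · intro b hb
      obtain ⟨a, ha, rfl⟩ := Finset.mem_image.1 hb
      exact hl ha
    · rw [lattice, Finsupp.mem_span_image_iff_linearCombination]
      exact ⟨l, fun a ha => Finset.mem_image_of_mem _ ha, e⟩
  · rintro ⟨F, hF, N, hN⟩
    exact ⟨N, lattice_mono hF hN⟩

theorem countable_purified [Countable R] [Countable 𝔅] [Countable ι]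
    (hp : ∀ s : S, p • s = 0 → s = 0) : Countable (purified R op ξ η p B) := by
  have : Countable (lattice R op ξ η B) := by
    rw [lattice, Set.image_eq_range]
    infer_instance
  choose N hN using fun x : purified R op ξ η p B => x.2
  refine Function.Injective.countable
    (f := fun x => (N x, (⟨_, hN x⟩ : lattice R op ξ η B))) fun x y h => ?_
  rw [Prod.mk.injEq, Subtype.mk.injEq] at h
  obtain ⟨h1, h2⟩ := h
  rw [h1] at h2
  exact Subtype.ext (pow_smul_vec_injective hp _ h2)

/-- A criterion for the lattices to code the operators: linear maps between lattices commute with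
the operators modulo the kernel of a reduction. -/
theorem codesOperator_of_purified [Countable R] [Countable 𝔅] [Countable ι] {k : Type u}
    [CommRing k] [IsDomain k] (res : S →+* k) (hres : ∀ x, ∃ r : R, res (algebraMap R S r) = x)
    (hp : ∀ s : S, p • s = 0 → s = 0)
    (h0 : ∀ B B' (_ : IsOpClosed op B) (_ : IsOpClosed op B')
      (φ : purified R op ξ η p B →ₗ[R] purified R op ξ η p B') (x : purified R op ξ η p B),
        mapVec res (x : 𝔅 →₀ S) = 0 → mapVec res (φ x : 𝔅 →₀ S) = 0)
    (hop : ∀ B B' (_ : IsOpClosed op B) (_ : IsOpClosed op B')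
      (φ : purified R op ξ η p B →ₗ[R] purified R op ξ η p B') (c : ι) (b : 𝔅) (_ : b ∈ B)
      (x y : purified R op ξ η p B), (x : 𝔅 →₀ S) = .single b 1 →
        (y : 𝔅 →₀ S) = castVec S (op c b) →
        mapVec res (φ y : 𝔅 →₀ S) = intExt k (op c) (mapVec res (φ x : 𝔅 →₀ S))) :
    CodesOperator R op := by
  classical
  have hne : Nontrivial S := res.domain_nontrivial
  refine ⟨𝔅 →₀ S, inferInstance, inferInstance, purified R op ξ η p, countable_purified hp,
    fun B w => mem_purified_iff_exists_finset, fun B hB => ?_,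
    fun B B' hB hB' h => h.nonempty_purified_equiv hp hB hB', k, inferInstance, inferInstance, ?_⟩
  · have := hB.to_subtype
    refine Infinite.of_injective (fun b : B => (⟨.single b 1,
      lattice_le_purified (single_mem_lattice b.2)⟩ : purified R op ξ η p B)) fun a b h => ?_
    rw [Subtype.mk.injEq] at h
    exact Subtype.ext (Finsupp.single_left_injective one_ne_zero h)
  rintro B B' hB hB' ⟨φ⟩
  let e : ∀ (B : Set 𝔅) (b : 𝔅) (_ : b ∈ B), purified R op ξ η p B := fun B b hb =>
    ⟨.single b 1, lattice_le_purified (single_mem_lattice hb)⟩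
  -- The `k`-linear map that `φ` induces on reductions, prescribed on the basis elements in `B`; the
  -- value outside `B` is immaterial.
  let F : ∀ (B B' : Set 𝔅), (purified R op ξ η p B →ₗ[R] purified R op ξ η p B') →
      (𝔅 →₀ k) →ₗ[k] (𝔅 →₀ k) := fun B B' φ =>
    Finsupp.linearCombination k fun b => if hb : b ∈ B then mapVec res (φ (e B b hb) : 𝔅 →₀ S) else 0
  have hF1 : ∀ B B' φ b (hb : b ∈ B), F B B' φ (.single b 1) =
      mapVec res (φ (e B b hb) : 𝔅 →₀ S) := by
    intro B B' φ b hb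
    rw [Finsupp.linearCombination_single, one_smul, dif_pos hb]
  have hF : ∀ B B' (_ : IsOpClosed op B) (_ : IsOpClosed op B') φ (x : purified R op ξ η p B),
      mapVec res (φ x : 𝔅 →₀ S) = F B B' φ (mapVec res (x : 𝔅 →₀ S)) := by
    intro B B' hB hB' φ x
    -- Vectors over `k` lift to combinations of basis elements on which `φ` reduces to `F`; by `h0`
    -- any other lift gives the same reduction.
    have hlift : ∀ y ∈ Finsupp.supported k k B, ∃ z : purified R op ξ η p B,
        mapVec res (z : 𝔅 →₀ S) = y ∧ mapVec res (φ z : 𝔅 →₀ S) = F B B' φ y := by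
      intro y hy
      rw [Finsupp.supported_eq_span_single] at hy
      induction hy using Submodule.span_induction with
      | mem y hy =>
        obtain ⟨b, hb, rfl⟩ := hy
        refine ⟨e B b hb, ?_, (hF1 B B' φ b hb).symm⟩
        rw [mapVec_single, map_one]
      | zero => exact ⟨0, by simp, by simp⟩
      | add y y' _ _ hy hy' =>
        obtain ⟨z, h1, h2⟩ := hy
        obtain ⟨z', h1', h2'⟩ := hy'
        exact ⟨z + z', by rw [Submodule.coe_add, map_add, h1, h1'],
          by rw [map_add, Submodule.coe_add, map_add, h2, h2', map_add]⟩
      | smul a y _ hy =>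
        obtain ⟨z, h1, h2⟩ := hy
        obtain ⟨r, rfl⟩ := hres a
        exact ⟨r • z, by rw [Submodule.coe_smul, mapVec_algebra_smul, h1],
          by rw [map_smul, Submodule.coe_smul, mapVec_algebra_smul, h2, map_smul]⟩
    obtain ⟨z, h1, h2⟩ := hlift _ (mapVec_mem_supported res (purified_le_supported hp hB x x.2))
    rw [← h2, ← sub_eq_zero, ← map_sub, ← Submodule.coe_sub, ← map_sub φ]
    exact h0 B B' hB hB' φ _ (by rw [Submodule.coe_sub, map_sub, h1, sub_self])
  have hI : ∀ B B' (_ : IsOpClosed op B) (_ : IsOpClosed op B')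
      (φ : purified R op ξ η p B ≃ₗ[R] purified R op ξ η p B'),
      IntertwinesOn k op B B' (F B B' φ) (F B' B φ.symm) := by
    intro B B' hB hB' φ
    refine IntertwinesOn.of_single fun b hb => ⟨?_, ?_, fun c => ?_⟩
    · rw [hF1 B B' _ b hb]
      exact mapVec_mem_supported res (purified_le_supported hp hB' _ (Subtype.prop _))
    · rw [hF1 B B' _ b hb, ← hF B' B hB' hB]
      simp only [LinearEquiv.coe_coe, LinearEquiv.symm_apply_apply]
      rw [mapVec_single, map_one]
    · have hy : castVec S (op c b) ∈ purified R op ξ η p B :=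
        lattice_le_purified (castVec_mem_lattice (hB c b hb))
      rw [hF1 B B' _ b hb, intExt_single_one,
        ← hop B B' hB hB' φ c b hb (e B b hb) ⟨_, hy⟩ rfl rfl, hF B B' hB hB', mapVec_castVec]
  exact ⟨F B B' φ, F B' B φ.symm, hI B B' hB hB' φ, hI B' B hB' hB φ.symm⟩

end Lattice

end CountableModels


/-! ### Completion at a prime, and relations between algebraically independent elements -/

namespace CountableModels

universe u

section Completion

variable {R : Type u} [CommRing R]

theorem exists_evalₐ_eq {p : R} (s : AdicCompletion (Ideal.span {p}) R) :
    ∃ f : ℕ → R, (∀ m n, m ≤ n → p ^ m ∣ f n - f m) ∧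
      ∀ n, AdicCompletion.evalₐ (Ideal.span {p}) n s = Ideal.Quotient.mk _ (f n) := by
  obtain ⟨f, rfl⟩ := AdicCompletion.mk_surjective (Ideal.span {p}) R s
  refine ⟨f.val, fun m n hmn => ?_, fun n => AdicCompletion.evalₐ_mk _ n f⟩
  have h := (f.property hmn).symm
  rw [SModEq.sub_mem, smul_eq_mul, Ideal.mul_top, Ideal.span_singleton_pow,
    Ideal.mem_span_singleton] at h
  exact h

theorem exists_of_coherent {p : R} {f : ℕ → R} (hf : ∀ n, p ^ n ∣ f (n + 1) - f n) :
    ∃ s : AdicCompletion (Ideal.span {p}) R,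
      ∀ n, AdicCompletion.evalₐ (Ideal.span {p}) n s = Ideal.Quotient.mk _ (f n) := by
  refine ⟨AdicCompletion.mk _ R (AdicCompletion.AdicCauchySequence.mk _ R f fun n => ?_),
    fun n => AdicCompletion.evalₐ_mk _ n _⟩
  rw [SModEq.comm, SModEq.sub_mem, smul_eq_mul, Ideal.mul_top, Ideal.span_singleton_pow,
    Ideal.mem_span_singleton]
  exact hf n

theorem quotient_mk_eq_iff_pow_dvd {p : R} {n : ℕ} {a b : R} :
    Ideal.Quotient.mk (Ideal.span {p} ^ n) a = Ideal.Quotient.mk _ b ↔ p ^ n ∣ a - b := by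
  rw [Ideal.Quotient.eq, Ideal.span_singleton_pow, Ideal.mem_span_singleton]

variable [IsDomain R] {p : R} (hp : Prime p)
include hp

/-- All representatives from index `n` on are divisible by `p ^ n`; the quotients, shifted by `n`,
are again coherent. -/
theorem exists_eq_pow_smul_of_evalₐ_eq_zero {n : ℕ} {s : AdicCompletion (Ideal.span {p}) R}
    (hs : AdicCompletion.evalₐ (Ideal.span {p}) n s = 0) : ∃ t, s = p ^ n • t := by
  obtain ⟨f, hf, hfs⟩ := exists_evalₐ_eq s
  have h0 : p ^ n ∣ f n := by
    rw [hfs, ← map_zero (Ideal.Quotient.mk _), quotient_mk_eq_iff_pow_dvd, sub_zero] at hs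
    exact hs
  have h1 : ∀ m, p ^ n ∣ f (n + m) := fun m => by
    have := dvd_add (hf n (n + m) (Nat.le_add_right _ _)) h0
    rwa [sub_add_cancel] at this
  choose t ht using h1
  obtain ⟨u, hu⟩ := exists_of_coherent (p := p) (f := t) fun m => by
    have := hf (n + m) (n + (m + 1)) (by omega)
    rw [ht, ht, ← mul_sub, pow_add] at this
    exact (mul_dvd_mul_iff_left (pow_ne_zero n hp.ne_zero)).1 this
  refine ⟨u, AdicCompletion.ext_evalₐ fun m => ?_⟩
  rw [map_smul, hu, hfs, ← Ideal.Quotient.mk_eq_mk, ← Ideal.Quotient.mk_eq_mk,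
    ← Submodule.Quotient.mk_smul, Ideal.Quotient.mk_eq_mk, Ideal.Quotient.mk_eq_mk,
    quotient_mk_eq_iff_pow_dvd, smul_eq_mul, ← ht, ← dvd_neg, neg_sub]
  exact hf m (n + m) (Nat.le_add_left _ _)

theorem smul_eq_zero_of_prime {s : AdicCompletion (Ideal.span {p}) R} (hs : p • s = 0) : s = 0 := by
  obtain ⟨f, hf, hfs⟩ := exists_evalₐ_eq s
  refine AdicCompletion.ext_evalₐ fun n => ?_
  have h := congrArg (AdicCompletion.evalₐ (Ideal.span {p}) (n + 1)) hs
  rw [map_smul, hfs, ← Ideal.Quotient.mk_eq_mk, ← Submodule.Quotient.mk_smul,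
    Ideal.Quotient.mk_eq_mk, map_zero, ← map_zero (Ideal.Quotient.mk _),
    quotient_mk_eq_iff_pow_dvd, sub_zero, smul_eq_mul, pow_succ',
    mul_dvd_mul_iff_left hp.ne_zero] at h
  rw [hfs, map_zero, ← map_zero (Ideal.Quotient.mk _), quotient_mk_eq_iff_pow_dvd, sub_zero]
  have := dvd_sub h (hf n (n + 1) (Nat.le_succ n))
  rwa [sub_sub_cancel] at this

theorem pow_smul_eq_zero_of_prime {s : AdicCompletion (Ideal.span {p}) R} (n : ℕ)
    (hs : p ^ n • s = 0) : s = 0 := by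
  induction n with
  | zero => simpa using hs
  | succ n ih => rw [pow_succ', mul_smul] at hs; exact ih (smul_eq_zero_of_prime hp hs)

/-- Every nonzero element is a power of `p` times an element that is nonzero modulo `p`. Powers of
`p` act injectively, and `R` modulo `p` is a domain. -/
theorem isDomain_adicCompletion_of_prime : IsDomain (AdicCompletion (Ideal.span {p}) R) := by
  have hI : (Ideal.span {p} ^ 1).IsPrime := by
    rw [pow_one]
    exact (Ideal.span_singleton_prime hp.ne_zero).2 hp
  have hQ : IsDomain (R ⧸ Ideal.span {p} ^ 1) := Ideal.Quotient.isDomain _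
  have hfac : ∀ s : AdicCompletion (Ideal.span {p}) R, s ≠ 0 → ∃ n t, s = p ^ n • t ∧
      AdicCompletion.evalₐ (Ideal.span {p}) 1 t ≠ 0 := by
    classical
    intro s hs
    have hex : ∃ n, AdicCompletion.evalₐ (Ideal.span {p}) n s ≠ 0 := by
      by_contra! h
      exact hs (AdicCompletion.ext_evalₐ fun n => by rw [h n, map_zero])
    obtain ⟨m, hm⟩ : ∃ m, Nat.find hex = m + 1 := by
      refine Nat.exists_eq_succ_of_ne_zero fun h => ?_
      have h1 := Nat.find_spec hex
      rw [h] at h1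
      obtain ⟨r, hr⟩ := Ideal.Quotient.mk_surjective (AdicCompletion.evalₐ (Ideal.span {p}) 0 s)
      refine h1 ?_
      rw [← hr, ← map_zero (Ideal.Quotient.mk _), quotient_mk_eq_iff_pow_dvd, pow_zero]
      exact one_dvd _
    have h1 := Nat.find_spec hex
    have h2 : AdicCompletion.evalₐ (Ideal.span {p}) m s = 0 := by
      by_contra h
      exact Nat.find_min hex (by omega) h
    rw [hm] at h1
    obtain ⟨t, rfl⟩ := exists_eq_pow_smul_of_evalₐ_eq_zero hp h2
    refine ⟨m, t, rfl, fun h => h1 ?_⟩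
    obtain ⟨t', rfl⟩ := exists_eq_pow_smul_of_evalₐ_eq_zero hp h
    rw [smul_smul, ← pow_add, map_smul]
    obtain ⟨r, hr⟩ := Ideal.Quotient.mk_surjective
      (AdicCompletion.evalₐ (Ideal.span {p}) (m + 1) t')
    rw [← hr, ← Ideal.Quotient.mk_eq_mk, ← Submodule.Quotient.mk_smul, Ideal.Quotient.mk_eq_mk,
      ← map_zero (Ideal.Quotient.mk _), quotient_mk_eq_iff_pow_dvd, sub_zero]
    exact dvd_mul_right _ _
  have : Nontrivial (AdicCompletion (Ideal.span {p}) R) :=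
    (AdicCompletion.evalₐ (Ideal.span {p}) 1).toRingHom.domain_nontrivial
  have : NoZeroDivisors (AdicCompletion (Ideal.span {p}) R) := by
    refine ⟨fun {s t} hst => ?_⟩
    by_contra! h
    obtain ⟨m, s', rfl, hs'⟩ := hfac s h.1
    obtain ⟨n, t', rfl, ht'⟩ := hfac t h.2
    rw [smul_mul_smul_comm, ← pow_add] at hst
    have := congrArg (AdicCompletion.evalₐ (Ideal.span {p}) 1)
      (pow_smul_eq_zero_of_prime hp _ hst)
    rw [map_mul, map_zero] at this
    exact (mul_ne_zero hs' ht') this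
  exact NoZeroDivisors.to_isDomain _

/-- Power series in `p` with coefficients `0` and `1` are distinct: the first differing coefficient
is detected modulo the next power of `p`. -/
theorem uncountable_adicCompletion_of_prime :
    Uncountable (AdicCompletion (Ideal.span {p}) R) := by
  classical
  rw [← not_countable_iff]
  intro hc
  let g : (ℕ → Prop) → ℕ → R := fun ε n => ∑ i ∈ Finset.range n, if ε i then p ^ i else 0
  have hg : ∀ ε n, p ^ n ∣ g ε (n + 1) - g ε n := by
    intro ε n
    simp only [g, Finset.sum_range_succ, add_sub_cancel_left]
    split_ifs
    · exact dvd_rfl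
    · exact dvd_zero _
  choose F hF using fun ε => exists_of_coherent (hg ε)
  have hinj : Function.Injective F := by
    intro ε ε' h
    have hd : ∀ n, p ^ n ∣ g ε n - g ε' n := fun n => by
      rw [← quotient_mk_eq_iff_pow_dvd, ← hF, ← hF, h]
    have hnd : ∀ n, ¬ p ^ (n + 1) ∣ p ^ n := fun n h => hp.not_isUnit <| by
      rw [pow_succ, ← mul_one (p ^ n), mul_assoc, one_mul,
        mul_dvd_mul_iff_left (pow_ne_zero n hp.ne_zero)] at h
      exact isUnit_of_dvd_one h
    have key : ∀ n, ε n = ε' n := by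
      intro n
      induction n using Nat.strong_induction_on with
      | _ n ih =>
        have h1 := hd (n + 1)
        have h2 : g ε n = g ε' n := Finset.sum_congr rfl fun i hi =>
          if_congr (iff_of_eq (ih i (Finset.mem_range.1 hi))) rfl rfl
        have h3 : ∀ ε, g ε (n + 1) = g ε n + if ε n then p ^ n else 0 :=
          fun ε => Finset.sum_range_succ _ _
        rw [h3, h3, h2, add_sub_add_left_eq_sub] at h1
        by_cases e : ε n <;> by_cases e' : ε' n
        · simp only [e, e']
        · simp only [e, e', if_true, if_false, sub_zero] at h1
          exact absurd h1 (hnd n)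
        · simp only [e, e', if_true, if_false, zero_sub, dvd_neg] at h1
          exact absurd h1 (hnd n)
        · simp only [e, e']
    exact funext key
  have : Countable (Set ℕ) := hinj.countable
  obtain ⟨c, hc⟩ := exists_injective_nat (Set ℕ)
  exact Function.cantor_injective c hc

omit hp in
-- A finite transcendence basis would make `S` algebraic over a countable ring, hence countable.
theorem exists_algebraicIndependent [Countable R] {S : Type u} [CommRing S] [IsDomain S]
    [Algebra R S] (hinj : Function.Injective (algebraMap R S)) [Uncountable S] (σ : Type)
    [Countable σ] : ∃ ζ : σ → S, AlgebraicIndependent R ζ := by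
  have : FaithfulSMul R S := (faithfulSMul_iff_algebraMap_injective R S).2 hinj
  obtain ⟨s, hs⟩ := exists_isTranscendenceBasis R S
  have hunc : Infinite s := by
    by_contra hfin
    rw [not_infinite_iff_finite] at hfin
    have halg := hs.isAlgebraic
    have h1 := Algebra.IsAlgebraic.cardinalMk_le_max
      (Algebra.adjoin R (Set.range ((↑) : s → S))) S
    rw [← Cardinal.mk_congr hs.1.aevalEquiv.toEquiv] at h1
    have h2 : Countable (MvPolynomial s R) := by
      rw [← Cardinal.mk_le_aleph0_iff]
      refine MvPolynomial.cardinalMk_le_max.trans ?_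
      simp
    rw [max_eq_right (Cardinal.mk_le_aleph0_iff.2 h2), Cardinal.mk_le_aleph0_iff] at h1
    exact not_countable h1
  obtain ⟨c, hc⟩ := exists_injective_nat σ
  exact ⟨_, hs.1.comp (fun i => Infinite.natEmbedding s (c i))
    ((Infinite.natEmbedding s).injective.comp hc)⟩

end Completion

section Affine

open MvPolynomial

variable {R : Type u} [CommRing R] {ι : Type} (s : Finset ι)

/-- A polynomial of degree at most one in the variables numbered by `s`. -/
noncomputable def affineForm (a : R) (x x' : ι → R) : MvPolynomial (ι × Bool) R :=
  C a + ∑ c ∈ s, (monomial (Finsupp.single (c, false) 1) (x c) +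
    monomial (Finsupp.single (c, true) 1) (x' c))

variable (a : R) (x x' : ι → R)

theorem coeff_zero_affineForm : coeff 0 (affineForm s a x x') = a := by
  classical
  simp [affineForm, coeff_sum, coeff_monomial]

theorem coeff_false_affineForm (hx : ∀ c ∉ s, x c = 0) (c : ι) :
    coeff (Finsupp.single (c, false) 1) (affineForm s a x x') = x c := by
  classical
  simp [affineForm, coeff_sum, coeff_monomial, coeff_C, Finsupp.single_left_inj,
    eq_comm (a := (0 : ι × Bool →₀ ℕ))]
  exact fun h => (hx c h).symm

theorem coeff_true_affineForm (hx : ∀ c ∉ s, x' c = 0) (c : ι) :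
    coeff (Finsupp.single (c, true) 1) (affineForm s a x x') = x' c := by
  classical
  simp [affineForm, coeff_sum, coeff_monomial, coeff_C, Finsupp.single_left_inj,
    eq_comm (a := (0 : ι × Bool →₀ ℕ))]
  exact fun h => (hx c h).symm

theorem coeff_add_affineForm (d e : ι × Bool) :
    coeff (Finsupp.single d 1 + Finsupp.single e 1) (affineForm s a x x') = 0 := by
  classical
  have h : ∀ f : ι × Bool, Finsupp.single f 1 ≠ Finsupp.single d 1 + Finsupp.single e 1 := by
    intro f h
    have := congrArg Finsupp.degree h
    simp at this
  have h0 : (0 : ι × Bool →₀ ℕ) ≠ Finsupp.single d 1 + Finsupp.single e 1 := by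
    intro h
    have := congrArg Finsupp.degree h
    simp at this
  simp [affineForm, coeff_sum, coeff_monomial, coeff_C, h, h0]

theorem aeval_affineForm {S : Type u} [CommRing S] [Algebra R S] (ζ : ι × Bool → S) :
    aeval ζ (affineForm s a x x') = algebraMap R S a +
      ∑ c ∈ s, (ζ (c, false) * algebraMap R S (x c) + ζ (c, true) * algebraMap R S (x' c)) := by
  simp [affineForm, aeval_monomial, mul_comm]

variable {s}

/-- By independence this is an identity of polynomials. The left side is an affine form times a
variable, twice, and the right side is affine, so the quadratic coefficients vanish and the linear
ones identify `z j` and `z' j` with the constant terms. -/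
theorem affine_relation {S : Type u} [CommRing S] [Algebra R S] {ζ : ι × Bool → S}
    (hζ : AlgebraicIndependent R ζ) {a b d : R} {x x' y y' z z' : ι → R}
    (hx : ∀ c ∉ s, x c = 0) (hx' : ∀ c ∉ s, x' c = 0) (hy : ∀ c ∉ s, y c = 0)
    (hz : ∀ c ∉ s, z c = 0) (hz' : ∀ c ∉ s, z' c = 0) (j : ι)
    (h : ζ (j, false) * (algebraMap R S a + ∑ c ∈ s,
        (ζ (c, false) * algebraMap R S (x c) + ζ (c, true) * algebraMap R S (x' c))) +
      ζ (j, true) * (algebraMap R S b + ∑ c ∈ s,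
        (ζ (c, false) * algebraMap R S (y c) + ζ (c, true) * algebraMap R S (y' c))) =
      algebraMap R S d + ∑ c ∈ s,
        (ζ (c, false) * algebraMap R S (z c) + ζ (c, true) * algebraMap R S (z' c))) :
    (∀ c, x c = 0) ∧ (∀ c, c ≠ j → y c = 0) ∧ x' j + y j = 0 ∧ z j = a ∧ z' j = b := by
  classical
  have hP : affineForm s a x x' * X (j, false) + affineForm s b y y' * X (j, true) =
      affineForm s d z z' := by
    apply hζ
    rw [map_add, map_mul, map_mul, aeval_X, aeval_X, aeval_affineForm, aeval_affineForm,
      aeval_affineForm, ← h]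
    ring
  refine ⟨fun c => ?_, fun c hc => ?_, ?_, ?_, ?_⟩
  · have := congrArg (coeff (Finsupp.single (c, false) 1 + Finsupp.single (j, false) 1)) hP
    rw [coeff_add, coeff_mul_X, coeff_false_affineForm s a x x' hx, coeff_mul_X',
      coeff_add_affineForm, if_neg (by simp), add_zero] at this
    exact this
  · have := congrArg (coeff (Finsupp.single (c, false) 1 + Finsupp.single (j, true) 1)) hP
    rw [coeff_add, coeff_mul_X, coeff_false_affineForm s b y y' hy, coeff_mul_X',
      coeff_add_affineForm, if_neg (by simp [hc]), zero_add] at this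
    exact this
  · have := congrArg (coeff (Finsupp.single (j, false) 1 + Finsupp.single (j, true) 1)) hP
    rw [coeff_add, coeff_mul_X, coeff_false_affineForm s b y y' hy, add_comm (Finsupp.single _ _),
      coeff_mul_X, coeff_true_affineForm s a x x' hx', coeff_add_affineForm] at this
    exact this
  · have := congrArg (coeff (0 + Finsupp.single (j, false) 1)) hP
    rw [coeff_add, coeff_mul_X, coeff_zero_affineForm, coeff_mul_X', if_neg (by simp), zero_add,
      coeff_false_affineForm s d z z' hz, add_zero] at this
    exact this.symm
  · have := congrArg (coeff (0 + Finsupp.single (j, true) 1)) hP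
    rw [coeff_add, coeff_mul_X, coeff_zero_affineForm, coeff_mul_X', if_neg (by simp), zero_add,
      zero_add, coeff_true_affineForm s d z z' hz'] at this
    exact this.symm

end Affine

end CountableModels


/-! ### Prime elements code operators -/

namespace CountableModels

universe u

section Vectors

variable {𝔅 : Type*} {S k : Type*} [CommRing S] [CommRing k] (res : S →+* k)

theorem mapVec_intExt (q : 𝔅 → 𝔅 →₀ ℤ) (x : 𝔅 →₀ S) :
    mapVec res (intExt S q x) = intExt k q (mapVec res x) := by
  induction x using Finsupp.induction_linear with
  | zero => simp only [map_zero]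
  | add x y hx hy => simp only [map_add, hx, hy]
  | single b s =>
    have h1 : (.single b s : 𝔅 →₀ S) = s • .single b 1 := by simp
    rw [h1, map_smul, mapVec_smul, mapVec_smul, map_smul, intExt_single_one, mapVec_castVec,
      mapVec_single, map_one, intExt_single_one]

theorem mapVec_apply (x : 𝔅 →₀ S) (b : 𝔅) : mapVec res x b = res (x b) := rfl

theorem mapVec_algebraMap_smul {R : Type*} [CommRing R] [Algebra R S] (r : R) (x : 𝔅 →₀ R) :
    mapVec (algebraMap R S) (r • x) = r • mapVec (algebraMap R S) x := by
  rw [mapVec_smul, algebraMap_smul]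

end Vectors

section Lattice

variable {R S : Type u} [CommRing R] [CommRing S] [Algebra R S] {𝔅 ι : Type}
  {op : ι → 𝔅 → 𝔅 →₀ ℤ} {ξ η : ι → S} {B : Set 𝔅}

theorem exists_coordinates_of_mem_lattice {x : 𝔅 →₀ S} (hx : x ∈ lattice R op ξ η B) :
    ∃ (v₀ : 𝔅 →₀ R) (v : ι →₀ 𝔅 →₀ R), v₀ ∈ Finsupp.supported R R B ∧
      x = mapVec (algebraMap R S) v₀ + v.sum fun c u => ξ c • mapVec (algebraMap R S) u +
        η c • mapVec (algebraMap R S) (intExt R (op c) u) := by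
  classical
  have h0 : ∀ c, ξ c • mapVec (algebraMap R S) (0 : 𝔅 →₀ R) +
      η c • mapVec (algebraMap R S) (intExt R (op c) 0) = 0 := by simp
  induction hx using Submodule.span_induction with
  | mem x hx =>
    obtain ⟨⟨c, b⟩, hb, rfl⟩ := hx
    rcases c with _ | c
    · refine ⟨.single b 1, 0, Finsupp.single_mem_supported R 1 hb, ?_⟩
      rw [latticeGen, mapVec_single, map_one, Finsupp.sum_zero_index, add_zero]
    · refine ⟨0, .single c (.single b 1), zero_mem _, ?_⟩
      rw [Finsupp.sum_single_index (h0 c), intExt_single_one, latticeGen, mapVec_single, map_one,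
        mapVec_castVec, map_zero, zero_add]
  | zero => exact ⟨0, 0, zero_mem _, by simp⟩
  | add x y _ _ hx hy =>
    obtain ⟨v₀, v, hv, rfl⟩ := hx
    obtain ⟨w₀, w, hw, rfl⟩ := hy
    refine ⟨v₀ + w₀, v + w, add_mem hv hw, ?_⟩
    rw [Finsupp.sum_add_index' h0, map_add, add_add_add_comm]
    intro c a b
    simp only [map_add, smul_add]
    rw [add_add_add_comm]
  | smul a x _ hx =>
    obtain ⟨v₀, v, hv, rfl⟩ := hx
    refine ⟨a • v₀, a • v, Submodule.smul_mem _ _ hv, ?_⟩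
    rw [Finsupp.sum_smul_index' h0, mapVec_algebraMap_smul, smul_add, Finsupp.smul_sum]
    congr 2
    funext c u
    rw [LinearMap.map_smul, mapVec_algebraMap_smul, mapVec_algebraMap_smul, smul_add, smul_comm a,
      smul_comm a]

/-- The index set `s` is left free so that several vectors can be expanded over the same one. -/
theorem exists_coordinates_apply {x : 𝔅 →₀ S} (hx : x ∈ lattice R op ξ η B) :
    ∃ (v₀ : 𝔅 →₀ R) (v : ι →₀ 𝔅 →₀ R), v₀ ∈ Finsupp.supported R R B ∧
      ∀ (b : 𝔅) (s : Finset ι), v.support ⊆ s →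
      x b = algebraMap R S (v₀ b) + ∑ c ∈ s, (ξ c * algebraMap R S (v c b) +
        η c * algebraMap R S (intExt R (op c) (v c) b)) := by
  obtain ⟨v₀, v, hv, rfl⟩ := exists_coordinates_of_mem_lattice hx
  refine ⟨v₀, v, hv, fun b s hs => ?_⟩
  rw [Finsupp.sum_of_support_subset v hs _ (by simp), Finsupp.add_apply, Finsupp.finsetSum_apply]
  rfl

end Lattice

/-- A ring with a dense embedding into a ring of infinite transcendence degree codes operators. -/
theorem codesOperators_of_dense {R S k : Type u} [CommRing R] [CommRing S] [CommRing k] [IsDomain k]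
    [Algebra R S] [Countable R] {p : R} (res : S →+* k)
    (hres : ∀ x, ∃ r : R, res (algebraMap R S r) = x) (hresp : res (algebraMap R S p) = 0)
    (hker : ∀ s, res s = 0 → ∃ t, s = p • t)
    (hdense : ∀ n (s : S), ∃ r t, s = algebraMap R S r + p ^ n • t)
    (hsep : ∀ s : S, (∀ n, ∃ t, s = p ^ n • t) → s = 0)
    (hpS : ∀ s : S, p • s = 0 → s = 0)
    (hind : ∀ (σ : Type) [Countable σ], ∃ ζ : σ → S, AlgebraicIndependent R ζ) :
    CodesOperators R := by
  classical
  intro 𝔅 ι _ _ op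
  obtain ⟨ζ, hζ⟩ := hind (ι × Bool)
  refine codesOperator_of_purified (ξ := fun c => ζ (c, false)) (η := fun c => ζ (c, true))
    (p := p) res hres hpS ?_ ?_
  · intro B B' _ _ φ x hx
    have hdiv : ∀ b, ∃ t, (x : 𝔅 →₀ S) b = p • t := fun b => hker _ (DFunLike.congr_fun hx b)
    choose t ht using hdiv
    have hy : (x : 𝔅 →₀ S) = p ^ 1 • Finsupp.onFinset (x : 𝔅 →₀ S).support t (fun b hb => by
        rw [Finsupp.mem_support_iff, ht]
        exact fun h => hb (hpS _ h)) := by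
      ext1 b
      rw [pow_one]
      exact ht b
    -- This is where purification is used: a vector with zero reduction is `p` times an element of
    -- the same module, so its image is also a multiple of `p`.
    obtain ⟨y, hxy⟩ : ∃ y, x = p ^ 1 • y :=
      ⟨⟨_, mem_purified_of_smul_mem (hy ▸ x.2)⟩, Subtype.ext hy⟩
    rw [hxy, map_smul, Submodule.coe_smul]
    rw [mapVec_algebra_smul, pow_one, hresp, zero_smul]
  · intro B B' hB hB' φ j b hb x y hx hy
    have hwmem := graph_mem_lattice (R := R) (op := op) (ξ := fun c => ζ (c, false))
      (η := fun c => ζ (c, true)) hb j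
    rw [← hx, ← hy] at hwmem
    let w : purified R op (fun c => ζ (c, false)) (fun c => ζ (c, true)) p B :=
      ⟨_, lattice_le_purified hwmem⟩
    -- Although `φ` is only `R`-linear, it respects the scalars `ζ`: approximating them by elements
    -- of `R` modulo `p ^ n` leaves an error `p ^ n • u` with `u` in the purified lattice, and `S`
    -- is separated.
    have hφw : (φ w : 𝔅 →₀ S) = ζ (j, false) • (φ x : 𝔅 →₀ S) + ζ (j, true) • (φ y : 𝔅 →₀ S) := by
      ext1 b'
      rw [← sub_eq_zero]
      refine hsep _ fun n => ?_
      obtain ⟨r, t, hr⟩ := hdense n (ζ (j, false))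
      obtain ⟨r', t', hr'⟩ := hdense n (ζ (j, true))
      have h1 : ((w - r • x - r' • y : purified R op _ _ p B) : 𝔅 →₀ S) =
          p ^ n • (t • (x : 𝔅 →₀ S) + t' • (y : 𝔅 →₀ S)) := by
        simp only [w, Submodule.coe_sub, Submodule.coe_smul]
        rw [hr, hr', add_smul, add_smul, algebraMap_smul, algebraMap_smul, smul_add, smul_assoc,
          smul_assoc]
        abel
      obtain ⟨u, hu⟩ : ∃ u, w - r • x - r' • y = p ^ n • u :=
        ⟨⟨_, mem_purified_of_smul_mem (h1 ▸ Subtype.prop _)⟩, Subtype.ext h1⟩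
      have h2 := congrArg φ hu
      rw [map_sub φ, map_sub φ, map_smul, map_smul, map_smul] at h2
      replace h2 : (φ w : 𝔅 →₀ S) b' - r • (φ x : 𝔅 →₀ S) b' - r' • (φ y : 𝔅 →₀ S) b' =
          p ^ n • (φ u : 𝔅 →₀ S) b' := congrArg (fun g : purified R op _ _ p B' => (g : 𝔅 →₀ S) b') h2
      have h3 : (φ w : 𝔅 →₀ S) b' - (ζ (j, false) • (φ x : 𝔅 →₀ S) +
          ζ (j, true) • (φ y : 𝔅 →₀ S)) b' = p ^ n • ((φ u : 𝔅 →₀ S) b' -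
            t * (φ x : 𝔅 →₀ S) b' - t' * (φ y : 𝔅 →₀ S) b') := by
        rw [smul_sub, smul_sub, ← h2, Finsupp.add_apply, Finsupp.smul_apply, Finsupp.smul_apply,
          smul_eq_mul, smul_eq_mul, hr, hr']
        simp only [Algebra.smul_def]
        ring
      exact ⟨_, h3⟩
    obtain ⟨N₁, hN₁⟩ := (φ x).2
    obtain ⟨N₂, hN₂⟩ := (φ y).2
    obtain ⟨N₃, hN₃⟩ := (φ w).2
    have hup : ∀ (M N : ℕ) (v : 𝔅 →₀ S), p ^ N • v ∈ lattice R op (fun c => ζ (c, false))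
        (fun c => ζ (c, true)) B' → p ^ (M + N) • v ∈ lattice R op (fun c => ζ (c, false))
        (fun c => ζ (c, true)) B' := fun M N v h => by
      rw [pow_add, mul_smul]
      exact Submodule.smul_mem _ _ h
    set N := N₁ + N₂ + N₃ with hN
    obtain ⟨x₀, x₁, -, hX⟩ := exists_coordinates_apply (show p ^ N • (φ x : 𝔅 →₀ S) ∈ _ by
      rw [hN, show N₁ + N₂ + N₃ = (N₂ + N₃) + N₁ by ring]; exact hup _ _ _ hN₁)
    obtain ⟨y₀, y₁, -, hY⟩ := exists_coordinates_apply (show p ^ N • (φ y : 𝔅 →₀ S) ∈ _ by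
      rw [hN, show N₁ + N₂ + N₃ = (N₁ + N₃) + N₂ by ring]; exact hup _ _ _ hN₂)
    obtain ⟨z₀, z₁, -, hZ⟩ := exists_coordinates_apply (show p ^ N • (φ w : 𝔅 →₀ S) ∈ _ from
      hup _ _ _ hN₃)
    set s : Finset ι := x₁.support ∪ y₁.support ∪ z₁.support with hs
    have hsx : x₁.support ⊆ s := fun c hc => by simp only [hs, Finset.mem_union]; tauto
    have hsy : y₁.support ⊆ s := fun c hc => by simp only [hs, Finset.mem_union]; tauto
    have hsz : z₁.support ⊆ s := fun c hc => by simp only [hs, Finset.mem_union]; tauto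
    have hout : ∀ (v : ι →₀ 𝔅 →₀ R), v.support ⊆ s → ∀ c ∉ s, v c = 0 := fun v hv c hc =>
      Finsupp.notMem_support_iff.1 fun h => hc (hv h)
    -- In each coordinate, `hφw` times `p ^ N` is a relation between affine forms in the independent
    -- scalars.
    have key := fun b' => affine_relation (s := s) hζ (a := x₀ b') (b := y₀ b') (d := z₀ b')
      (x := fun c => x₁ c b') (x' := fun c => intExt R (op c) (x₁ c) b')
      (y := fun c => y₁ c b') (y' := fun c => intExt R (op c) (y₁ c) b')
      (z := fun c => z₁ c b') (z' := fun c => intExt R (op c) (z₁ c) b')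
      (fun c hc => by rw [hout _ hsx c hc]; rfl)
      (fun c hc => by rw [hout _ hsx c hc, map_zero]; rfl)
      (fun c hc => by rw [hout _ hsy c hc]; rfl)
      (fun c hc => by rw [hout _ hsz c hc]; rfl)
      (fun c hc => by rw [hout _ hsz c hc, map_zero]; rfl) j (by
        rw [← hX b' s hsx, ← hY b' s hsy, ← hZ b' s hsz, hφw]
        simp only [Finsupp.smul_apply, Finsupp.add_apply, smul_eq_mul, smul_add, Algebra.smul_def]
        ring)
    have hx1 : ∀ c, x₁ c = 0 := fun c => Finsupp.ext fun b' => (key b').1 c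
    have hy1 : ∀ c, y₁ c = 0 := fun c => Finsupp.ext fun b' => by
      by_cases h : c = j
      · subst h
        -- This relation also contains `op j` applied to `x₁ j`, already known to vanish.
        have := (key b').2.2.1
        simpa only [hx1, map_zero, Finsupp.zero_apply, zero_add] using this
      · exact (key b').2.1 c h
    have hz1 : z₁ j = x₀ := Finsupp.ext fun b' => (key b').2.2.2.1
    have hz2 : intExt R (op j) (z₁ j) = y₀ := Finsupp.ext fun b' => (key b').2.2.2.2
    have hX' : p ^ N • (φ x : 𝔅 →₀ S) = mapVec (algebraMap R S) x₀ := by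
      ext1 b'
      rw [hX b' s hsx]
      simp [hx1, mapVec_apply]
    have hY' : p ^ N • (φ y : 𝔅 →₀ S) = mapVec (algebraMap R S) y₀ := by
      ext1 b'
      rw [hY b' s hsy]
      simp [hy1, mapVec_apply]
    have hfin : (φ y : 𝔅 →₀ S) = intExt S (op j) (φ x : 𝔅 →₀ S) := by
      apply pow_smul_vec_injective hpS N
      rw [hY', ← LinearMap.map_smul_of_tower, hX', ← mapVec_intExt, ← hz2, hz1]
    rw [hfin, mapVec_intExt]

/-- `S` is the `p`-adic completion, with reduction modulo `p`; `hsep` embeds `R` in it. -/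
theorem codesOperators_of_prime {R : Type u} [CommRing R] [IsDomain R] [Countable R] {p : R}
    (hp : Prime p) (hsep : ∀ r : R, (∀ n, p ^ n ∣ r) → r = 0) : CodesOperators R := by
  have hS : IsDomain (AdicCompletion (Ideal.span {p}) R) := isDomain_adicCompletion_of_prime hp
  have hSu : Uncountable (AdicCompletion (Ideal.span {p}) R) :=
    uncountable_adicCompletion_of_prime hp
  have hev : ∀ n r, AdicCompletion.evalₐ (Ideal.span {p}) n (algebraMap R _ r) =
      Ideal.Quotient.mk _ r := fun n r => (AdicCompletion.evalₐ (Ideal.span {p}) n).commutes r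
  have hpow : ∀ n s, AdicCompletion.evalₐ (Ideal.span {p}) n (p ^ n • s) = 0 := by
    intro n s
    rw [map_smul]
    obtain ⟨r, hr⟩ := Ideal.Quotient.mk_surjective (AdicCompletion.evalₐ (Ideal.span {p}) n s)
    rw [← hr, ← Ideal.Quotient.mk_eq_mk, ← Submodule.Quotient.mk_smul, Ideal.Quotient.mk_eq_mk,
      ← map_zero (Ideal.Quotient.mk _), quotient_mk_eq_iff_pow_dvd, sub_zero]
    exact dvd_mul_right _ _
  have hinj : Function.Injective (algebraMap R (AdicCompletion (Ideal.span {p}) R)) := by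
    refine (injective_iff_map_eq_zero _).2 fun r hr => hsep r fun n => ?_
    have := hev n r
    rwa [hr, map_zero, eq_comm, ← map_zero (Ideal.Quotient.mk _), quotient_mk_eq_iff_pow_dvd,
      sub_zero] at this
  have hI : (Ideal.span {p} ^ 1).IsPrime := by
    rw [pow_one]
    exact (Ideal.span_singleton_prime hp.ne_zero).2 hp
  have hQ : IsDomain (R ⧸ Ideal.span {p} ^ 1) := Ideal.Quotient.isDomain _
  refine codesOperators_of_dense (p := p)
    (AdicCompletion.evalₐ (Ideal.span {p}) 1).toRingHom
    (fun x => ?_) ?_ (fun s hs => ?_) (fun n s => ?_) (fun s hs => ?_)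
    (fun s => smul_eq_zero_of_prime hp) (fun σ _ => exists_algebraicIndependent hinj σ)
  · obtain ⟨r, rfl⟩ := Ideal.Quotient.mk_surjective x
    exact ⟨r, hev 1 r⟩
  · refine (hev 1 p).trans ?_
    rw [← map_zero (Ideal.Quotient.mk _), quotient_mk_eq_iff_pow_dvd, sub_zero, pow_one]
  · simpa using exists_eq_pow_smul_of_evalₐ_eq_zero hp hs
  · obtain ⟨r, hr⟩ := Ideal.Quotient.mk_surjective (AdicCompletion.evalₐ (Ideal.span {p}) n s)
    obtain ⟨t, ht⟩ := exists_eq_pow_smul_of_evalₐ_eq_zero hp (s := s - algebraMap R _ r) (n := n)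
      (by rw [map_sub]; exact sub_eq_zero.2 (hr.symm.trans (hev n r).symm))
    exact ⟨r, t, by rw [← ht, add_sub_cancel]⟩
  · refine AdicCompletion.ext_evalₐ fun n => ?_
    obtain ⟨t, rfl⟩ := hs n
    rw [hpow, map_zero]

end CountableModels


/-! ### Partial sums without linear relations -/

namespace CountableModels

universe u

section PartialSums

variable {R : Type u} [CommRing R]

open Classical in
/-- The partial sums of a sequence over a set of indices. -/
noncomputable def partialSum (a : ℕ → R) (P : Set ℕ) (n : ℕ) : R :=
  ∑ m ∈ Finset.range n, if m ∈ P then a m else 0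

variable {a : ℕ → R}

theorem partialSum_succ_of_mem {P : Set ℕ} {n : ℕ} (h : n ∈ P) :
    partialSum a P (n + 1) = partialSum a P n + a n := by
  rw [partialSum, Finset.sum_range_succ, if_pos h, partialSum]

theorem partialSum_succ_of_notMem {P : Set ℕ} {n : ℕ} (h : n ∉ P) :
    partialSum a P (n + 1) = partialSum a P n := by
  rw [partialSum, Finset.sum_range_succ, if_neg h, partialSum, add_zero]

theorem exists_partialSum_add (I : Ideal R) (ha : ∀ d m, d < m → ∃ e ∈ I, a m = a d * e)
    (P : Set ℕ) (d n : ℕ) :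
    ∃ e ∈ I, partialSum a P (d + 1 + n) = partialSum a P (d + 1) + a d * e := by
  induction n with
  | zero => exact ⟨0, zero_mem _, by rw [mul_zero, add_zero, add_zero]⟩
  | succ n ih =>
    obtain ⟨e, he, h⟩ := ih
    by_cases hP : d + 1 + n ∈ P
    · obtain ⟨e', he', h'⟩ := ha d (d + 1 + n) (by omega)
      refine ⟨e + e', add_mem he he', ?_⟩
      rw [← add_assoc, partialSum_succ_of_mem hP, h, h']
      ring
    · exact ⟨e, he, by rw [← add_assoc, partialSum_succ_of_notMem hP, h]⟩

/-- At the first index `d` in which the sets differ, the sums differ by `± a d`; later terms change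
this only by multiples of `a d` with factors in the maximal ideal. -/
theorem exists_partialSum_sub_eq [IsLocalRing R]
    (ha : ∀ d m, d < m → ∃ e ∈ IsLocalRing.maximalIdeal R, a m = a d * e) {P Q : Set ℕ}
    (h : P ≠ Q) : ∃ d, ∀ n, ∃ u, IsUnit u ∧
      partialSum a P (d + 1 + n) - partialSum a Q (d + 1 + n) = a d * u := by
  classical
  have hex : ∃ d, ¬ (d ∈ P ↔ d ∈ Q) := by
    by_contra! hcon
    exact h (Set.ext hcon)
  refine ⟨Nat.find hex, fun n => ?_⟩
  have hd := Nat.find_spec hex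
  have hlt : ∀ i < Nat.find hex, (i ∈ P ↔ i ∈ Q) := fun i hi => not_not.1 (Nat.find_min hex hi)
  generalize Nat.find hex = d at hd hlt ⊢
  have h0 : partialSum a P d = partialSum a Q d := Finset.sum_congr rfl fun i hi =>
    if_congr (hlt i (Finset.mem_range.1 hi)) rfl rfl
  obtain ⟨e, he, h1⟩ := exists_partialSum_add _ ha P d n
  obtain ⟨e', he', h2⟩ := exists_partialSum_add _ ha Q d n
  have hee : e - e' ∈ IsLocalRing.maximalIdeal R := sub_mem he he'
  have hu : ∀ v : R, IsUnit v → IsUnit (v + (e - e')) := by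
    intro v hv
    by_contra hnu
    have h3 := sub_mem ((IsLocalRing.mem_maximalIdeal _).2 hnu) hee
    rw [add_sub_cancel_right] at h3
    exact (IsLocalRing.mem_maximalIdeal _).1 h3 hv
  by_cases hP : d ∈ P
  · have hQ : d ∉ Q := fun hQ => hd ⟨fun _ => hQ, fun _ => hP⟩
    refine ⟨1 + (e - e'), hu _ isUnit_one, ?_⟩
    rw [h1, h2, partialSum_succ_of_mem hP, partialSum_succ_of_notMem hQ, h0]
    ring
  · have hQ : d ∈ Q := by_contra fun hQ => hd ⟨fun h => absurd h hP, fun h => absurd h hQ⟩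
    refine ⟨-1 + (e - e'), hu _ isUnit_one.neg, ?_⟩
    rw [h1, h2, partialSum_succ_of_mem hQ, partialSum_succ_of_notMem hP, h0]
    ring

/-- There are uncountably many sets but countably many coefficient tuples. If every `P` were bad,
two sets would share a tuple, and the difference of their relations would put `t'` times some `a d`
into an ideal that excludes it. -/
theorem exists_set_avoiding_relations [IsLocalRing R] [Countable R] {J : ℕ → Ideal R}
    (hJ : Antitone J) (ha : ∀ d m, d < m → ∃ e ∈ IsLocalRing.maximalIdeal R, a m = a d * e)
    (N : ℕ) (f : ℕ → Set ℕ) : ∃ P : Set ℕ, ∀ (t : Fin N → R) (t' r : R),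
      (∃ n₀, ∀ n, n₀ ≤ n → ∑ i, t i * partialSum a (f i) n + t' * partialSum a P n - r ∈ J n) →
        ∃ d, ∀ n, t' * a d ∈ J n := by
  by_contra! hcon
  choose t t' r h1 k h2 using hcon
  choose n₀ h1 using h1
  have hinj : Function.Injective fun P => (t P, t' P, r P) := by
    intro P Q h
    simp only [Prod.mk.injEq] at h
    obtain ⟨e1, e2, e3⟩ := h
    by_contra hne
    obtain ⟨d, hd⟩ := exists_partialSum_sub_eq ha hne
    have hn := h2 P d
    set n := k P d
    obtain ⟨u, hu, hd⟩ := hd (n + n₀ P + n₀ Q)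
    set m := d + 1 + (n + n₀ P + n₀ Q) with hm
    have h3 := sub_mem (h1 P m (by omega)) (h1 Q m (by omega))
    rw [← e1, ← e2, ← e3, sub_sub_sub_cancel_right, add_sub_add_left_eq_sub, ← mul_sub, hd,
      ← mul_assoc] at h3
    exact hn (hJ (show n ≤ m by omega) ((Ideal.mul_unit_mem_iff_mem _ hu).1 h3))
  have : Countable (Set ℕ) := hinj.countable
  obtain ⟨c, hc⟩ := exists_injective_nat (Set ℕ)
  exact Function.cantor_injective c hc

/-- There are sets of indices such that the partial sums of a rapidly decreasing sequence over them
are linearly independent modulo constants, up to coefficients in the maximal ideal. -/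
theorem exists_independent_partialSums [IsLocalRing R] [Countable R] {J : ℕ → Ideal R}
    (hJ : Antitone J) (ha : ∀ d m, d < m → ∃ e ∈ IsLocalRing.maximalIdeal R, a m = a d * e)
    (haJ : ∀ d, ∃ n, a d ∉ J n) (σ : Type) [Countable σ] :
    ∃ Z : σ → Set ℕ, ∀ (s : Finset σ) (t : σ → R) (r : R),
      (∀ n, ∑ i ∈ s, t i * partialSum a (Z i) n - r ∈ J n) →
        ∀ i ∈ s, t i ∈ IsLocalRing.maximalIdeal R := by
  classical
  choose F hF using exists_set_avoiding_relations hJ ha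
  -- The sets are chosen recursively: stage `N` overrides entry `N` by a set that avoids relations
  -- with the earlier ones.
  let g : ℕ → ℕ → Set ℕ := fun N => Nat.rec (fun _ => ∅) (fun N f => Function.update f N (F N f)) N
  have hg : ∀ N, g (N + 1) = Function.update (g N) N (F N (g N)) := fun N => rfl
  let Z : ℕ → Set ℕ := fun N => g (N + 1) N
  have hgZ : ∀ N i, i < N → g N i = Z i := by
    intro N
    induction N with
    | zero => intro i hi; omega
    | succ N ih =>
      intro i hi
      rcases Nat.lt_succ_iff_lt_or_eq.1 hi with hi | rfl
      · rw [hg, Function.update_of_ne hi.ne, ih i hi]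
      · rfl
  have hZ : ∀ N, Z N = F N (g N) := fun N => by
    simp only [Z, hg, Function.update_self]
  -- The coefficient of the largest index kills some `a d` modulo all `J n`, so its term is constant
  -- from `d + 1` on and can be absorbed into `r`. Hence relations are only required for large `n`.
  have key : ∀ (s : Finset ℕ) (t : ℕ → R) (r : R),
      (∃ n₀, ∀ n, n₀ ≤ n → ∑ i ∈ s, t i * partialSum a (Z i) n - r ∈ J n) →
        ∀ i ∈ s, ∃ d, ∀ n, t i * a d ∈ J n := by
    intro s
    induction s using Finset.induction_on_max with
    | empty => intro t r _ i hi; simp at hi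
    | insert N s hs ih =>
      rintro t r ⟨n₀, h⟩
      have hN : N ∉ s := fun h => (hs N h).false
      have hd : ∃ d, ∀ n, t N * a d ∈ J n := by
        refine hF N (g N) (fun i => if (i : ℕ) ∈ s then t i else 0) (t N) r ⟨n₀, fun n hn => ?_⟩
        have h1 := h n hn
        rw [Finset.sum_insert hN, add_comm (t N * _)] at h1
        rw [← hZ]
        convert h1 using 3
        have h2 : ∀ i : Fin N, (if (i : ℕ) ∈ s then t i else 0) * partialSum a (g N i) n =
            (fun i : ℕ => if i ∈ s then t i * partialSum a (Z i) n else 0) i := fun i => by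
          rw [hgZ N i i.2, ite_mul, zero_mul]
        rw [Finset.sum_congr rfl fun i _ => h2 i, Fin.sum_univ_eq_sum_range
          (fun i : ℕ => if i ∈ s then t i * partialSum a (Z i) n else 0), ← Finset.sum_filter]
        congr 1
        ext i
        simp only [Finset.mem_filter, Finset.mem_range]
        exact ⟨fun h => h.2, fun h => ⟨hs i h, h⟩⟩
      obtain ⟨d, hd⟩ := hd
      intro i hi
      rcases Finset.mem_insert.1 hi with rfl | hi
      · exact ⟨d, hd⟩
      refine ih t (r - t N * partialSum a (Z N) (d + 1)) ⟨n₀ + d + 1, fun n hn => ?_⟩ i hi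
      obtain ⟨e, -, he⟩ := exists_partialSum_add _ ha (Z N) d (n - (d + 1))
      rw [show d + 1 + (n - (d + 1)) = n by omega] at he
      have h1 := h n (by omega)
      rw [Finset.sum_insert hN, he] at h1
      have h2 := sub_mem h1 (Ideal.mul_mem_right e _ (hd n))
      convert h2 using 1
      ring
  obtain ⟨c, hc⟩ := exists_injective_nat σ
  refine ⟨fun i => Z (c i), fun s t r h i hi => ?_⟩
  obtain ⟨d, hd⟩ := key (s.image c) (Function.extend c t 0) r ⟨0, fun n _ => by
    rw [Finset.sum_image hc.injOn]
    simp only [hc.extend_apply]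
    exact h n⟩ (c i) (Finset.mem_image_of_mem _ hi)
  rw [hc.extend_apply] at hd
  rw [IsLocalRing.mem_maximalIdeal]
  intro hu
  obtain ⟨n, hn⟩ := haJ d
  exact hn ((Ideal.unit_mul_mem_iff_mem _ hu).1 (hd n))

end PartialSums

end CountableModels


/-! ### Coding operators by approximable scalars -/

namespace CountableModels

universe u

/-- A ring codes operators if it has an extension by elements that are approximated by constants
independently up to coefficients in the maximal ideal. -/
theorem codesOperator_of_approximation {R S k : Type u} [CommRing R] [CommRing S] [CommRing k]
    [IsDomain k] [Algebra R S] [Countable R] {𝔅 ι : Type} [Countable 𝔅] [Countable ι]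
    (op : ι → 𝔅 → 𝔅 →₀ ℤ) (res : S →+* k) (hres : ∀ x, ∃ r : R, res (algebraMap R S r) = x)
    {ζ : ι × Bool → S} {α : ι × Bool → ℕ → R} {c : ℕ → R} (hζ : ∀ i, res (ζ i) = 0)
    (hc : ∀ i, c 0 • ζ i = 0) (hα : ∀ i n, c n • ζ i = algebraMap R S (c n * α i n))
    (hαζ : ∀ i n j, algebraMap R S (α i n) * ζ j = 0)
    (hc0 : ∀ t, algebraMap R S (c 0 * t) = 0 → res (algebraMap R S t) = 0)
    (hind : ∀ (s : Finset ι) (j : ι) (_ : j ∈ s) (x y r : R) (z z' : ι → R),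
      (∀ n, algebraMap R S (c n * (r + ∑ i ∈ s, (α (i, false) n * z i + α (i, true) n * z' i) -
        α (j, false) n * x - α (j, true) n * y)) = 0) →
      res (algebraMap R S (z j)) = res (algebraMap R S x) ∧
        res (algebraMap R S (z' j)) = res (algebraMap R S y)) : CodesOperator R op := by
  classical
  -- With `p = 1` purification adds nothing.
  have hlat : ∀ (B : Set 𝔅) (x : 𝔅 →₀ S),
      x ∈ purified R op (fun i => ζ (i, false)) (fun i => ζ (i, true)) (1 : R) B →
      x ∈ lattice R op (fun i => ζ (i, false)) (fun i => ζ (i, true)) B := by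
    rintro B x ⟨N, hN⟩
    rwa [one_pow, one_smul] at hN
  -- `c 0` annihilates all `ζ i`, so it sees only the constant part of a lattice vector, and the `ζ`
  -- part reduces to zero anyway.
  have hkey : ∀ (B : Set 𝔅) (x : 𝔅 →₀ S),
      x ∈ purified R op (fun i => ζ (i, false)) (fun i => ζ (i, true)) (1 : R) B →
      c 0 • x = 0 → mapVec res x = 0 := by
    intro B x hx h0
    obtain ⟨v₀, v, -, hv⟩ := exists_coordinates_apply (hlat B x hx)
    ext b
    have h1 : c 0 • x b = 0 := DFunLike.congr_fun h0 b
    rw [mapVec_apply, hv b _ subset_rfl]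
    rw [hv b _ subset_rfl, smul_add, Finset.smul_sum, Finset.sum_eq_zero, add_zero,
      Algebra.smul_def, ← map_mul] at h1
    · simp [hζ, hc0 _ h1]
    · intro i _
      rw [smul_add, ← smul_mul_assoc, ← smul_mul_assoc, hc, hc, zero_mul, zero_mul, add_zero]
  refine codesOperator_of_purified (ξ := fun i => ζ (i, false)) (η := fun i => ζ (i, true))
    (p := 1) res hres (fun s hs => by rwa [one_smul] at hs) ?_ ?_
  · intro B B' _ _ φ x hx
    obtain ⟨v₀, v, hv₀, hv⟩ := exists_coordinates_apply (hlat B x x.2)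
    have hv₀res : ∀ b, res (algebraMap R S (v₀ b)) = 0 := by
      intro b
      have h1 : res ((x : 𝔅 →₀ S) b) = 0 := DFunLike.congr_fun hx b
      rw [hv b _ subset_rfl] at h1
      simpa [hζ] using h1
    let e : 𝔅 → purified R op (fun i => ζ (i, false)) (fun i => ζ (i, true)) (1 : R) B := fun b =>
      if hb : b ∈ B then ⟨.single b 1, lattice_le_purified (single_mem_lattice hb)⟩ else 0
    -- The constant part of `x`. Its image reduces to zero because its coefficients do, and the rest
    -- `x - u` is annihilated by `c 0`, a property that `φ` preserves.
    let u := ∑ b ∈ v₀.support, v₀ b • e b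
    have hu : (u : 𝔅 →₀ S) = mapVec (algebraMap R S) v₀ := by
      conv_rhs => rw [← Finsupp.sum_single v₀]
      rw [Finsupp.sum, map_sum, Submodule.coe_sum]
      refine Finset.sum_congr rfl fun b hb => ?_
      have hbB : b ∈ B := hv₀ hb
      rw [Submodule.coe_smul, mapVec_single, show e b = _ from dif_pos hbB]
      change v₀ b • (.single b 1 : 𝔅 →₀ S) = _
      rw [Finsupp.smul_single, Algebra.algebraMap_eq_smul_one]
    have hφu : mapVec res (φ u : 𝔅 →₀ S) = 0 := by
      simp only [u, map_sum, map_smul, Submodule.coe_sum, Submodule.coe_smul]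
      exact Finset.sum_eq_zero fun b _ => by rw [mapVec_algebra_smul, hv₀res, zero_smul]
    have hy : c 0 • (x - u) = 0 := by
      refine Subtype.ext (Finsupp.ext fun b => ?_)
      change c 0 • ((x : 𝔅 →₀ S) b - (u : 𝔅 →₀ S) b) = 0
      rw [hu, mapVec_apply, hv b _ subset_rfl, add_sub_cancel_left, Finset.smul_sum]
      refine Finset.sum_eq_zero fun i _ => ?_
      rw [smul_add, ← smul_mul_assoc, ← smul_mul_assoc, hc, hc, zero_mul, zero_mul, add_zero]
    have h1 := hkey B' (φ (x - u)) (Subtype.prop _) (by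
      rw [← Submodule.coe_smul, ← map_smul, hy, map_zero, Submodule.coe_zero])
    rwa [map_sub φ, Submodule.coe_sub, map_sub, hφu, sub_zero] at h1
  · intro B B' hB hB' φ j b hb x y hx hy
    have hwmem := graph_mem_lattice (R := R) (op := op) (ξ := fun i => ζ (i, false))
      (η := fun i => ζ (i, true)) hb j
    rw [← hx, ← hy] at hwmem
    let w : purified R op (fun i => ζ (i, false)) (fun i => ζ (i, true)) 1 B :=
      ⟨_, lattice_le_purified hwmem⟩
    -- Multiplication by `c n` makes the scalars `ζ` indistinguishable from the constants `α n`;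
    -- this relation has coefficients in `R` and so passes through `φ`.
    have hw : ∀ n, c n • (w - α (j, false) n • x - α (j, true) n • y) = 0 := by
      intro n
      refine Subtype.ext (Finsupp.ext fun b' => ?_)
      change c n • (ζ (j, false) * (x : 𝔅 →₀ S) b' + ζ (j, true) * (y : 𝔅 →₀ S) b' -
        α (j, false) n • (x : 𝔅 →₀ S) b' - α (j, true) n • (y : 𝔅 →₀ S) b') = 0
      simp only [smul_add, smul_sub, ← smul_mul_assoc, hα, smul_smul]
      simp only [Algebra.smul_def]
      ring
    obtain ⟨x₀, x₁, -, hX⟩ := exists_coordinates_apply (hlat _ _ (φ x).2)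
    obtain ⟨y₀, y₁, -, hY⟩ := exists_coordinates_apply (hlat _ _ (φ y).2)
    obtain ⟨z₀, z₁, -, hZ⟩ := exists_coordinates_apply (hlat _ _ (φ w).2)
    -- The `ζ` parts of `φ x` and `φ y` disappear after multiplication by `α`; only the `ζ` part of
    -- `φ w` contributes.
    have hαv : ∀ (i : ι × Bool) (n : ℕ) (s : Finset ι) (f g : ι → S),
        algebraMap R S (α i n) * ∑ d ∈ s, (ζ (d, false) * f d + ζ (d, true) * g d) = 0 := by
      intro i n s f g
      rw [Finset.mul_sum]
      refine Finset.sum_eq_zero fun d _ => ?_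
      rw [mul_add, ← mul_assoc, ← mul_assoc, hαζ, hαζ, zero_mul, zero_mul, add_zero]
    have key : ∀ b', res (algebraMap R S (z₁ j b')) = res (algebraMap R S (x₀ b')) ∧
        res (algebraMap R S (intExt R (op j) (z₁ j) b')) = res (algebraMap R S (y₀ b')) := by
      intro b'
      refine hind (insert j z₁.support) j (Finset.mem_insert_self _ _) (x₀ b') (y₀ b') (z₀ b')
        (fun i => z₁ i b') (fun i => intExt R (op i) (z₁ i) b') fun n => ?_
      have h1 := congrArg φ (hw n)
      rw [map_smul, map_sub φ, map_sub φ, map_smul, map_smul, map_zero] at h1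
      replace h1 : c n • ((φ w : 𝔅 →₀ S) b' - α (j, false) n • (φ x : 𝔅 →₀ S) b' -
          α (j, true) n • (φ y : 𝔅 →₀ S) b') = 0 :=
        congrArg (fun g : purified R op _ _ (1 : R) B' => (g : 𝔅 →₀ S) b') h1
      rw [hX b' _ subset_rfl, hY b' _ subset_rfl, hZ b' _ (Finset.subset_insert j _)] at h1
      rw [Algebra.smul_def, Algebra.smul_def (α (j, false) n), Algebra.smul_def (α (j, true) n),
        mul_add (algebraMap R S (α _ n)), mul_add (algebraMap R S (α _ n)), hαv, hαv, add_zero,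
        add_zero, mul_sub, mul_sub, mul_add, Finset.mul_sum] at h1
      have h2 : ∀ i ∈ insert j z₁.support, algebraMap R S (c n) *
          (ζ (i, false) * algebraMap R S (z₁ i b') +
            ζ (i, true) * algebraMap R S (intExt R (op i) (z₁ i) b')) =
          algebraMap R S (c n * (α (i, false) n * z₁ i b' +
            α (i, true) n * intExt R (op i) (z₁ i) b')) := by
        intro i _
        rw [mul_add, ← mul_assoc, ← mul_assoc, ← Algebra.smul_def, ← Algebra.smul_def, hα, hα,
          ← map_mul, ← map_mul, ← map_add]
        congr 1
        ring
      rw [Finset.sum_congr rfl h2] at h1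
      rw [← h1]
      simp only [map_mul, map_add, map_sub, map_sum, Finset.mul_sum, mul_add, mul_sub]
    have hred : ∀ (v : 𝔅 →₀ S) (v₀ : 𝔅 →₀ R) (v₁ : ι →₀ 𝔅 →₀ R), (∀ (b : 𝔅) (s : Finset ι),
        v₁.support ⊆ s → v b = algebraMap R S (v₀ b) + ∑ i ∈ s, (ζ (i, false) *
          algebraMap R S (v₁ i b) + ζ (i, true) * algebraMap R S (intExt R (op i) (v₁ i) b))) →
        mapVec res v = mapVec (res.comp (algebraMap R S)) v₀ := by
      intro v v₀ v₁ h
      ext b'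
      rw [mapVec_apply, mapVec_apply, h b' _ subset_rfl]
      simp [hζ]
    rw [hred _ _ _ hX, hred _ _ _ hY]
    have h1 : mapVec (res.comp (algebraMap R S)) x₀ = mapVec (res.comp (algebraMap R S)) (z₁ j) :=
      Finsupp.ext fun b' => (key b').1.symm
    rw [h1, ← mapVec_intExt]
    exact Finsupp.ext fun b' => (key b').2.symm

end CountableModels


/-! ### Local rings with total divisibility and nonprincipal maximal ideal -/

namespace CountableModels

universe u

section Chain

variable {R : Type u} [CommRing R]

theorem dvd_partialSum_sub {a : ℕ → R} (ha : ∀ d m, d ≤ m → a d ∣ a m) (P : Set ℕ) (n m : ℕ)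
    (h : n ≤ m) : a n ∣ partialSum a P m - partialSum a P n := by
  induction m, h using Nat.le_induction with
  | base => rw [sub_self]; exact dvd_zero _
  | succ m hm ih =>
    by_cases hP : m ∈ P
    · rw [partialSum_succ_of_mem hP, add_sub_right_comm]
      exact dvd_add ih (ha n m hm)
    · rwa [partialSum_succ_of_notMem hP]

/-- The sequences that are eventually divisible by `z`. -/
def eventuallyDvd (z : R) : Ideal (ℕ → R) where
  carrier := {f | ∃ n₀, ∀ n, n₀ ≤ n → z ∣ f n}
  zero_mem' := ⟨0, fun _ _ => dvd_zero _⟩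
  add_mem' := by
    rintro f g ⟨m, hm⟩ ⟨n, hn⟩
    exact ⟨m + n, fun i hi => dvd_add (hm i (by omega)) (hn i (by omega))⟩
  smul_mem' := by
    rintro f g ⟨n, hn⟩
    exact ⟨n, fun i hi => Dvd.dvd.mul_left (hn i hi) _⟩

variable [IsLocalRing R]

open IsLocalRing

theorem eq_zero_of_eq_mul_of_mem {x e : R} (he : e ∈ maximalIdeal R) (h : x = x * e) : x = 0 := by
  have h1 : IsUnit (1 - e) := by
    by_contra hnu
    have h2 := add_mem ((mem_maximalIdeal _).2 hnu) he
    rw [sub_add_cancel] at h2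
    exact (mem_maximalIdeal _).1 h2 isUnit_one
  have h2 : x * (1 - e) = 0 := by rw [mul_sub, mul_one, ← h, sub_self]
  exact (h1.mul_left_eq_zero).1 h2

/-- The independent scalars are sequences of partial sums of `a`, modulo sequences eventually
divisible by `z`. Since `a n * c n = z`, multiplication by `c n` makes such a sequence equal to its
`n`-th term. -/
theorem codesOperators_of_sequences [Countable R] {z : R} {a c r : ℕ → R} (hz : z ≠ 0)
    (hac : ∀ n, a n * c n = z) (hc : ∀ n, c n ∈ maximalIdeal R) (hr : ∀ n, r n ∈ maximalIdeal R)
    (ha : ∀ n, a (n + 1) = a n * r n) (hcr : ∀ n, c n = r n * c (n + 1)) (h0 : c 0 ∣ a 0)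
    (ha0 : a 0 ∈ maximalIdeal R) : CodesOperators R := by
  classical
  intro 𝔅 ι _ _ op
  have haa : ∀ d m, d < m → ∃ e ∈ maximalIdeal R, a m = a d * e := by
    intro d m h
    induction m, h using Nat.le_induction with
    | base => exact ⟨r d, hr d, ha d⟩
    | succ m _ ih =>
      obtain ⟨e, he, h⟩ := ih
      exact ⟨e * r m, Ideal.mul_mem_right _ _ he, by rw [ha, h, mul_assoc]⟩
  have hdvd : ∀ d m, d ≤ m → a d ∣ a m := by
    intro d m h
    rcases h.lt_or_eq with h | rfl
    · obtain ⟨e, -, he⟩ := haa d m h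
      exact ⟨e, he⟩
    · exact dvd_rfl
  -- The ideal quotient `(z : c n)`, the indeterminacy that remains after multiplication by `c n`.
  let J : ℕ → Ideal R := fun n => Submodule.comap (LinearMap.mulLeft R (c n)) (Ideal.span {z})
  have hJ : ∀ n t, t ∈ J n ↔ z ∣ c n * t := fun n t => Ideal.mem_span_singleton
  have hJanti : Antitone J := by
    refine antitone_nat_of_succ_le fun n t ht => ?_
    rw [hJ] at ht ⊢
    rw [hcr, mul_assoc]
    exact ht.mul_left _
  have haJ : ∀ d, ∃ n, a d ∉ J n := by
    refine fun d => ⟨d + 1, fun h => hz ?_⟩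
    rw [hJ] at h
    obtain ⟨t, ht⟩ := h
    refine eq_zero_of_eq_mul_of_mem (Ideal.mul_mem_right t _ (hr d)) ?_
    calc z = r d * (c (d + 1) * a d) := by rw [← hac (d + 1), ha]; ring
      _ = z * (r d * t) := by rw [ht]; ring
  obtain ⟨Z, hZ⟩ := exists_independent_partialSums hJanti haa haJ (ι × Bool)
  have hps : ∀ P n, a 0 ∣ partialSum a P n := fun P n => by
    have := dvd_partialSum_sub hdvd P 0 n (Nat.zero_le n)
    rwa [show partialSum a P 0 = 0 from Finset.sum_range_zero _, sub_zero] at this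
  have hzero : ∀ t, algebraMap R (ResidueField R × ((ℕ → R) ⧸ eventuallyDvd z)) t = 0 → z ∣ t := by
    intro t ht
    have h1 : Ideal.Quotient.mk (eventuallyDvd z) (fun _ => t) = 0 := congrArg Prod.snd ht
    rw [Ideal.Quotient.eq_zero_iff_mem] at h1
    obtain ⟨n₀, hn₀⟩ := h1
    exact hn₀ n₀ le_rfl
  have hres : ∀ t, RingHom.fst (ResidueField R) ((ℕ → R) ⧸ eventuallyDvd z)
      (algebraMap R _ t) = residue R t := fun t => rfl
  have hα : ∀ (i : ι × Bool) n, c n • ((0, Ideal.Quotient.mk (eventuallyDvd z)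
      (partialSum a (Z i))) : ResidueField R × ((ℕ → R) ⧸ eventuallyDvd z)) =
      algebraMap R _ (c n * partialSum a (Z i) n) := by
    intro i n
    refine Prod.ext ?_ ?_
    · change c n • (0 : ResidueField R) = residue R (c n * partialSum a (Z i) n)
      rw [smul_zero, map_mul, (residue_eq_zero_iff _).2 (hc n), zero_mul]
    · change Ideal.Quotient.mk (eventuallyDvd z) (c n • partialSum a (Z i)) =
        Ideal.Quotient.mk (eventuallyDvd z) fun _ => c n * partialSum a (Z i) n
      rw [Ideal.Quotient.eq]
      refine ⟨n, fun m hm => ?_⟩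
      change z ∣ c n * partialSum a (Z i) m - c n * partialSum a (Z i) n
      rw [← mul_sub, ← hac n, mul_comm (a n)]
      exact mul_dvd_mul_left _ (dvd_partialSum_sub hdvd _ n m hm)
  -- The residue field factor supplies the reduction, in which all `ζ` vanish. Products of an `α`
  -- and a `ζ` vanish because partial sums are multiples of `a 0` and `z = a 0 * c 0` divides `a 0 *
  -- a 0`.
  refine codesOperator_of_approximation (S := ResidueField R × ((ℕ → R) ⧸ eventuallyDvd z)) op
    (RingHom.fst _ _) (ζ := fun i => (0, Ideal.Quotient.mk _ (partialSum a (Z i))))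
    (α := fun i => partialSum a (Z i)) (c := c) (fun x => ?_) (fun i => rfl) (fun i => ?_) hα
    (fun i n j => ?_) (fun t ht => ?_) ?_
  · obtain ⟨t, rfl⟩ := residue_surjective x
    exact ⟨t, rfl⟩
  · rw [hα, show partialSum a (Z i) 0 = 0 from Finset.sum_range_zero _, mul_zero, map_zero]
  · refine Prod.ext (mul_zero _) ?_
    change Ideal.Quotient.mk (eventuallyDvd z)
      ((fun _ => partialSum a (Z i) n) * partialSum a (Z j)) = 0
    rw [Ideal.Quotient.eq_zero_iff_mem]
    refine ⟨0, fun m _ => ?_⟩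
    refine Dvd.dvd.trans ?_ (mul_dvd_mul (hps (Z i) n) (hps (Z j) m))
    rw [← hac 0]
    exact mul_dvd_mul_left _ h0
  · rw [hres, residue_eq_zero_iff, mem_maximalIdeal]
    intro hu
    have h1 := hu.dvd_mul_right.1 (hzero _ ht)
    obtain ⟨s, hs⟩ := h1
    have h2 : c 0 = c 0 * (a 0 * s) := by
      calc c 0 = z * s := hs
        _ = _ := by rw [← hac 0]; ring
    have h3 := eq_zero_of_eq_mul_of_mem (Ideal.mul_mem_right s _ ha0) h2
    exact hz (by rw [← hac 0, h3, mul_zero])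
  · intro s j hj x y t w w' h
    -- The coefficients `x` and `y` are moved to index `j`, so that independence puts `w j - x` and
    -- `w' j - y` into the maximal ideal.
    have hrel := hZ (s ×ˢ Finset.univ) (fun i => (if i.2 then w' i.1 else w i.1) -
      if i.1 = j then (if i.2 then y else x) else 0) (-t) (fun n => by
        rw [hJ]
        convert hzero _ (h n) using 2
        rw [Finset.sum_product]
        simp only [Fintype.sum_bool, if_true, Bool.false_eq_true, if_false, sub_mul, ite_mul,
          zero_mul]
        have h1 : ∀ i ∈ s, (w' i * partialSum a (Z (i, true)) n -
            (if i = j then y * partialSum a (Z (i, true)) n else 0) +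
            (w i * partialSum a (Z (i, false)) n -
            if i = j then x * partialSum a (Z (i, false)) n else 0)) =
            (partialSum a (Z (i, false)) n * w i + partialSum a (Z (i, true)) n * w' i) -
            if i = j then (partialSum a (Z (j, false)) n * x + partialSum a (Z (j, true)) n * y)
              else 0 := by
          intro i _
          split_ifs with e
          · subst e; ring
          · ring
        rw [Finset.sum_congr rfl h1, Finset.sum_sub_distrib, Finset.sum_ite_eq' s j, if_pos hj]
        ring)
    have h1 := hrel (j, false) (by simp [hj])
    have h2 := hrel (j, true) (by simp [hj])
    simp only [if_true, Bool.false_eq_true, if_false] at h1 h2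
    rw [hres, hres, hres, hres, ← sub_eq_zero, ← map_sub, residue_eq_zero_iff, ← sub_eq_zero (b :=
      residue R y), ← map_sub, residue_eq_zero_iff]
    exact ⟨h1, h2⟩

/-- Countable local rings in which divisibility is total and whose maximal ideal is not principal
code operators. -/
theorem codesOperators_of_dvd_total [Countable R] (hchain : ∀ a b : R, a ∣ b ∨ b ∣ a)
    (hm : ¬ (maximalIdeal R).IsPrincipal) : CodesOperators R := by
  -- As `x` does not generate the maximal ideal, some `y` in it is not a multiple of `x`; by total
  -- divisibility `x` is a multiple of `y`, and the cofactor is not a unit.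
  have hfac : ∀ x : {x : R // x ∈ maximalIdeal R ∧ x ≠ 0}, ∃ r ∈ maximalIdeal R,
      ∃ y : {x : R // x ∈ maximalIdeal R ∧ x ≠ 0}, (x : R) = r * y := by
    rintro ⟨x, hx, hx0⟩
    obtain ⟨y, hy, hxy⟩ : ∃ y ∈ maximalIdeal R, ¬ x ∣ y := by
      by_contra! h
      refine hm ⟨⟨x, le_antisymm (fun y hy => Ideal.mem_span_singleton.2 (h y hy)) ?_⟩⟩
      exact (Ideal.span_singleton_le_iff_mem _).2 hx
    obtain ⟨t, rfl⟩ := (hchain x y).resolve_left hxy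
    refine ⟨t, ?_, ⟨y, hy, left_ne_zero_of_mul hx0⟩, mul_comm _ _⟩
    rw [mem_maximalIdeal]
    intro hu
    exact hxy (hu.mul_right_dvd.2 dvd_rfl)
  obtain ⟨z, hz, hz0⟩ : ∃ z ∈ maximalIdeal R, z ≠ 0 := by
    by_contra! h
    exact hm ⟨⟨0, by rw [Submodule.span_singleton_eq_bot.2 rfl]; exact (Submodule.eq_bot_iff _).2 h⟩⟩
  -- Factor `z` and name the factors so that `c₀` divides `a₀`; from here nonunit factors are moved
  -- repeatedly from `c` to `a`.
  obtain ⟨a₀, c₀, ha₀, hac, hdvd⟩ : ∃ (a₀ : R) (c₀ : {x : R // x ∈ maximalIdeal R ∧ x ≠ 0}),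
      a₀ ∈ maximalIdeal R ∧ a₀ * c₀ = z ∧ (c₀ : R) ∣ a₀ := by
    obtain ⟨b, hb, ⟨c, hc, hc0⟩, h⟩ := hfac ⟨z, hz, hz0⟩
    change z = b * c at h
    have hb0 : b ≠ 0 := fun hb0 => hz0 (by rw [h, hb0, zero_mul])
    rcases hchain c b with hd | hd
    · exact ⟨b, ⟨c, hc, hc0⟩, hb, h.symm, hd⟩
    · exact ⟨c, ⟨b, hb, hb0⟩, hc, by rw [h, mul_comm], hd⟩
  choose r hr y hy using hfac
  let c : ℕ → {x : R // x ∈ maximalIdeal R ∧ x ≠ 0} := fun n => Nat.rec c₀ (fun _ x => y x) n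
  have hc : ∀ n, (c n).1 = r (c n) * (c (n + 1)).1 := fun n => hy (c n)
  let a : ℕ → R := fun n => Nat.rec a₀ (fun n x => x * r (c n)) n
  have ha : ∀ n, a (n + 1) = a n * r (c n) := fun n => rfl
  refine codesOperators_of_sequences (a := a) (c := fun n => (c n).1) (r := fun n => r (c n)) hz0
    (fun n => ?_) (fun n => (c n).2.1) (fun n => hr _) ha hc hdvd ha₀
  induction n with
  | zero => exact hac
  | succ n ih => rw [ha, mul_assoc, ← hc, ih]

end Chain

end CountableModels


/-! ### Two incomparable elements: polynomial modules inside `R`-modules -/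

namespace CountableModels

universe u

open IsLocalRing Polynomial

section Incomparable

variable {R : Type u} [CommRing R] [IsLocalRing R] (a b : R)

section Relations

variable (V : Type u) [AddCommGroup V] [Module (ResidueField R)[X] V] [Module R V]
  [IsScalarTower R (ResidueField R)[X] V]

/-- The evaluation of formal linear combinations. -/
noncomputable def formalEval : (V →₀ R) →ₗ[R] V := Finsupp.linearCombination R id

/-- The relations that identify multiplication by `X` with `b / a`. -/
def quotRel : Submodule R (V →₀ R) where
  carrier := {x | ∃ α β : V →₀ R, x = a • α + b • β ∧
    formalEval V α + (X : (ResidueField R)[X]) • formalEval V β = 0}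
  zero_mem' := ⟨0, 0, by simp, by simp⟩
  add_mem' := by
    rintro _ _ ⟨α, β, rfl, h⟩ ⟨α', β', rfl, h'⟩
    refine ⟨α + α', β + β', ?_, ?_⟩
    · rw [smul_add, smul_add, add_add_add_comm]
    · rw [map_add, map_add, smul_add, add_add_add_comm, h, h', add_zero]
  smul_mem' := by
    rintro r _ ⟨α, β, rfl, h⟩
    refine ⟨r • α, r • β, ?_, ?_⟩
    · rw [smul_add, smul_comm r, smul_comm r]
    · rw [map_smul, map_smul, smul_comm _ r, ← smul_add, h, smul_zero]

/-- The `R`-module in which multiplication by `X` on `V` becomes `b / a`. -/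
abbrev FractionModule : Type u := (V →₀ R) ⧸ quotRel a b V

variable {V}

theorem smul_eq_zero_of_mem_maximalIdeal {r : R} (hr : r ∈ maximalIdeal R) (v : V) : r • v = 0 := by
  rw [← algebraMap_smul (ResidueField R)[X] r v, Polynomial.algebraMap_apply,
    ResidueField.algebraMap_eq, (residue_eq_zero_iff r).2 hr, map_zero, zero_smul]

omit [IsLocalRing R] [Module (ResidueField R)[X] V] [IsScalarTower R (ResidueField R)[X] V] in
theorem formalEval_single (v : V) (r : R) : formalEval V (.single v r) = r • v :=
  Finsupp.linearCombination_single ..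

theorem formalEval_eq_zero {x : V →₀ R} (hx : ∀ v, x v ∈ maximalIdeal R) : formalEval V x = 0 :=
  Finset.sum_eq_zero fun v _ => smul_eq_zero_of_mem_maximalIdeal (hx v) v

variable {a b}

/-- A unit coefficient would give a divisibility between `a` and `b`. Hence `a • α + b • β`
determines `α` and `β` up to coefficients in the maximal ideal, which `formalEval` does not see. -/
theorem mem_maximalIdeal_of_smul_add_smul_eq_zero (hab : ¬ a ∣ b) (hba : ¬ b ∣ a) {s t : R}
    (h : a * s + b * t = 0) : s ∈ maximalIdeal R ∧ t ∈ maximalIdeal R := by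
  simp only [mem_maximalIdeal, mem_nonunits_iff]
  refine ⟨fun hs => hba ?_, fun ht => hab ?_⟩
  · rw [← hs.dvd_mul_right, eq_neg_of_add_eq_zero_left h]
    exact (dvd_mul_right _ _).neg_right
  · rw [← ht.dvd_mul_right, eq_neg_of_add_eq_zero_right h]
    exact (dvd_mul_right _ _).neg_right

theorem formalEval_eq_zero_of_smul_add_smul_eq_zero (hab : ¬ a ∣ b) (hba : ¬ b ∣ a)
    {α β : V →₀ R} (h : a • α + b • β = 0) : formalEval V α = 0 ∧ formalEval V β = 0 := by
  have h1 : ∀ v, a * α v + b * β v = 0 := fun v => DFunLike.congr_fun h v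
  exact ⟨formalEval_eq_zero fun v => (mem_maximalIdeal_of_smul_add_smul_eq_zero hab hba (h1 v)).1,
    formalEval_eq_zero fun v => (mem_maximalIdeal_of_smul_add_smul_eq_zero hab hba (h1 v)).2⟩

theorem mem_maximalIdeal_of_not_dvd (hab : ¬ a ∣ b) : a ∈ maximalIdeal R := by
  rw [mem_maximalIdeal]
  exact fun h => hab h.dvd

theorem quotRel_le_ker (hab : ¬ a ∣ b) (hba : ¬ b ∣ a) :
    quotRel a b V ≤ LinearMap.ker (formalEval V) := by
  rintro _ ⟨α, β, rfl, -⟩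
  rw [LinearMap.mem_ker, map_add, map_smul, map_smul,
    smul_eq_zero_of_mem_maximalIdeal (mem_maximalIdeal_of_not_dvd hab),
    smul_eq_zero_of_mem_maximalIdeal (mem_maximalIdeal_of_not_dvd hba), add_zero]

/-- Multiplication by `X` is thus definable from the `R`-module structure of the quotient. -/
theorem smul_mk_eq_smul_mk_iff (hab : ¬ a ∣ b) (hba : ¬ b ∣ a) (x y : V →₀ R) :
    a • (quotRel a b V).mkQ x = b • (quotRel a b V).mkQ y ↔
      formalEval V x = (X : (ResidueField R)[X]) • formalEval V y := by
  rw [← map_smul, ← map_smul, ← sub_eq_zero, ← map_sub, Submodule.mkQ_apply,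
    Submodule.Quotient.mk_eq_zero]
  constructor
  · rintro ⟨α, β, h, h0⟩
    have h1 : a • (x - α) + b • (-y - β) = 0 := by
      rw [smul_sub, smul_sub, smul_neg]
      have := sub_eq_zero.2 h
      rw [← this]
      abel
    obtain ⟨h2, h3⟩ := formalEval_eq_zero_of_smul_add_smul_eq_zero hab hba h1
    rw [map_sub, sub_eq_zero] at h2 h3
    rw [map_neg] at h3
    rw [← h2, ← h3, smul_neg, ← sub_eq_add_neg, sub_eq_zero] at h0
    exact h0
  · intro h
    refine ⟨x, -y, by rw [smul_neg, sub_eq_add_neg], ?_⟩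
    rw [map_neg, smul_neg, h, add_neg_cancel]

end Relations

variable {a b} {V V' : Type u} [AddCommGroup V] [Module (ResidueField R)[X] V] [Module R V]
  [IsScalarTower R (ResidueField R)[X] V] [AddCommGroup V'] [Module (ResidueField R)[X] V']
  [Module R V'] [IsScalarTower R (ResidueField R)[X] V']

theorem formalEval_mapDomain (f : V →ₗ[(ResidueField R)[X]] V') (x : V →₀ R) :
    formalEval V' (Finsupp.lmapDomain R R f x) = f (formalEval V x) := by
  induction x using Finsupp.induction_linear with
  | zero => simp only [map_zero]
  | add x y hx hy => simp only [map_add, hx, hy]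
  | single v r =>
    rw [Finsupp.lmapDomain_apply, Finsupp.mapDomain_single, formalEval_single, formalEval_single,
      LinearMap.map_smul_of_tower]

theorem lmapDomain_mem_quotRel (f : V →ₗ[(ResidueField R)[X]] V') {x : V →₀ R}
    (hx : x ∈ quotRel a b V) : Finsupp.lmapDomain R R f x ∈ quotRel a b V' := by
  obtain ⟨α, β, rfl, h⟩ := hx
  refine ⟨Finsupp.lmapDomain R R f α, Finsupp.lmapDomain R R f β, ?_, ?_⟩
  · rw [map_add, map_smul, map_smul]
  · rw [formalEval_mapDomain, formalEval_mapDomain, ← map_smul, ← map_add, h, map_zero]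

/-- Outside the range of `f` the coefficients of `α` and `β` lie in the maximal ideal, so discarding
them does not change the evaluations. -/
theorem mem_quotRel_of_injective (hab : ¬ a ∣ b) (hba : ¬ b ∣ a)
    (f : V →ₗ[(ResidueField R)[X]] V') (hf : Function.Injective f) {x : V →₀ R}
    (hx : Finsupp.lmapDomain R R f x ∈ quotRel a b V') : x ∈ quotRel a b V := by
  obtain ⟨α, β, h, h0⟩ := hx
  have hres : ∀ γ : V' →₀ R, (∀ v ∉ Set.range f, γ v ∈ maximalIdeal R) →
      f (formalEval V (Finsupp.comapDomain f γ hf.injOn)) = formalEval V' γ := by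
    intro γ hγ
    rw [← formalEval_mapDomain, ← sub_eq_zero, ← map_sub]
    refine formalEval_eq_zero fun v => ?_
    rw [Finsupp.sub_apply, Finsupp.lmapDomain_apply]
    by_cases hv : v ∈ Set.range f
    · obtain ⟨w, rfl⟩ := hv
      rw [Finsupp.mapDomain_apply hf, Finsupp.comapDomain_apply, sub_self]
      exact zero_mem _
    · rw [Finsupp.mapDomain_of_notMem_range _ _ hv, zero_sub]
      exact neg_mem (hγ v hv)
  have hout : ∀ v ∉ Set.range f, α v ∈ maximalIdeal R ∧ β v ∈ maximalIdeal R := by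
    intro v hv
    apply mem_maximalIdeal_of_smul_add_smul_eq_zero hab hba
    have := DFunLike.congr_fun h v
    rw [Finsupp.lmapDomain_apply, Finsupp.mapDomain_of_notMem_range _ _ hv] at this
    exact this.symm
  refine ⟨Finsupp.comapDomain f α hf.injOn, Finsupp.comapDomain f β hf.injOn, ?_, hf ?_⟩
  · ext v
    have := DFunLike.congr_fun h (f v)
    rw [Finsupp.lmapDomain_apply, Finsupp.mapDomain_apply hf] at this
    exact this
  · rw [map_add, map_smul, hres α fun v hv => (hout v hv).1, hres β fun v hv => (hout v hv).2, h0,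
      map_zero]

/-- `ψ` preserves the relation `a • x = b • x'`, that is, the graph of `X`. Its instance with `x' =
0` says that evaluation zero is preserved, so `ψ` descends to evaluations. -/
theorem exists_linearMap_of_fraction (hab : ¬ a ∣ b) (hba : ¬ b ∣ a)
    (ψ : FractionModule a b V →ₗ[R] FractionModule a b V') : ∃ φ : V →ₗ[(ResidueField R)[X]] V', ∀ x y,
      ψ ((quotRel a b V).mkQ x) = (quotRel a b V').mkQ y →
        φ (formalEval V x) = formalEval V' y := by
  have hs : ∀ v, ∃ y, ψ ((quotRel a b V).mkQ (.single v 1)) = (quotRel a b V').mkQ y := fun v => by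
    obtain ⟨y, hy⟩ := (quotRel a b V').mkQ_surjective (ψ ((quotRel a b V).mkQ (.single v 1)))
    exact ⟨y, hy.symm⟩
  choose g hg using hs
  have hX : ∀ x x' y y', ψ ((quotRel a b V).mkQ x) = (quotRel a b V').mkQ y →
      ψ ((quotRel a b V).mkQ x') = (quotRel a b V').mkQ y' →
      formalEval V x = (X : (ResidueField R)[X]) • formalEval V x' →
      formalEval V' y = (X : (ResidueField R)[X]) • formalEval V' y' := by
    intro x x' y y' h h' hx
    rw [← smul_mk_eq_smul_mk_iff hab hba] at hx ⊢
    rw [← h, ← h', ← map_smul ψ, ← map_smul ψ, hx]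
  have h0 : ∀ x y, ψ ((quotRel a b V).mkQ x) = (quotRel a b V').mkQ y → formalEval V x = 0 →
      formalEval V' y = 0 := by
    intro x y h hx
    have := hX x 0 y 0 h (by rw [map_zero, map_zero, map_zero]) (by rw [hx, map_zero, smul_zero])
    rwa [map_zero, smul_zero] at this
  have hkey : ∀ x y, ψ ((quotRel a b V).mkQ x) = (quotRel a b V').mkQ y →
      formalEval V' (g (formalEval V x)) = formalEval V' y := by
    intro x y h
    rw [← sub_eq_zero, ← map_sub]
    refine h0 (.single (formalEval V x) 1 - x) _ ?_ ?_
    · rw [map_sub, map_sub, hg, h, map_sub]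
    · rw [map_sub, formalEval_single, one_smul, sub_self]
  have hadd : ∀ v w, formalEval V' (g (v + w)) = formalEval V' (g v) + formalEval V' (g w) := by
    intro v w
    have := hkey (.single v 1 + .single w 1) (g v + g w) (by
      rw [map_add, map_add, hg, hg, map_add])
    rwa [map_add, map_add, formalEval_single, formalEval_single, one_smul, one_smul] at this
  have hsmul : ∀ (r : R) v, formalEval V' (g (r • v)) = r • formalEval V' (g v) := by
    intro r v
    have := hkey (r • .single v 1) (r • g v) (by rw [map_smul, map_smul, hg, map_smul])
    rwa [map_smul, map_smul, formalEval_single, one_smul] at this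
  have hXs : ∀ v, formalEval V' (g ((X : (ResidueField R)[X]) • v)) =
      (X : (ResidueField R)[X]) • formalEval V' (g v) := by
    intro v
    refine hX _ _ _ _ (hg _) (hg _) ?_
    rw [formalEval_single, formalEval_single, one_smul, one_smul]
  have hC : ∀ (r : ResidueField R) v, formalEval V' (g ((C r : (ResidueField R)[X]) • v)) =
      (C r : (ResidueField R)[X]) • formalEval V' (g v) := by
    intro r v
    obtain ⟨r, rfl⟩ := residue_surjective r
    have := hsmul r v
    rwa [← algebraMap_smul (ResidueField R)[X] r v,
      ← algebraMap_smul (ResidueField R)[X] r (formalEval V' _), Polynomial.algebraMap_apply,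
      ResidueField.algebraMap_eq] at this
  refine ⟨{ toFun := fun v => formalEval V' (g v), map_add' := hadd, map_smul' := fun q v => ?_ },
    hkey⟩
  change formalEval V' (g (q • v)) = q • formalEval V' (g v)
  induction q using Polynomial.induction_on' with
  | add p q hp hq => rw [add_smul, add_smul, hadd, hp, hq]
  | monomial n r =>
    rw [← C_mul_X_pow_eq_monomial, mul_smul, mul_smul, hC]
    congr 1
    induction n with
    | zero => rw [pow_zero, one_smul, one_smul]
    | succ n ih => rw [pow_succ', mul_smul, mul_smul, hXs, ih]

omit [IsLocalRing R] [Module (ResidueField R)[X] V] [IsScalarTower R (ResidueField R)[X] V] in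
theorem formalEval_surjective : Function.Surjective (formalEval V : (V →₀ R) →ₗ[R] V) := fun v =>
  ⟨.single v 1, by rw [formalEval_single, one_smul]⟩

/-- A module over the polynomial ring is determined by the associated module over `R`. -/
theorem nonempty_fraction_equiv_iff (hab : ¬ a ∣ b) (hba : ¬ b ∣ a) :
    Nonempty (FractionModule a b V ≃ₗ[R] FractionModule a b V') ↔
      Nonempty (V ≃ₗ[(ResidueField R)[X]] V') := by
  constructor
  · rintro ⟨ψ⟩
    obtain ⟨φ, hφ⟩ := exists_linearMap_of_fraction hab hba ψ.toLinearMap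
    obtain ⟨φ', hφ'⟩ := exists_linearMap_of_fraction hab hba ψ.symm.toLinearMap
    refine ⟨LinearEquiv.ofLinearMap φ φ' (LinearMap.ext fun v => ?_) (LinearMap.ext fun v => ?_)⟩
    · obtain ⟨y, rfl⟩ := formalEval_surjective (R := R) v
      obtain ⟨x, hx⟩ := (quotRel a b V).mkQ_surjective (ψ.symm ((quotRel a b V').mkQ y))
      rw [LinearMap.comp_apply, hφ' y x hx.symm, hφ x y (by simp [hx])]
      rfl
    · obtain ⟨x, rfl⟩ := formalEval_surjective (R := R) v
      obtain ⟨y, hy⟩ := (quotRel a b V').mkQ_surjective (ψ ((quotRel a b V).mkQ x))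
      rw [LinearMap.comp_apply, hφ x y hy.symm, hφ' y x (by simp [hy])]
      rfl
  · rintro ⟨φ⟩
    refine ⟨Submodule.Quotient.equiv _ _ (Finsupp.domLCongr φ.toEquiv) ?_⟩
    ext y
    have hcoe : ∀ x : V →₀ R, (Finsupp.domLCongr φ.toEquiv : (V →₀ R) ≃ₗ[R] (V' →₀ R)) x =
        Finsupp.lmapDomain R R φ x := fun x => by
      rw [Finsupp.domLCongr_apply, Finsupp.domCongr_apply, Finsupp.equivMapDomain_eq_mapDomain]
      rfl
    constructor
    · rintro ⟨x, hx, rfl⟩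
      exact hcoe x ▸ lmapDomain_mem_quotRel (φ : V →ₗ[(ResidueField R)[X]] V') hx
    · intro hy
      obtain ⟨x, rfl⟩ := (Finsupp.domLCongr φ.toEquiv : (V →₀ R) ≃ₗ[R] (V' →₀ R)).surjective y
      exact ⟨x, mem_quotRel_of_injective hab hba (φ : V →ₗ[(ResidueField R)[X]] V') φ.injective
        (hcoe x ▸ hy), rfl⟩

end Incomparable

end CountableModels


/-! ### Transfer of the coding property -/

namespace CountableModels

universe u

open IsLocalRing Polynomial

section Submodules

variable {R : Type u} [CommRing R] [IsLocalRing R] (a b : R) {V : Type u} [AddCommGroup V]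
  [Module (ResidueField R)[X] V] [Module R V] [IsScalarTower R (ResidueField R)[X] V]

/-- The map from the module of fractions of a submodule to that of the whole module. -/
noncomputable def fractionMap (N : Submodule (ResidueField R)[X] V) :
    (N →₀ R) →ₗ[R] FractionModule a b V :=
  (quotRel a b V).mkQ ∘ₗ Finsupp.lmapDomain R R N.subtype

variable {a b}

theorem ker_fractionMap (hab : ¬ a ∣ b) (hba : ¬ b ∣ a) (N : Submodule (ResidueField R)[X] V) :
    LinearMap.ker (fractionMap a b N) = quotRel a b N := by
  ext x
  rw [LinearMap.mem_ker, fractionMap, LinearMap.comp_apply, Submodule.mkQ_apply,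
    Submodule.Quotient.mk_eq_zero]
  exact ⟨mem_quotRel_of_injective hab hba N.subtype N.injective_subtype,
    lmapDomain_mem_quotRel N.subtype⟩

/-- The module of fractions of a submodule embeds into that of the whole module. -/
noncomputable def fractionEquivRange (hab : ¬ a ∣ b) (hba : ¬ b ∣ a)
    (N : Submodule (ResidueField R)[X] V) :
    FractionModule a b N ≃ₗ[R] LinearMap.range (fractionMap a b N) :=
  (Submodule.quotEquivOfEq _ _ (ker_fractionMap hab hba N)).symm ≪≫ₗ
    (fractionMap a b N).quotKerEquivRange

theorem mem_range_fractionMap (N : Submodule (ResidueField R)[X] V) (w : FractionModule a b V) :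
    w ∈ LinearMap.range (fractionMap a b N) ↔
      ∃ x : V →₀ R, (x.support : Set V) ⊆ N ∧ (quotRel a b V).mkQ x = w := by
  constructor
  · rintro ⟨x, rfl⟩
    refine ⟨Finsupp.lmapDomain R R N.subtype x, fun v hv => ?_, rfl⟩
    by_contra h
    refine Finsupp.mem_support_iff.1 hv (Finsupp.mapDomain_of_notMem_range _ _ ?_)
    rintro ⟨y, rfl⟩
    exact h y.2
  · rintro ⟨x, hx, rfl⟩
    refine ⟨Finsupp.comapDomain N.subtype x N.injective_subtype.injOn, ?_⟩
    rw [fractionMap, LinearMap.comp_apply, Finsupp.lmapDomain_apply,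
      Finsupp.mapDomain_comapDomain _ N.injective_subtype]
    intro v hv
    exact ⟨⟨v, hx hv⟩, rfl⟩

theorem infinite_fractionModule [Infinite V] (hab : ¬ a ∣ b) (hba : ¬ b ∣ a) :
    Infinite (FractionModule a b V) := by
  refine Infinite.of_surjective ((quotRel a b V).liftQ (formalEval V) (quotRel_le_ker hab hba))
    fun v => ?_
  obtain ⟨x, rfl⟩ := formalEval_surjective (R := R) v
  exact ⟨(quotRel a b V).mkQ x, rfl⟩

end Submodules

theorem countable_polynomial {k : Type*} [CommRing k] [Countable k] : Countable k[X] :=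
  (basisMonomials k).repr.injective.countable

/-- A countable local ring with two elements that do not divide each other codes operators. -/
theorem codesOperators_of_not_dvd {R : Type u} [CommRing R] [IsLocalRing R] [Countable R]
    {a b : R} (hab : ¬ a ∣ b) (hba : ¬ b ∣ a) : CodesOperators R := by
  have : Countable (ResidueField R) := residue_surjective.countable
  have : Countable (ResidueField R)[X] := countable_polynomial
  have hX : ∀ r : (ResidueField R)[X], (∀ n, X ^ n ∣ r) → r = 0 := by
    intro r hr
    ext n
    exact X_pow_dvd_iff.1 (hr (n + 1)) n n.lt_succ_self
  intro 𝔅 ι _ _ op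
  obtain ⟨W, _, _, G, hG, hfin, hinf, hiso, k, _, _, hk⟩ :=
    -- Operators are coded over the polynomial ring of the residue field; the passage to fraction
    -- modules preserves and reflects isomorphism and respects submodules.
    codesOperators_of_prime (prime_X (R := ResidueField R)) hX 𝔅 ι op
  let : Module R W := Module.compHom W (algebraMap R (ResidueField R)[X])
  have : IsScalarTower R (ResidueField R)[X] W :=
    ⟨fun r q w => by
      rw [Algebra.smul_def, mul_smul]
      rfl⟩
  have hmono : ∀ B B', B ⊆ B' → G B ≤ G B' := by
    intro B B' h w hw
    obtain ⟨F, hF, hw⟩ := (hfin B w).1 hw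
    exact (hfin B' w).2 ⟨F, hF.trans h, hw⟩
  refine ⟨FractionModule a b W, inferInstance, inferInstance,
    fun B => LinearMap.range (fractionMap a b (G B)), ?_, ?_, ?_, ?_, k, ‹_›, ‹_›, ?_⟩
  · exact (fractionMap a b (G Set.univ)).surjective_rangeRestrict.countable
  · intro B w
    simp only [mem_range_fractionMap]
    constructor
    · rintro ⟨x, hx, rfl⟩
      classical
      choose! F hF hxF using fun v (hv : v ∈ x.support) => (hfin B v).1 (hx hv)
      refine ⟨x.support.biUnion F, ?_, x, fun v hv => ?_, rfl⟩
      · rw [Finset.coe_biUnion]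
        exact Set.iUnion₂_subset hF
      · exact hmono _ _ (by exact_mod_cast Finset.subset_biUnion_of_mem F hv) (hxF v hv)
    · rintro ⟨F, hF, x, hx, rfl⟩
      exact ⟨x, hx.trans (hmono _ _ hF), rfl⟩
  · intro B hB
    have := hinf B hB
    have := infinite_fractionModule (V := G B) hab hba
    exact (fractionEquivRange hab hba (G B)).toEquiv.infinite_iff.1 this
  · intro B B' hB hB' h
    obtain ⟨e⟩ := (nonempty_fraction_equiv_iff hab hba).2 (hiso B B' hB hB' h)
    exact ⟨(fractionEquivRange hab hba (G B)).symm ≪≫ₗ e ≪≫ₗ fractionEquivRange hab hba (G B')⟩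
  · rintro B B' hB hB' ⟨e⟩
    exact hk B B' hB hB' ((nonempty_fraction_equiv_iff hab hba).1
      ⟨fractionEquivRange hab hba (G B) ≪≫ₗ e ≪≫ₗ (fractionEquivRange hab hba (G B')).symm⟩)

/-- The property to code operators passes from a quotient ring to the ring. -/
theorem CodesOperators.of_surjective {R R₁ : Type u} [CommRing R] [CommRing R₁] (f : R →+* R₁)
    (hf : Function.Surjective f) (h : CodesOperators R₁) : CodesOperators R := by
  intro 𝔅 ι _ _ op
  obtain ⟨W, _, _, G, hG, hfin, hinf, hiso, k, _, _, hk⟩ := h 𝔅 ι op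
  let := f.toAlgebra
  let : Module R W := Module.compHom W f
  have : IsScalarTower R R₁ W := .of_algebraMap_smul fun _ _ => rfl
  refine ⟨W, inferInstance, inferInstance, fun B => (G B).restrictScalars R, hG, hfin, hinf, ?_,
    k, ‹_›, ‹_›, ?_⟩
  · intro B B' hB hB' h
    obtain ⟨e⟩ := hiso B B' hB hB' h
    exact ⟨(e.restrictScalars R : G B ≃ₗ[R] G B')⟩
  · rintro B B' hB hB' ⟨e⟩
    refine hk B B' hB hB' ⟨{ e with map_smul' := fun s x => ?_ }⟩
    obtain ⟨r, rfl⟩ := hf s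
    exact e.map_smul r x

/-! ### Local rings with principal maximal ideal -/

section Principal

variable {R : Type u} [CommRing R] [IsLocalRing R] {p : R}

/-- At the last power of `p` that divides `r`, the cofactor is outside the maximal ideal. -/
theorem exists_eq_mul_pow_of_not_dvd (hp : maximalIdeal R = Ideal.span {p}) {r : R} {n : ℕ}
    (h : ¬ p ^ n ∣ r) : ∃ (m : ℕ) (v : R), IsUnit v ∧ r = v * p ^ m := by
  induction n with
  | zero => exact absurd (by simp) h
  | succ n ih =>
    by_cases hn : p ^ n ∣ r
    · obtain ⟨v, rfl⟩ := hn
      refine ⟨n, v, ?_, mul_comm _ _⟩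
      by_contra hv
      rw [← mem_nonunits_iff, ← mem_maximalIdeal, hp, Ideal.mem_span_singleton] at hv
      exact h (by rw [pow_succ]; exact mul_dvd_mul_left _ hv)
    · exact ih hn

theorem isArtinianRing_and_isPrincipalIdealRing (hp : maximalIdeal R = Ideal.span {p})
    (hnil : IsNilpotent p) : IsArtinianRing R ∧ IsPrincipalIdealRing R := by
  classical
  obtain ⟨N, hN⟩ := hnil
  have hr : ∀ r : R, ∃ (m : ℕ) (v : R), IsUnit v ∧ r = v * p ^ m := by
    intro r
    by_cases h0 : r = 0
    · exact ⟨N, 1, isUnit_one, by rw [h0, hN, mul_zero]⟩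
    · exact exists_eq_mul_pow_of_not_dvd hp (n := N) (by rwa [hN, zero_dvd_iff])
  have hpir : IsPrincipalIdealRing R := by
    refine ⟨fun I => ?_⟩
    have hex : ∃ n, p ^ n ∈ I := ⟨N, hN ▸ zero_mem I⟩
    refine ⟨⟨p ^ Nat.find hex, le_antisymm (fun r hrI => ?_)
      ((Ideal.span_singleton_le_iff_mem _).2 (Nat.find_spec hex))⟩⟩
    obtain ⟨m, v, hv, rfl⟩ := hr r
    exact Ideal.mem_span_singleton.2 ((pow_dvd_pow p (Nat.find_min' hex
      ((Ideal.unit_mul_mem_iff_mem I hv).1 hrI))).mul_left v)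
  refine ⟨isArtinianRing_iff_isNilpotent_maximalIdeal R |>.2 ⟨N, ?_⟩, hpir⟩
  rw [hp, Ideal.span_singleton_pow, hN]
  exact Ideal.span_singleton_eq_bot.2 rfl

/-- The ideal of elements divisible by all powers of `p`. -/
def powDivisible (p : R) : Ideal R := ⨅ n : ℕ, Ideal.span {p ^ n}

omit [IsLocalRing R] in
theorem mem_powDivisible {r : R} : r ∈ powDivisible p ↔ ∀ n, p ^ n ∣ r := by
  simp only [powDivisible, Submodule.mem_iInf, Ideal.mem_span_singleton]

theorem not_pow_dvd_pow (hp : maximalIdeal R = Ideal.span {p}) (hnil : ¬ IsNilpotent p) (n : ℕ) :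
    ¬ p ^ (n + 1) ∣ p ^ n := by
  rintro ⟨s, hs⟩
  refine hnil ⟨n, ?_⟩
  refine eq_zero_of_eq_mul_of_mem (e := p * s) ?_ (by rwa [← mul_assoc, ← pow_succ])
  exact hp ▸ Ideal.mul_mem_right s _ (Ideal.mem_span_singleton_self p)

/-- Elements outside are units times powers of `p`, and so are their products; a non-nilpotent `p`
has strictly descending powers. -/
theorem isPrime_powDivisible (hp : maximalIdeal R = Ideal.span {p}) (hnil : ¬ IsNilpotent p) :
    (powDivisible p).IsPrime := by
  rw [Ideal.isPrime_iff]
  constructor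
  · rw [Ne, Ideal.eq_top_iff_one, mem_powDivisible]
    intro h
    exact not_pow_dvd_pow hp hnil 0 (by simpa using h 1)
  · intro x y hxy
    by_contra! h
    simp only [mem_powDivisible, not_forall] at h
    obtain ⟨⟨n, hn⟩, n', hn'⟩ := h
    obtain ⟨m, v, hv, rfl⟩ := exists_eq_mul_pow_of_not_dvd hp hn
    obtain ⟨m', v', hv', rfl⟩ := exists_eq_mul_pow_of_not_dvd hp hn'
    refine not_pow_dvd_pow hp hnil (m + m') ?_
    have := mem_powDivisible.1 hxy (m + m' + 1)
    rwa [mul_mul_mul_comm, ← pow_add, (hv.mul hv').dvd_mul_left] at this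

/-- Modulo `powDivisible p` the ring is a domain in which `p` is prime and only zero is divisible by
all its powers. -/
theorem codesOperators_of_not_isNilpotent [Countable R] (hp : maximalIdeal R = Ideal.span {p})
    (hnil : ¬ IsNilpotent p) : CodesOperators R := by
  have hprime := isPrime_powDivisible hp hnil
  have hmk : Function.Surjective (Ideal.Quotient.mk (powDivisible p)) :=
    Ideal.Quotient.mk_surjective
  have : Countable (R ⧸ powDivisible p) := hmk.countable
  -- The ideal factored out lies in every `(p ^ n)`, so divisibility by `p ^ n` lifts.
  have hdvd : ∀ n r, Ideal.Quotient.mk (powDivisible p) (p ^ n) ∣ Ideal.Quotient.mk _ r →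
      p ^ n ∣ r := by
    rintro n r ⟨s, hs⟩
    obtain ⟨s, rfl⟩ := hmk s
    rw [← map_mul, Ideal.Quotient.eq, mem_powDivisible] at hs
    exact (dvd_iff_dvd_of_dvd_sub (hs n)).2 (dvd_mul_right _ _)
  refine .of_surjective (Ideal.Quotient.mk (powDivisible p)) hmk
    (codesOperators_of_prime (p := Ideal.Quotient.mk _ p) ⟨?_, ?_, ?_⟩ ?_)
  · rw [Ne, Ideal.Quotient.eq_zero_iff_mem, mem_powDivisible]
    exact fun h => not_pow_dvd_pow hp hnil 1 (by simpa using h 2)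
  · intro hu
    have := hdvd 1 1 (by rw [pow_one, map_one]; exact hu.dvd)
    exact not_pow_dvd_pow hp hnil 0 (by simpa using this)
  · intro x y h
    obtain ⟨x, rfl⟩ := hmk x
    obtain ⟨y, rfl⟩ := hmk y
    rw [← map_mul] at h
    have hxy : x * y ∈ maximalIdeal R := by
      rw [hp, Ideal.mem_span_singleton, ← pow_one p]
      exact hdvd 1 _ (by rwa [pow_one])
    rw [← pow_one p] at h
    refine ((maximalIdeal.isMaximal R).isPrime.mem_or_mem hxy).imp ?_ ?_ <;>
      exact fun hx => map_dvd _ (Ideal.mem_span_singleton.1 (hp ▸ hx))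
  · intro r hr
    obtain ⟨r, rfl⟩ := hmk r
    rw [Ideal.Quotient.eq_zero_iff_mem, mem_powDivisible]
    exact fun n => hdvd n r (by rw [map_pow]; exact hr n)

end Principal

end CountableModels


theorem mainTheorem10 {R : Type*} [CommRing R] [Countable R] [IsLocalRing R]
    (hR : ¬ CountableModels.BorelComplete (CountableModels.moduleTheory R)) :
    IsArtinianRing R ∧ IsPrincipalIdealRing R := by
  have hcode : ¬ CountableModels.CodesOperators R := fun h => hR h.borelComplete
  by_cases hm : (IsLocalRing.maximalIdeal R).IsPrincipal
  · obtain ⟨p, hp⟩ := hm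
    refine CountableModels.isArtinianRing_and_isPrincipalIdealRing hp ?_
    by_contra hnil
    exact hcode (CountableModels.codesOperators_of_not_isNilpotent hp hnil)
  · refine absurd ?_ hcode
    by_cases hchain : ∀ a b : R, a ∣ b ∨ b ∣ a
    · exact CountableModels.codesOperators_of_dvd_total hchain hm
    · push Not at hchain
      obtain ⟨a, b, hab, hba⟩ := hchain
      exact CountableModels.codesOperators_of_not_dvd hab hba
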